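/- **Setting.** All logarithms are to base 2. Let $\mathcal X,\mathcal Y$ be finite alphabets and $P=P_{XY}$ a probability distribution on $\mathcal X\times\mathcal Y$ with marginals $P_X,P_Y$. For each block length $n$ let $0\le d=d_n\le n$ be an integer (the relative delay) with $d_n/n\to\delta$. The source blocks $(\mathbf X,\mathbf Y)\in\mathcal X^n\times\mathcal Y^n$ have the law $$P_d(\mathbf x,\mathbf y)=\prod_{i=1}^{d}P_Y(y_i)\cdot\prod_{i=1}^{n-d}P_{XY}(x_i,y_{i+d})\cdot\prod_{i=n-d+1}^{n}P_X(x_i).$$ For rates $R_x,R_y\ge 0$, every $\mathbf x\in\mathcal X^n$ is assigned a bin $f(\mathbf x)\in\{1,\dots,\lfloor 2^{nR_x}\rfloor\}$ and every $\mathbf y\in\mathcal Y^n$ a bin $g(\mathbf y)\in\{1,\dots,\lfloor 2^{nR_y}\rfloor\}$, all independently and uniformly at random. Given $f,g$ and the two bin indices, the MAP decoder (which knows $P$ and $d$) outputs a maximizer of $P_d(\mathbf x',\mathbf y')$ over all pairs with $f(\mathbf x')=f(\mathbf x)$, $g(\mathbf y')=g(\mathbf y)$. The universal decoder, which knows neither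 $P$ nor $d$, outputs a minimizer, over the same pairs, of $$q(\mathbf x,\mathbf y)=\min_{0\le k\le n}\max\{u_k-n(R_x+R_y),\;v_k-nR_x,\;w_k-nR_y\},$$ where, with $\hat H$ denoting empirical entropies (joint, conditional, or of one sequence), $$u_k=k\hat H(y_1^k)+(n-k)\hat H(x_1^{n-k},y_{k+1}^n)+k\hat H(x_{n-k+1}^n),$$ $$v_k=(n-k)\hat H(x_1^{n-k}|y_{k+1}^n)+k\hat H(x_{n-k+1}^n),\qquad w_k=k\hat H(y_1^k)+(n-k)\hat H(y_{k+1}^n|x_1^{n-k}).$$ In both decoders ties may be resolved in any way. Let $\bar P_{e,*}$ and $\bar P_{e,q}$ be the respective probabilities, over the source and the random bins, that the output differs from $(\mathbf X,\mathbf Y)$, and let $E_*(R_x,R_y)$, $E_q(R_x,R_y)$ be the limits of $-\frac1n\log\bar P_{e,*}$ and $-\frac1n\log\bar P_{e,q}$ as $n\to\infty$, if they exist. Assume the non-degeneracy condition that $H(X)>0$ and $H(Y)>0$, and that either $d_n\ge1$ for all large $n$, or both $H(X|Y)>0$ and $H(Y|X)>0$. For $\theta>0$, $\theta\ne1$, let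 $H_\theta(X)=\frac1{1-\theta}\log\sum_xP_X(x)^\theta$, and similarly $H_\theta(Y)$ and $H_\theta(X,Y)$ with $P_Y$ and $P_{XY}$; let $H_\theta(X|Y)=\frac\theta{1-\theta}\log\sum_y\big[\sum_xP_{XY}(x,y)^\theta\big]^{1/\theta}$, and $H_\theta(Y|X)$ likewise with the roles of $X$ and $Y$ interchanged. For $\theta=1$ these are the Shannon entropies. **Theorem 1.** (a) For all $R_x,R_y\ge0$, both error exponents $E_*(R_x,R_y)$ and $E_q(R_x,R_y)$ exist (as finite limits). (b) For all $R_x,R_y\ge0$, $E_q(R_x,R_y)=E_*(R_x,R_y)=\min\{E_{x|y}(R_x),E_{y|x}(R_y),E_{xy}(R_x,R_y)\}$, where $$E_{x|y}(R_x)=\max_{0\le\rho\le1}\rho\,[R_x-\delta H_{1/(1+\rho)}(X)-(1-\delta)H_{1/(1+\rho)}(X|Y)],$$ $$E_{y|x}(R_y)=\max_{0\le\rho\le1}\rho\,[R_y-\delta H_{1/(1+\rho)}(Y)-(1-\delta)H_{1/(1+\rho)}(Y|X)],$$ $$E_{xy}(R_x,R_y)=\max_{0\le\rho\le1}\rho\,[R_x+R_y-\delta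 H_{1/(1+\rho)}(X)-\delta H_{1/(1+\rho)}(Y)-(1-\delta)H_{1/(1+\rho)}(X,Y)].$$ Consequently, for every $E>0$ and for either decoder, the set of rate pairs $R_x,R_y\ge0$ whose error exponent is at least $E$ equals $$\{(R_x,R_y):\ R_x\ge\bar R_x(E),\ R_y\ge\bar R_y(E),\ R_x+R_y\ge\bar R_{xy}(E)\},$$ where $$\bar R_x(E)=\inf_{s\ge1}[sE+\delta H_{s/(1+s)}(X)+(1-\delta)H_{s/(1+s)}(X|Y)],$$ $$\bar R_y(E)=\inf_{s\ge1}[sE+\delta H_{s/(1+s)}(Y)+(1-\delta)H_{s/(1+s)}(Y|X)],$$ $$\bar R_{xy}(E)=\inf_{s\ge1}[sE+\delta H_{s/(1+s)}(X)+\delta H_{s/(1+s)}(Y)+(1-\delta)H_{s/(1+s)}(X,Y)].$$ -/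

import Mathlib

open Filter Topology

noncomputable section

namespace AsyncSW

/-! ### Information measures (all logarithms are to base 2) -/

/-- Marginal of the first coordinate. -/
def margFst {A B : Type*} [Fintype B] (p : A × B → ℝ) (a : A) : ℝ := ∑ b, p (a, b)

/-- Marginal of the second coordinate. -/
def margSnd {A B : Type*} [Fintype A] (p : A × B → ℝ) (b : B) : ℝ := ∑ a, p (a, b)

/-- Shannon entropy in bits. -/
def entropy {A : Type*} [Fintype A] (p : A → ℝ) : ℝ := -∑ a, p a * Real.logb 2 (p a)

/-- Conditional Shannon entropy of the first coordinate given the second one, in bits. -/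
def condEntropy {A B : Type*} [Fintype A] [Fintype B] (p : A × B → ℝ) : ℝ :=
  -∑ a, ∑ b, p (a, b) * Real.logb 2 (p (a, b) / margSnd p b)

/-- Rényi entropy of order `θ > 0`, in bits; at `θ = 1` it is the Shannon entropy. -/
def renyi {A : Type*} [Fintype A] (θ : ℝ) (p : A → ℝ) : ℝ :=
  if θ = 1 then entropy p else 1 / (1 - θ) * Real.logb 2 (∑ a, p a ^ θ)

/-- Conditional Rényi entropy of order `θ > 0` of the first coordinate given the second one,
in bits; at `θ = 1` it is the conditional Shannon entropy. -/
def condRenyi {A B : Type*} [Fintype A] [Fintype B] (θ : ℝ) (p : A × B → ℝ) : ℝ :=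
  if θ = 1 then condEntropy p
  else θ / (1 - θ) * Real.logb 2 (∑ b, (∑ a, p (a, b) ^ θ) ^ (1 / θ))

/-- The law of the pair with the two coordinates interchanged. -/
def swapLaw {A B : Type*} (p : A × B → ℝ) : B × A → ℝ := fun z => p (z.2, z.1)

/-! ### Segments and empirical entropies -/

/-- The first `m` letters of a block of length `n`. -/
def headSeg {A : Type*} {n : ℕ} (m : ℕ) (hm : m ≤ n) (z : Fin n → A) : Fin m → A :=
  fun i => z ⟨i, by omega⟩

/-- The last `m` letters of a block of length `n`. -/
def tailSeg {A : Type*} {n : ℕ} (m : ℕ) (hm : m ≤ n) (z : Fin n → A) : Fin m → A :=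
  fun i => z ⟨n - m + i, by omega⟩

/-- Empirical distribution of a finite sequence. -/
def empirical {A : Type*} [DecidableEq A] {m : ℕ} (z : Fin m → A) (a : A) : ℝ :=
  ((Finset.univ.filter fun i => z i = a).card : ℝ) / (m : ℝ)

/-- Empirical entropy. -/
def empEntropy {A : Type*} [Fintype A] [DecidableEq A] {m : ℕ} (z : Fin m → A) : ℝ :=
  entropy (empirical z)

/-- Empirical joint entropy of two sequences of the same length. -/
def empJoint {A B : Type*} [Fintype A] [Fintype B] [DecidableEq A] [DecidableEq B] {m : ℕ}
    (x : Fin m → A) (y : Fin m → B) : ℝ :=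
  entropy (empirical fun i => (x i, y i))

/-- Empirical conditional entropy of the first sequence given the second one. -/
def empCond {A B : Type*} [Fintype A] [Fintype B] [DecidableEq A] [DecidableEq B] {m : ℕ}
    (x : Fin m → A) (y : Fin m → B) : ℝ :=
  condEntropy (empirical fun i => (x i, y i))

section Model

variable {X Y : Type*} [Fintype X] [Fintype Y]

/-! ### The source -/

/-- Probability of the pair of blocks `(x, y)` of length `n` when the relative delay is `d`:
`∏_{i ≤ d} P_Y(y_i) · ∏_{i ≤ n-d} P_XY(x_i, y_{i+d}) · ∏_{i > n-d} P_X(x_i)`. -/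
def blockProb (P : X × Y → ℝ) {n : ℕ} (d : Fin (n + 1)) (x : Fin n → X) (y : Fin n → Y) : ℝ :=
  (∏ i, margSnd P (headSeg (d : ℕ) (by omega) y i)) *
  (∏ i, P (headSeg (n - (d : ℕ)) (by omega) x i, tailSeg (n - (d : ℕ)) (by omega) y i)) *
  (∏ i, margFst P (tailSeg (d : ℕ) (by omega) x i))

/-! ### Random binning and decoders -/

/-- Number of bins at rate `R` and block length `n`. -/
def numBins (n : ℕ) (R : ℝ) : ℕ := ⌊(2 : ℝ) ^ ((n : ℝ) * R)⌋₊

/-- A decoder knows both binning maps, receives the two bin indices and outputs two blocks. -/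
abbrev Decoder (X Y : Type*) (n Mx My : ℕ) : Type _ :=
  ((Fin n → X) → Fin Mx) → ((Fin n → Y) → Fin My) → Fin Mx → Fin My →
    (Fin n → X) × (Fin n → Y)

/-- `dec` outputs a minimizer of the metric `q` over the pairs of blocks that have the received
bin indices. Ties may be resolved in any way. -/
def IsMetricDecoder {n Mx My : ℕ} (q : (Fin n → X) → (Fin n → Y) → ℝ)
    (dec : Decoder X Y n Mx My) : Prop :=
  ∀ (f : (Fin n → X) → Fin Mx) (g : (Fin n → Y) → Fin My) (x : Fin n → X) (y : Fin n → Y),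
    f (dec f g (f x) (g y)).1 = f x ∧ g (dec f g (f x) (g y)).2 = g y ∧
      q (dec f g (f x) (g y)).1 (dec f g (f x) (g y)).2 ≤ q x y

/-- The MAP decoder that knows `P` and `d`: it maximizes the block probability over the pairs of
blocks that have the received bin indices. -/
def IsMAPDecoder (P : X × Y → ℝ) {n Mx My : ℕ} (d : Fin (n + 1))
    (dec : Decoder X Y n Mx My) : Prop :=
  IsMetricDecoder (fun x y => -blockProb P d x y) dec

variable [DecidableEq X] [DecidableEq Y]

/-- Average probability of error: the two binning maps are independent, each one uniform over all
maps (every block is given an independent uniform bin), and the pair of source blocks has law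
`blockProb P d`. -/
def errorProb (P : X × Y → ℝ) {n Mx My : ℕ} (d : Fin (n + 1)) (dec : Decoder X Y n Mx My) : ℝ :=
  (∑ f : (Fin n → X) → Fin Mx, ∑ g : (Fin n → Y) → Fin My, ∑ x : Fin n → X, ∑ y : Fin n → Y,
      if dec f g (f x) (g y) ≠ (x, y) then blockProb P d x y else 0) /
    ((Fintype.card ((Fin n → X) → Fin Mx) : ℝ) * (Fintype.card ((Fin n → Y) → Fin My) : ℝ))

/-! ### The universal metric -/

/-- `u_k = k Ĥ(y_1^k) + (n-k) Ĥ(x_1^{n-k}, y_{k+1}^n) + k Ĥ(x_{n-k+1}^n)`. -/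
def uMetric {n : ℕ} (k : Fin (n + 1)) (x : Fin n → X) (y : Fin n → Y) : ℝ :=
  (k : ℝ) * empEntropy (headSeg (k : ℕ) (by omega) y) +
  ((n : ℝ) - (k : ℝ)) *
    empJoint (headSeg (n - (k : ℕ)) (by omega) x) (tailSeg (n - (k : ℕ)) (by omega) y) +
  (k : ℝ) * empEntropy (tailSeg (k : ℕ) (by omega) x)

/-- `v_k = (n-k) Ĥ(x_1^{n-k} | y_{k+1}^n) + k Ĥ(x_{n-k+1}^n)`. -/
def vMetric {n : ℕ} (k : Fin (n + 1)) (x : Fin n → X) (y : Fin n → Y) : ℝ :=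
  ((n : ℝ) - (k : ℝ)) *
    empCond (headSeg (n - (k : ℕ)) (by omega) x) (tailSeg (n - (k : ℕ)) (by omega) y) +
  (k : ℝ) * empEntropy (tailSeg (k : ℕ) (by omega) x)

/-- `w_k = k Ĥ(y_1^k) + (n-k) Ĥ(y_{k+1}^n | x_1^{n-k})`. -/
def wMetric {n : ℕ} (k : Fin (n + 1)) (x : Fin n → X) (y : Fin n → Y) : ℝ :=
  (k : ℝ) * empEntropy (headSeg (k : ℕ) (by omega) y) +
  ((n : ℝ) - (k : ℝ)) *
    empCond (tailSeg (n - (k : ℕ)) (by omega) y) (headSeg (n - (k : ℕ)) (by omega) x)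

/-- `q_k = max {u_k - n (R_x + R_y), v_k - n R_x, w_k - n R_y}`. -/
def qMetricAt (Rx Ry : ℝ) {n : ℕ} (k : Fin (n + 1)) (x : Fin n → X) (y : Fin n → Y) : ℝ :=
  max (uMetric k x y - (n : ℝ) * (Rx + Ry))
    (max (vMetric k x y - (n : ℝ) * Rx) (wMetric k x y - (n : ℝ) * Ry))

/-- The universal decoding metric `q = min_{0 ≤ k ≤ n} q_k`. -/
def qMetric (Rx Ry : ℝ) {n : ℕ} (x : Fin n → X) (y : Fin n → Y) : ℝ :=
  Finset.univ.inf' Finset.univ_nonempty fun k : Fin (n + 1) => qMetricAt Rx Ry k x y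

end Model

/-! ### Error exponents -/

/-- The error probabilities `pe n` have the (finite) error exponent `e`. -/
def HasErrorExponent (pe : ℕ → ℝ) (e : ℝ) : Prop :=
  (∀ᶠ n in atTop, 0 < pe n) ∧ Tendsto (fun n : ℕ => -Real.logb 2 (pe n) / (n : ℝ)) atTop (𝓝 e)

section Formula

variable {X Y : Type*} [Fintype X] [Fintype Y]

/-- `δ H_θ(X) + (1-δ) H_θ(X|Y)`. -/
def mixX (P : X × Y → ℝ) (δ θ : ℝ) : ℝ :=
  δ * renyi θ (margFst P) + (1 - δ) * condRenyi θ P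

/-- `δ H_θ(Y) + (1-δ) H_θ(Y|X)`. -/
def mixY (P : X × Y → ℝ) (δ θ : ℝ) : ℝ :=
  δ * renyi θ (margSnd P) + (1 - δ) * condRenyi θ (swapLaw P)

/-- `δ H_θ(X) + δ H_θ(Y) + (1-δ) H_θ(X,Y)`. -/
def mixXY (P : X × Y → ℝ) (δ θ : ℝ) : ℝ :=
  δ * renyi θ (margFst P) + δ * renyi θ (margSnd P) + (1 - δ) * renyi θ P

end Formula

/-- The values `ρ [R - G(1/(1+ρ))]`, `0 ≤ ρ ≤ 1`. -/
def gallagerSet (G : ℝ → ℝ) (R : ℝ) : Set ℝ :=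
  (fun ρ : ℝ => ρ * (R - G (1 / (1 + ρ)))) '' Set.Icc 0 1

/-- `max_{0 ≤ ρ ≤ 1} ρ [R - G(1/(1+ρ))]`. -/
def gallagerExp (G : ℝ → ℝ) (R : ℝ) : ℝ := sSup (gallagerSet G R)

/-- `inf_{s ≥ 1} [s E + G(s/(1+s))]`. -/
def rateThreshold (G : ℝ → ℝ) (E : ℝ) : ℝ :=
  sInf ((fun s : ℝ => s * E + G (s / (1 + s))) '' Set.Ici 1)

end AsyncSW

end

/-!
The probability of a pair of blocks is a product over three segments (head of `y`, overlap, tail of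
`x`), and the three kinds of errors (in `x` only, in `y` only, in both) differ only in the map `π`
on each segment that keeps what is decoded correctly: `Prod.snd`, `Prod.fst`, a constant, or `id`.
All entropies are conditional entropies `condEnt π` of a letter given its image under `π`, and `ρ`
times the Rényi entropies of order `1 / (1 + ρ)` are the functions `gallagerFn π`, which satisfy
`Γ(ρ) = max_q (ρ H(q) - D(q‖p))`, the maximum being attained at an explicit tilted law.

*Upper bound.* The empirical entropies satisfy a Kraft-type inequality with a polynomial constant,
so for each hypothetical delay few pairs have a small metric. The union bound over competitors and
over the `n + 1` delays bounds the probability of error given `(x, y)` by a polynomial times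
`min(1, 2^q)`, where `q` may be taken at the true delay. As `min(1, 2^q) ≤ 2^{ρ q}` for
`ρ ∈ [0, 1]`, and an empirical entropy is at most the code length of the tilted kernel, this gives
Gallager's bound for each kind of error (`errorProb_universal_le`). The MAP decoder has the least
error probability of all decoders, so it obeys the same bound.

*Lower bound, for every decoder.* If several pairs of blocks share both bin indices, at most one of
them is decoded correctly. With a second-moment estimate for the number of collisions under random
binning, this shows that in a set `T` of pairs which agree in one block, the error probabilities
average to at least a constant times `min(1, |T| / M)`, and a similar bound holds for sets in which
few pairs agree in either block. With `T` made of typical pairs for a product law `q`, a change of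
measure gives the exponent `D(q‖p) + (R - H(q))⁺` (`expLowerBound_of_fibers`,
`expLowerBound_joint_of_le`). At the tilted law for the maximizing `ρ`, where
`(R - H)⁺ = ρ (R - H)`, this is exactly `ρ R - Γ(ρ)` (`exists_tilt_gallagerExp`).

The non-degeneracy condition enters where the entropy rate under `q` vanishes. Then `δ = 0`, each
paired letter is determined by the letter of the other source, and the only ambiguity is in the
unpaired letters, of which at least one exists; two values of a single unpaired letter are confused
with probability of order `2^{-nR}` (`expLowerBound_unpaired_fst`, `expLowerBound_unpaired_snd`),
which suffices because the exponent is then at least `R`.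

The rate region follows by the substitution `s = 1 / ρ` (`le_gallagerExp_iff`).
-/

set_option linter.unusedSectionVars false

noncomputable section

namespace AsyncSW

/-! ### Entropies relative to a map on a finite alphabet -/

section Letter

variable {Z B : Type*} [Fintype Z] [Fintype B] [DecidableEq B]

/-- Total mass of `q` on the fibre of `π` over `b`; for a law `q` it is the law of `π`. -/
def fibSum (π : Z → B) (q : Z → ℝ) (b : B) : ℝ := ∑ z with π z = b, q z

/-- Conditional entropy, in bits, of a letter with law `q` given its image under `π`. The maps
`Prod.snd`, `Prod.fst` and a constant map give `H(X|Y)`, `H(Y|X)` and the plain entropy, and an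
injective `π` gives `0`; so the error events of the decoder differ only in the choice of `π`. -/
def condEnt (π : Z → B) (q : Z → ℝ) : ℝ :=
  -∑ z, q z * Real.logb 2 (q z / fibSum π q (π z))

/-- Relative entropy in bits. -/
def relEnt (q p : Z → ℝ) : ℝ := ∑ z, q z * Real.logb 2 (q z / p z)

/-- The normalizer `∑_{z : π z = b} p(z)^{1/(1+ρ)}` of the tilted kernel. -/
def tiltNorm (π : Z → B) (p : Z → ℝ) (ρ : ℝ) (b : B) : ℝ :=
  fibSum π (fun z => p z ^ (1 / (1 + ρ))) b

/-- The sum `∑_b (∑_{z : π z = b} p(z)^{1/(1+ρ)})^{1+ρ}`. -/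
def tiltTotal (π : Z → B) (p : Z → ℝ) (ρ : ℝ) : ℝ := ∑ b, tiltNorm π p ρ b ^ (1 + ρ)

/-- Gallager's source function: `ρ` times the conditional Rényi entropy of order `1/(1+ρ)`. -/
def gallagerFn (π : Z → B) (p : Z → ℝ) (ρ : ℝ) : ℝ := Real.logb 2 (tiltTotal π p ρ)

/-- The tilted conditional law of a letter given its image under `π`. -/
def tiltKer (π : Z → B) (p : Z → ℝ) (ρ : ℝ) (z : Z) : ℝ :=
  p z ^ (1 / (1 + ρ)) / tiltNorm π p ρ (π z)

/-- The tilted law, which maximizes `ρ H(q) - D(q‖p)` over all laws `q`. -/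
def tiltLaw (π : Z → B) (p : Z → ℝ) (ρ : ℝ) (z : Z) : ℝ :=
  p z ^ (1 / (1 + ρ)) * tiltNorm π p ρ (π z) ^ ρ / tiltTotal π p ρ

lemma fibSum_nonneg (π : Z → B) {q : Z → ℝ} (hq : ∀ z, 0 ≤ q z) (b : B) : 0 ≤ fibSum π q b :=
  Finset.sum_nonneg fun z _ => hq z

lemma le_fibSum (π : Z → B) {q : Z → ℝ} (hq : ∀ z, 0 ≤ q z) (z : Z) : q z ≤ fibSum π q (π z) :=
  Finset.single_le_sum (f := q) (fun z _ => hq z) (by simp)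

lemma fibSum_pos (π : Z → B) {q : Z → ℝ} (hq : ∀ z, 0 ≤ q z) {z : Z} (hz : 0 < q z) :
    0 < fibSum π q (π z) :=
  hz.trans_le (le_fibSum π hq z)

lemma sum_fibSum (π : Z → B) (q : Z → ℝ) : ∑ b, fibSum π q b = ∑ z, q z :=
  Finset.sum_fiberwise Finset.univ π q

lemma fibSum_mul_comp (π : Z → B) (g : B → ℝ) (q : Z → ℝ) (b : B) :
    fibSum π (fun z => q z * g (π z)) b = fibSum π q b * g b := by
  unfold fibSum
  rw [Finset.sum_mul]
  refine Finset.sum_congr rfl fun z hz => ?_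
  simp only [(Finset.mem_filter.1 hz).2]

lemma sum_mul_comp (π : Z → B) (g : B → ℝ) (q : Z → ℝ) :
    ∑ z, q z * g (π z) = ∑ b, fibSum π q b * g b := by
  rw [← sum_fibSum π]
  exact Finset.sum_congr rfl fun b _ => fibSum_mul_comp π g q b

/-- Gibbs' inequality. -/
lemma sum_mul_logb_le {q r : Z → ℝ} (hq : ∀ z, 0 ≤ q z) (hr : ∀ z, 0 ≤ r z)
    (hsum : ∑ z, r z ≤ ∑ z, q z) (hqr : ∀ z, 0 < q z → 0 < r z) :
    ∑ z, q z * Real.logb 2 (r z) ≤ ∑ z, q z * Real.logb 2 (q z) := by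
  have hlog : 0 < Real.log 2 := Real.log_pos one_lt_two
  have key : ∀ z, q z * Real.logb 2 (r z) - q z * Real.logb 2 (q z) ≤ (r z - q z) / Real.log 2 := by
    intro z
    rcases (hq z).eq_or_lt with h | h
    · rw [← h]
      simpa using div_nonneg (hr z) hlog.le
    · have hrz := hqr z h
      have h1 := Real.log_le_sub_one_of_pos (div_pos hrz h)
      rw [Real.log_div hrz.ne' h.ne'] at h1
      have h2 : q z * (Real.log (r z) - Real.log (q z)) ≤ r z - q z := by
        calc q z * (Real.log (r z) - Real.log (q z)) ≤ q z * (r z / q z - 1) := by gcongr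
          _ = r z - q z := by field_simp
      unfold Real.logb
      rw [le_div_iff₀ hlog]
      calc _ = q z * (Real.log (r z) - Real.log (q z)) := by field_simp
        _ ≤ _ := h2
  have h := Finset.sum_le_sum fun z (_ : z ∈ Finset.univ) => key z
  rw [Finset.sum_sub_distrib, ← Finset.sum_div, Finset.sum_sub_distrib] at h
  have : (∑ z, r z - ∑ z, q z) / Real.log 2 ≤ 0 :=
    div_nonpos_of_nonpos_of_nonneg (by linarith) hlog.le
  linarith

/-- The conditional entropy is at most the ideal code length of any conditional law `w`. -/
lemma condEnt_le_cross (π : Z → B) {q w : Z → ℝ} (hq : ∀ z, 0 ≤ q z) (hw : ∀ z, 0 ≤ w z)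
    (hw1 : ∀ b, fibSum π w b ≤ 1) (hqw : ∀ z, 0 < q z → 0 < w z) :
    condEnt π q ≤ -∑ z, q z * Real.logb 2 (w z) := by
  have h := sum_mul_logb_le (q := q) (r := fun z => w z * fibSum π q (π z)) hq
    (fun z => mul_nonneg (hw z) (fibSum_nonneg π hq _)) ?_
    (fun z hz => mul_pos (hqw z hz) (fibSum_pos π hq hz))
  · unfold condEnt
    rw [neg_le_neg_iff, ← sub_nonneg, ← Finset.sum_sub_distrib]
    rw [← sub_nonneg, ← Finset.sum_sub_distrib] at h
    refine h.trans_eq (Finset.sum_congr rfl fun z _ => ?_)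
    rcases (hq z).eq_or_lt with h0 | h0
    · simp [← h0]
    · have := fibSum_pos π hq h0
      rw [Real.logb_mul (hqw z h0).ne' this.ne', Real.logb_div h0.ne' this.ne']
      ring
  · rw [sum_mul_comp π (fibSum π q) w, ← sum_fibSum π q]
    exact Finset.sum_le_sum fun b _ => mul_le_of_le_one_left (fibSum_nonneg π hq b) (hw1 b)

lemma condEnt_nonneg (π : Z → B) {q : Z → ℝ} (hq : ∀ z, 0 ≤ q z) : 0 ≤ condEnt π q := by
  unfold condEnt
  rw [Left.nonneg_neg_iff]
  refine Finset.sum_nonpos fun z _ => mul_nonpos_of_nonneg_of_nonpos (hq z) ?_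
  have h : q z / fibSum π q (π z) ≤ 1 := div_le_one_of_le₀ (le_fibSum π hq z) (fibSum_nonneg π hq _)
  exact Real.logb_nonpos one_lt_two (div_nonneg (hq z) (fibSum_nonneg π hq _)) h

/-- The conditional entropy is positive exactly when some fibre holds two letters of positive
mass; so it depends on the support only. -/
lemma condEnt_pos_iff (π : Z → B) {q : Z → ℝ} (hq : ∀ z, 0 ≤ q z) :
    0 < condEnt π q ↔ ∃ z z', z ≠ z' ∧ π z = π z' ∧ 0 < q z ∧ 0 < q z' := by
  classical
  constructor
  · intro h
    by_contra! hne
    refine h.ne' ?_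
    unfold condEnt
    rw [neg_eq_zero]
    refine Finset.sum_eq_zero fun z _ => ?_
    rcases (hq z).eq_or_lt with h0 | h0
    · simp [← h0]
    · have : fibSum π q (π z) = q z := by
        refine Finset.sum_eq_single_of_mem z (by simp) fun z' hz' hzz' => ?_
        exact le_antisymm (hne z z' hzz'.symm (Finset.mem_filter.1 hz').2.symm h0) (hq z')
      rw [this, div_self h0.ne']
      simp
  · rintro ⟨z, z', hzz', hπ, hz, hz'⟩
    have hlt : q z < fibSum π q (π z) := by
      have : q z + q z' ≤ fibSum π q (π z) := by
        rw [← Finset.sum_pair hzz']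
        refine Finset.sum_le_sum_of_subset_of_nonneg ?_ fun i _ _ => hq i
        intro i hi
        rcases Finset.mem_insert.1 hi with rfl | hi
        · simp
        · rw [Finset.mem_singleton.1 hi]
          simp [hπ]
      linarith
    unfold condEnt
    rw [← Finset.sum_neg_distrib]
    refine Finset.sum_pos' (fun i _ => ?_) ⟨z, Finset.mem_univ _, ?_⟩
    · rw [← mul_neg]
      refine mul_nonneg (hq i) (neg_nonneg.2 (Real.logb_nonpos one_lt_two
        (div_nonneg (hq i) (fibSum_nonneg π hq _)) ?_))
      exact div_le_one_of_le₀ (le_fibSum π hq i) (fibSum_nonneg π hq _)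
    · rw [← mul_neg]
      refine mul_pos hz (neg_pos.2 (Real.logb_neg one_lt_two (div_pos hz (hz.trans hlt)) ?_))
      rwa [div_lt_one (hz.trans hlt)]

/-! ### Tilted laws -/

section Tilt

variable (π : Z → B) {p : Z → ℝ} {ρ : ℝ}

lemma rpow_tilt_nonneg (hp : ∀ z, 0 ≤ p z) (z : Z) : 0 ≤ p z ^ (1 / (1 + ρ)) :=
  Real.rpow_nonneg (hp z) _

lemma tiltNorm_nonneg (hp : ∀ z, 0 ≤ p z) (b : B) : 0 ≤ tiltNorm π p ρ b :=
  fibSum_nonneg π (rpow_tilt_nonneg hp) b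

lemma tiltNorm_pos (hp : ∀ z, 0 ≤ p z) {z : Z} (hz : 0 < p z) : 0 < tiltNorm π p ρ (π z) :=
  fibSum_pos π (rpow_tilt_nonneg hp) (Real.rpow_pos_of_pos hz _)

lemma exists_pos_of_mem_stdSimplex (hp : p ∈ stdSimplex ℝ Z) : ∃ z, 0 < p z := by
  by_contra! h
  have h1 := hp.2
  rw [Finset.sum_eq_zero fun z _ => le_antisymm (h z) (hp.1 z)] at h1
  exact zero_ne_one h1

lemma tiltTotal_pos (hp : p ∈ stdSimplex ℝ Z) : 0 < tiltTotal π p ρ := by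
  obtain ⟨z, hz⟩ := exists_pos_of_mem_stdSimplex hp
  exact Finset.sum_pos' (fun b _ => Real.rpow_nonneg (tiltNorm_nonneg π hp.1 b) _)
    ⟨π z, Finset.mem_univ _, Real.rpow_pos_of_pos (tiltNorm_pos π hp.1 hz) _⟩

lemma tiltNorm_rpow (hp : ∀ z, 0 ≤ p z) (hρ : 0 ≤ ρ) (b : B) :
    tiltNorm π p ρ b * tiltNorm π p ρ b ^ ρ = tiltNorm π p ρ b ^ (1 + ρ) := by
  rw [Real.rpow_add_of_nonneg (tiltNorm_nonneg π hp b) zero_le_one hρ, Real.rpow_one]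

lemma sum_tilt (hp : ∀ z, 0 ≤ p z) (hρ : 0 ≤ ρ) :
    ∑ z, p z ^ (1 / (1 + ρ)) * tiltNorm π p ρ (π z) ^ ρ = tiltTotal π p ρ := by
  rw [sum_mul_comp π (fun b => tiltNorm π p ρ b ^ ρ) fun z => p z ^ (1 / (1 + ρ))]
  exact Finset.sum_congr rfl fun b _ => tiltNorm_rpow π hp hρ b

lemma tiltLaw_mem (hp : p ∈ stdSimplex ℝ Z) (hρ : 0 ≤ ρ) : tiltLaw π p ρ ∈ stdSimplex ℝ Z := by
  refine ⟨fun z => ?_, ?_⟩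
  · exact div_nonneg (mul_nonneg (rpow_tilt_nonneg hp.1 z)
      (Real.rpow_nonneg (tiltNorm_nonneg π hp.1 _) _)) (tiltTotal_pos π hp).le
  · unfold tiltLaw
    rw [← Finset.sum_div, sum_tilt π hp.1 hρ, div_self (tiltTotal_pos π hp).ne']

lemma tiltLaw_pos_iff (hp : p ∈ stdSimplex ℝ Z) (hρ : 0 ≤ ρ) (z : Z) :
    0 < tiltLaw π p ρ z ↔ 0 < p z := by
  constructor
  · intro h
    by_contra h0
    have h0 : p z = 0 := le_antisymm (not_lt.1 h0) (hp.1 z)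
    unfold tiltLaw at h
    rw [h0, Real.zero_rpow (by positivity)] at h
    simp at h
  · intro h
    exact div_pos (mul_pos (Real.rpow_pos_of_pos h _)
      (Real.rpow_pos_of_pos (tiltNorm_pos π hp.1 h) _)) (tiltTotal_pos π hp)

lemma tiltKer_nonneg (hp : ∀ z, 0 ≤ p z) (z : Z) : 0 ≤ tiltKer π p ρ z :=
  div_nonneg (rpow_tilt_nonneg hp z) (tiltNorm_nonneg π hp _)

lemma tiltKer_pos (hp : ∀ z, 0 ≤ p z) {z : Z} (hz : 0 < p z) : 0 < tiltKer π p ρ z :=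
  div_pos (Real.rpow_pos_of_pos hz _) (tiltNorm_pos π hp hz)

/-- Dividing a nonnegative function by its fibre sums gives a conditional (sub-)law. -/
lemma fibSum_div_self_le (q : Z → ℝ) (b : B) :
    fibSum π (fun z => q z / fibSum π q (π z)) b ≤ 1 := by
  simp only [div_eq_mul_inv]
  rw [fibSum_mul_comp π (fun b => (fibSum π q b)⁻¹) q b, ← div_eq_mul_inv]
  exact div_self_le_one _

lemma fibSum_tiltKer_le (b : B) : fibSum π (tiltKer π p ρ) b ≤ 1 :=
  fibSum_div_self_le π (fun z => p z ^ (1 / (1 + ρ))) b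

/-- The tilted law is proportional to `p · (tilted kernel)^{-ρ}`. -/
lemma mul_tiltKer_rpow (hp : ∀ z, 0 ≤ p z) (hρ : 0 ≤ ρ) (z : Z) :
    p z * tiltKer π p ρ z ^ (-ρ) = p z ^ (1 / (1 + ρ)) * tiltNorm π p ρ (π z) ^ ρ := by
  rcases (hp z).eq_or_lt with h | h
  · rw [← h, Real.zero_rpow (by positivity)]
    simp
  · have hn := tiltNorm_pos (ρ := ρ) π hp h
    unfold tiltKer
    rw [Real.div_rpow (rpow_tilt_nonneg hp z) hn.le, ← Real.rpow_mul h.le, Real.rpow_neg hn.le,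
      div_inv_eq_mul, ← mul_assoc]
    congr 1
    nth_rewrite 1 [← Real.rpow_one (p z)]
    rw [← Real.rpow_add h]
    congr 1
    field_simp
    ring

lemma sum_mul_tiltKer_rpow (hp : ∀ z, 0 ≤ p z) (hρ : 0 ≤ ρ) :
    ∑ z, p z * tiltKer π p ρ z ^ (-ρ) = tiltTotal π p ρ := by
  rw [← sum_tilt π hp hρ]
  exact Finset.sum_congr rfl fun z _ => mul_tiltKer_rpow π hp hρ z

lemma logb_tiltLaw (hp : p ∈ stdSimplex ℝ Z) (hρ : 0 ≤ ρ) {z : Z} (hz : 0 < p z) :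
    Real.logb 2 (tiltLaw π p ρ z) =
      Real.logb 2 (p z) - ρ * Real.logb 2 (tiltKer π p ρ z) - gallagerFn π p ρ := by
  have hk := tiltKer_pos (ρ := ρ) π hp.1 hz
  unfold tiltLaw gallagerFn
  rw [← mul_tiltKer_rpow π hp.1 hρ,
    Real.logb_div (mul_pos hz (Real.rpow_pos_of_pos hk _)).ne' (tiltTotal_pos π hp).ne',
    Real.logb_mul hz.ne' (Real.rpow_pos_of_pos hk _).ne', Real.logb_rpow_eq_mul_logb_of_pos hk]
  ring

lemma tiltLaw_div_fibSum (hp : p ∈ stdSimplex ℝ Z) {z : Z} (hz : 0 < p z) :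
    tiltLaw π p ρ z / fibSum π (tiltLaw π p ρ) (π z) = tiltKer π p ρ z := by
  have hn := tiltNorm_pos (ρ := ρ) π hp.1 hz
  have ht := tiltTotal_pos (ρ := ρ) π hp
  have h : fibSum π (tiltLaw π p ρ) (π z) =
      tiltNorm π p ρ (π z) * (tiltNorm π p ρ (π z) ^ ρ / tiltTotal π p ρ) := by
    refine Eq.trans ?_ (fibSum_mul_comp π (fun b => tiltNorm π p ρ b ^ ρ / tiltTotal π p ρ)
      (fun z => p z ^ (1 / (1 + ρ))) (π z))
    simp only [fibSum, tiltLaw, mul_div_assoc]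
  rw [h, tiltKer, tiltLaw, mul_div_assoc]
  exact mul_div_mul_right _ _ (div_pos (Real.rpow_pos_of_pos hn _) ht).ne'

/-- The tilted law attains the maximum of `ρ H(q) - D(q‖p)`. -/
lemma gallagerFn_eq (hp : p ∈ stdSimplex ℝ Z) (hρ : 0 ≤ ρ) :
    gallagerFn π p ρ = ρ * condEnt π (tiltLaw π p ρ) - relEnt (tiltLaw π p ρ) p := by
  have hq := tiltLaw_mem π hp hρ
  have : gallagerFn π p ρ = ∑ z, tiltLaw π p ρ z * gallagerFn π p ρ := by
    rw [← Finset.sum_mul, hq.2, one_mul]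
  rw [this]
  unfold condEnt relEnt
  rw [mul_neg, Finset.mul_sum, ← Finset.sum_neg_distrib, ← Finset.sum_sub_distrib]
  refine Finset.sum_congr rfl fun z _ => ?_
  rcases (hq.1 z).eq_or_lt with h | h
  · simp [← h]
  · have hz := (tiltLaw_pos_iff π hp hρ z).1 h
    rw [tiltLaw_div_fibSum π hp hz, Real.logb_div h.ne' hz.ne', logb_tiltLaw π hp hρ hz]
    ring

/-- Gallager's function dominates `ρ H(q) - D(q‖p)` for every law `q`. -/
lemma le_gallagerFn (hp : p ∈ stdSimplex ℝ Z) (hρ : 0 ≤ ρ) {q : Z → ℝ} (hq : q ∈ stdSimplex ℝ Z)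
    (hqp : ∀ z, 0 < q z → 0 < p z) : ρ * condEnt π q - relEnt q p ≤ gallagerFn π p ρ := by
  have h1 := condEnt_le_cross π hq.1 (tiltKer_nonneg π hp.1) (fibSum_tiltKer_le π)
    (fun z hz => tiltKer_pos (ρ := ρ) π hp.1 (hqp z hz))
  have ht := tiltLaw_mem π hp hρ
  have h2 := sum_mul_logb_le hq.1 ht.1 (by rw [ht.2, hq.2])
    (fun z hz => (tiltLaw_pos_iff π hp hρ z).2 (hqp z hz))
  have h3 : ∑ z, q z * Real.logb 2 (tiltLaw π p ρ z) - ∑ z, q z * Real.logb 2 (q z) =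
      ρ * (-∑ z, q z * Real.logb 2 (tiltKer π p ρ z)) - relEnt q p - gallagerFn π p ρ := by
    have : gallagerFn π p ρ = ∑ z, q z * gallagerFn π p ρ := by
      rw [← Finset.sum_mul, hq.2, one_mul]
    rw [this]
    unfold relEnt
    rw [mul_neg, Finset.mul_sum, ← Finset.sum_neg_distrib, ← Finset.sum_sub_distrib,
      ← Finset.sum_sub_distrib, ← Finset.sum_sub_distrib]
    refine Finset.sum_congr rfl fun z _ => ?_
    rcases (hq.1 z).eq_or_lt with h | h
    · simp [← h]
    · have hz := hqp z h
      rw [Real.logb_div h.ne' hz.ne', logb_tiltLaw π hp hρ hz]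
      ring
  have h4 := mul_le_mul_of_nonneg_left h1 hρ
  linarith

lemma gallagerFn_nonneg (hp : p ∈ stdSimplex ℝ Z) (hρ : 0 ≤ ρ) : 0 ≤ gallagerFn π p ρ := by
  refine le_trans ?_ (le_gallagerFn π hp hρ hp fun _ h => h)
  have : relEnt p p = 0 := by
    refine Finset.sum_eq_zero fun z _ => ?_
    rcases (hp.1 z).eq_or_lt with h | h
    · simp [← h]
    · rw [div_self h.ne']
      simp
  rw [this, sub_zero]
  exact mul_nonneg hρ (condEnt_nonneg π hp.1)

/-- The conditional entropy of the tilted law is a subgradient of Gallager's function. -/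
lemma gallagerFn_subgradient (hp : p ∈ stdSimplex ℝ Z) (hρ : 0 ≤ ρ) {ρ' : ℝ} (hρ' : 0 ≤ ρ') :
    gallagerFn π p ρ + (ρ' - ρ) * condEnt π (tiltLaw π p ρ) ≤ gallagerFn π p ρ' := by
  have h1 := le_gallagerFn π hp hρ' (tiltLaw_mem π hp hρ)
    (fun z hz => (tiltLaw_pos_iff π hp hρ z).1 hz)
  have h2 := gallagerFn_eq π hp hρ
  linarith

lemma continuousOn_rpow_tilt (z : Z) :
    ContinuousOn (fun ρ : ℝ => p z ^ (1 / (1 + ρ))) (Set.Ici 0) := by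
  intro ρ hρ
  have hρ : (0 : ℝ) ≤ ρ := hρ
  have h1 : ContinuousAt (fun ρ : ℝ => 1 / (1 + ρ)) ρ :=
    ContinuousAt.div (by fun_prop) (by fun_prop) (by positivity)
  have h2 : ContinuousAt (fun t : ℝ => p z ^ t) (1 / (1 + ρ)) :=
    Real.continuousAt_const_rpow' (by positivity)
  exact (ContinuousAt.comp (f := fun ρ : ℝ => 1 / (1 + ρ)) h2 h1).continuousWithinAt

lemma continuousOn_tiltNorm (b : B) :
    ContinuousOn (fun ρ : ℝ => tiltNorm π p ρ b) (Set.Ici 0) :=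
  continuousOn_finsetSum _ fun z _ => continuousOn_rpow_tilt z

lemma continuousOn_tiltTotal : ContinuousOn (tiltTotal π p) (Set.Ici 0) := by
  refine continuousOn_finsetSum _ fun b _ => ?_
  refine (continuousOn_tiltNorm π b).rpow (by fun_prop) fun ρ hρ => Or.inr ?_
  have hρ : (0 : ℝ) ≤ ρ := hρ
  positivity

lemma continuousOn_gallagerFn (hp : p ∈ stdSimplex ℝ Z) :
    ContinuousOn (gallagerFn π p) (Set.Ici 0) := by
  unfold gallagerFn Real.logb
  exact ((continuousOn_tiltTotal π).log fun ρ _ => (tiltTotal_pos π hp).ne').div_const _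

lemma continuousOn_condEnt_tiltLaw (hp : p ∈ stdSimplex ℝ Z) :
    ContinuousOn (fun ρ => condEnt π (tiltLaw π p ρ)) (Set.Ici 0) := by
  have hEq : Set.EqOn (fun ρ => condEnt π (tiltLaw π p ρ))
      (fun ρ => -∑ z, if 0 < p z then
        tiltLaw π p ρ z * Real.logb 2 (tiltKer π p ρ z) else 0) (Set.Ici 0) := by
    intro ρ hρ
    simp only [condEnt]
    congr 1
    refine Finset.sum_congr rfl fun z _ => ?_
    split_ifs with h
    · rw [tiltLaw_div_fibSum π hp h]
    · have : tiltLaw π p ρ z = 0 :=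
        le_antisymm (not_lt.1 fun h' => h ((tiltLaw_pos_iff π hp hρ z).1 h'))
          ((tiltLaw_mem π hp hρ).1 z)
      rw [this, zero_mul]
  refine ContinuousOn.congr ?_ hEq
  refine ContinuousOn.neg (continuousOn_finsetSum _ fun z _ => ?_)
  split_ifs with h
  · have hker : ContinuousOn (fun ρ => tiltKer π p ρ z) (Set.Ici 0) :=
      (continuousOn_rpow_tilt z).div (continuousOn_tiltNorm π _)
        fun ρ _ => (tiltNorm_pos π hp.1 h).ne'
    refine ContinuousOn.mul ?_ ?_
    · refine ContinuousOn.div ?_ (continuousOn_tiltTotal π) fun ρ _ => (tiltTotal_pos π hp).ne'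
      exact (continuousOn_rpow_tilt z).mul ((continuousOn_tiltNorm π _).rpow continuousOn_id
        fun ρ _ => Or.inl (tiltNorm_pos π hp.1 h).ne')
    · unfold Real.logb
      exact (hker.log fun ρ _ => (tiltKer_pos π hp.1 h).ne').div_const _
  · exact continuousOn_const

end Tilt

end Letter

/-! ### The entropies of the two sources as instances -/

section Instances

variable {A B : Type*} [Fintype A] [Fintype B]

lemma fibSum_const (q : A → ℝ) : fibSum (fun _ => ()) q () = ∑ a, q a := by
  simp [fibSum]

lemma fibSum_snd [DecidableEq B] (p : A × B → ℝ) (b : B) :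
    fibSum Prod.snd p b = margSnd p b := by
  unfold fibSum margSnd
  rw [Finset.sum_filter, Fintype.sum_prod_type]
  simp

lemma fibSum_fst [DecidableEq A] (p : A × B → ℝ) (a : A) :
    fibSum Prod.fst p a = margFst p a := by
  unfold fibSum margFst
  rw [Finset.sum_filter, Fintype.sum_prod_type_right]
  simp

lemma entropy_eq_condEnt {p : A → ℝ} (hp : ∑ a, p a = 1) :
    entropy p = condEnt (fun _ => ()) p := by
  simp [entropy, condEnt, fibSum_const, hp]

lemma condEntropy_eq_condEnt [DecidableEq B] (p : A × B → ℝ) :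
    condEntropy p = condEnt Prod.snd p := by
  simp only [condEntropy, condEnt, fibSum_snd, Fintype.sum_prod_type]

lemma condEntropy_swapLaw_eq_condEnt [DecidableEq A] (p : A × B → ℝ) :
    condEntropy (swapLaw p) = condEnt Prod.fst p := by
  simp only [condEntropy, condEnt, fibSum_fst, Fintype.sum_prod_type_right]
  rfl

lemma margFst_mem {p : A × B → ℝ} (hp : p ∈ stdSimplex ℝ (A × B)) :
    margFst p ∈ stdSimplex ℝ A :=
  ⟨fun _ => Finset.sum_nonneg fun _ _ => hp.1 _, by
    rw [← hp.2, Fintype.sum_prod_type]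
    rfl⟩

lemma margSnd_mem {p : A × B → ℝ} (hp : p ∈ stdSimplex ℝ (A × B)) :
    margSnd p ∈ stdSimplex ℝ B :=
  ⟨fun _ => Finset.sum_nonneg fun _ _ => hp.1 _, by
    rw [← hp.2, Fintype.sum_prod_type_right]
    rfl⟩

lemma gallagerFn_zero [DecidableEq B] (π : A → B) {p : A → ℝ} (hp : ∑ a, p a = 1) :
    gallagerFn π p 0 = 0 := by
  have : tiltTotal π p 0 = 1 := by
    rw [← hp, ← sum_fibSum π p]
    simp [tiltTotal, tiltNorm]
  rw [gallagerFn, this, Real.logb_one]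

lemma gallagerFn_id [DecidableEq A] {p : A → ℝ} (hp : p ∈ stdSimplex ℝ A) {ρ : ℝ} (hρ : 0 ≤ ρ) :
    gallagerFn id p ρ = 0 := by
  have h : ∀ a, tiltNorm id p ρ a ^ (1 + ρ) = p a := by
    intro a
    have : tiltNorm id p ρ a = p a ^ (1 / (1 + ρ)) := by
      simp [tiltNorm, fibSum, Finset.filter_eq']
    rw [this, ← Real.rpow_mul (hp.1 a), one_div_mul_cancel (by positivity), Real.rpow_one]
  simp [gallagerFn, tiltTotal, h, hp.2]

lemma one_div_one_add_ne_one {ρ : ℝ} (hρ : 0 < ρ) : 1 / (1 + ρ) ≠ 1 := by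
  rw [Ne, div_eq_one_iff_eq (by positivity)]
  linarith

lemma mul_renyi {p : A → ℝ} (hp : p ∈ stdSimplex ℝ A) {ρ : ℝ} (hρ : 0 ≤ ρ) :
    ρ * renyi (1 / (1 + ρ)) p = gallagerFn (fun _ => ()) p ρ := by
  rcases hρ.eq_or_lt with rfl | h
  · rw [gallagerFn_zero _ hp.2, zero_mul]
  · rw [renyi, if_neg (one_div_one_add_ne_one h)]
    have h0 : 0 < tiltNorm (fun _ => ()) p ρ () := by
      obtain ⟨z, hz⟩ := exists_pos_of_mem_stdSimplex hp
      exact tiltNorm_pos (fun _ => ()) hp.1 hz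
    simp only [gallagerFn, tiltTotal, Finset.univ_unique, PUnit.default_eq_unit,
      Finset.sum_singleton]
    rw [Real.logb_rpow_eq_mul_logb_of_pos h0, tiltNorm, fibSum_const]
    field_simp
    ring_nf
    field_simp

lemma mul_condRenyi [DecidableEq B] {p : A × B → ℝ} (hp : p ∈ stdSimplex ℝ (A × B)) {ρ : ℝ}
    (hρ : 0 ≤ ρ) : ρ * condRenyi (1 / (1 + ρ)) p = gallagerFn Prod.snd p ρ := by
  rcases hρ.eq_or_lt with rfl | h
  · rw [gallagerFn_zero _ hp.2, zero_mul]
  · rw [condRenyi, if_neg (one_div_one_add_ne_one h)]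
    simp only [gallagerFn, tiltTotal, tiltNorm, fibSum_snd, margSnd, one_div_one_div]
    have : 1 - 1 / (1 + ρ) = ρ / (1 + ρ) := by
      field_simp
      ring
    rw [this]
    field_simp

lemma swapLaw_mem {p : A × B → ℝ} (hp : p ∈ stdSimplex ℝ (A × B)) :
    swapLaw p ∈ stdSimplex ℝ (B × A) :=
  ⟨fun _ => hp.1 _, by
    rw [← hp.2, Fintype.sum_prod_type, Fintype.sum_prod_type_right]
    rfl⟩

lemma mul_condRenyi_swapLaw [DecidableEq A] {p : A × B → ℝ} (hp : p ∈ stdSimplex ℝ (A × B))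
    {ρ : ℝ} (hρ : 0 ≤ ρ) :
    ρ * condRenyi (1 / (1 + ρ)) (swapLaw p) = gallagerFn Prod.fst p ρ := by
  rw [mul_condRenyi (swapLaw_mem hp) hρ]
  simp only [gallagerFn, tiltTotal, tiltNorm, fibSum_snd, fibSum_fst, margSnd, margFst, swapLaw]

end Instances

/-! ### Sequences: empirical entropies and product laws -/

section Sequences

variable {Z B : Type*} [Fintype Z] [DecidableEq Z] [Fintype B] [DecidableEq B] {m : ℕ}

lemma empirical_nonneg (z : Fin m → Z) (a : Z) : 0 ≤ empirical z a := by
  unfold empirical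
  positivity

lemma empirical_pos (z : Fin m → Z) (i : Fin m) : 0 < empirical z (z i) := by
  unfold empirical
  have h1 : 0 < (Finset.univ.filter fun j => z j = z i).card :=
    Finset.card_pos.2 ⟨i, by simp⟩
  have h2 : 0 < m := i.pos
  positivity

lemma exists_of_empirical_pos {z : Fin m → Z} {a : Z} (h : 0 < empirical z a) :
    ∃ i, z i = a := by
  by_contra! hne
  unfold empirical at h
  rw [Finset.filter_false_of_mem fun i _ => hne i] at h
  simp at h

lemma sum_comp_eq_empirical (z : Fin m → Z) (f : Z → ℝ) :
    ∑ i, f (z i) = m * ∑ a, empirical z a * f a := by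
  rw [← Finset.sum_fiberwise Finset.univ z, Finset.mul_sum]
  refine Finset.sum_congr rfl fun a _ => ?_
  rw [Finset.sum_congr rfl (g := fun _ => f a) fun i hi => by rw [(Finset.mem_filter.1 hi).2],
    Finset.sum_const, nsmul_eq_mul, empirical]
  rcases Nat.eq_zero_or_pos m with rfl | hm
  · simp
  · field_simp

/-- The empirical conditional entropy is the smallest ideal code length over memoryless
conditional laws. -/
lemma mul_condEnt_empirical_le (π : Z → B) {w : Z → ℝ} (hw : ∀ a, 0 ≤ w a)
    (hw1 : ∀ b, fibSum π w b ≤ 1) (z : Fin m → Z) (hz : ∀ i, 0 < w (z i)) :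
    m * condEnt π (empirical z) ≤ -∑ i, Real.logb 2 (w (z i)) := by
  rw [sum_comp_eq_empirical z fun a => Real.logb 2 (w a), ← mul_neg]
  refine mul_le_mul_of_nonneg_left ?_ (Nat.cast_nonneg m)
  refine condEnt_le_cross π (empirical_nonneg z) hw hw1 fun a ha => ?_
  obtain ⟨i, rfl⟩ := exists_of_empirical_pos ha
  exact hz i

lemma two_rpow_neg_condEnt_empirical (π : Z → B) (z : Fin m → Z) :
    (2 : ℝ) ^ (-(m * condEnt π (empirical z))) =
      ∏ i, empirical z (z i) / fibSum π (empirical z) (π (z i)) := by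
  have h := sum_comp_eq_empirical z
    fun a => Real.logb 2 (empirical z a / fibSum π (empirical z) (π a))
  rw [condEnt, mul_neg, neg_neg, ← h, Real.rpow_sum_of_pos two_pos]
  refine Finset.prod_congr rfl fun i _ => ?_
  rw [Real.rpow_logb two_pos (by norm_num)]
  exact div_pos (empirical_pos z i) (fibSum_pos π (empirical_nonneg z) (empirical_pos z i))

/-- The total mass of a product of letter weights on a fibre is the product of fibre masses. -/
lemma sum_fiber_prod (π : Z → B) (w : Z → ℝ) (b : Fin m → B) :
    ∑ z : Fin m → Z with (∀ i, π (z i) = b i), ∏ i, w (z i) = ∏ i, fibSum π w (b i) := by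
  unfold fibSum
  rw [Finset.prod_univ_sum]
  refine Finset.sum_congr ?_ fun _ _ => rfl
  ext z
  simp [Fintype.mem_piFinset]

/-- Kraft-type inequality for empirical conditional entropies: on each fibre, the weights
`2^{-m Ĥ}` have polynomially bounded sum. -/
lemma sum_fiber_two_rpow_neg_condEnt_le (π : Z → B) (b : Fin m → B) :
    ∑ z : Fin m → Z with (∀ i, π (z i) = b i), (2 : ℝ) ^ (-(m * condEnt π (empirical z))) ≤
      ((m : ℝ) + 1) ^ Fintype.card Z := by
  -- Empirical laws are indexed by their letter counts.
  let law : (Z → Fin (m + 1)) → Z → ℝ := fun c a => ((c a : ℕ) : ℝ) / m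
  let ker : (Z → Fin (m + 1)) → Z → ℝ := fun c a => law c a / fibSum π (law c) (π a)
  have hlaw : ∀ c a, 0 ≤ law c a := fun c a => by positivity
  have hker : ∀ c a, 0 ≤ ker c a := fun c a =>
    div_nonneg (hlaw c a) (fibSum_nonneg π (hlaw c) _)
  let cnt : (Fin m → Z) → Z → Fin (m + 1) := fun z a =>
    ⟨(Finset.univ.filter fun i => z i = a).card,
      Nat.lt_succ_of_le ((Finset.card_le_univ _).trans_eq (Fintype.card_fin m))⟩
  have h1 : ∀ z : Fin m → Z, (2 : ℝ) ^ (-(m * condEnt π (empirical z))) ≤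
      ∑ c, ∏ i, ker c (z i) := by
    intro z
    have hz : empirical z = law (cnt z) := rfl
    rw [two_rpow_neg_condEnt_empirical, hz]
    exact Finset.single_le_sum (f := fun c => ∏ i, ker c (z i))
      (fun c _ => Finset.prod_nonneg fun i _ => hker c _) (Finset.mem_univ (cnt z))
  calc _ ≤ ∑ z : Fin m → Z with (∀ i, π (z i) = b i), ∑ c, ∏ i, ker c (z i) :=
        Finset.sum_le_sum fun z _ => h1 z
    _ = ∑ c, ∏ i, fibSum π (ker c) (b i) := by
        rw [Finset.sum_comm]
        exact Finset.sum_congr rfl fun c _ => sum_fiber_prod π (ker c) b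
    _ ≤ ∑ _c : Z → Fin (m + 1), (1 : ℝ) := by
        refine Finset.sum_le_sum fun c _ => Finset.prod_le_one
          (fun i _ => fibSum_nonneg π (hker c) _) fun i _ => fibSum_div_self_le π _ _
    _ = _ := by simp

lemma sum_prod_eq_one {q : Z → ℝ} (hq : ∑ a, q a = 1) :
    ∑ z : Fin m → Z, ∏ i, q (z i) = 1 := by
  rw [← Fintype.sum_pow, hq, one_pow]

/-- First two moments of a sum of independent centred letter scores. -/
lemma sum_prod_mul_sum_and_sq {q t : Z → ℝ} (hq : ∑ a, q a = 1) (ht : ∑ a, q a * t a = 0) :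
    ∀ m : ℕ, (∑ z : Fin m → Z, (∏ i, q (z i)) * ∑ i, t (z i) = 0) ∧
      ∑ z : Fin m → Z, (∏ i, q (z i)) * (∑ i, t (z i)) ^ 2 = m * ∑ a, q a * t a ^ 2 := by
  intro m
  induction m with
  | zero => simp
  | succ m ih =>
    have hone : ∑ z : Fin m → Z, ∏ i, q (z i) = 1 := sum_prod_eq_one hq
    have hcons : ∀ F : (Fin (m + 1) → Z) → ℝ,
        ∑ z, F z = ∑ a, ∑ z : Fin m → Z, F (Fin.cons a z) := by
      intro F
      rw [← Fintype.sum_prod_type']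
      exact (Equiv.sum_comp (Fin.consEquiv fun _ => Z) F).symm
    constructor
    · rw [hcons]
      simp only [Fin.prod_univ_succ, Fin.sum_univ_succ, Fin.cons_zero, Fin.cons_succ]
      calc _ = ∑ a, (q a * t a * ∑ z : Fin m → Z, ∏ i, q (z i) +
            q a * ∑ z : Fin m → Z, (∏ i, q (z i)) * ∑ i, t (z i)) := by
            refine Finset.sum_congr rfl fun a _ => ?_
            rw [Finset.mul_sum, Finset.mul_sum, ← Finset.sum_add_distrib]
            exact Finset.sum_congr rfl fun z _ => by ring
        _ = 0 := by
            rw [ih.1, hone]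
            simpa using ht
    · rw [hcons]
      simp only [Fin.prod_univ_succ, Fin.sum_univ_succ, Fin.cons_zero, Fin.cons_succ]
      calc _ = ∑ a, (q a * t a ^ 2 * ∑ z : Fin m → Z, ∏ i, q (z i) +
            2 * (q a * t a) * ∑ z : Fin m → Z, (∏ i, q (z i)) * ∑ i, t (z i) +
            q a * ∑ z : Fin m → Z, (∏ i, q (z i)) * (∑ i, t (z i)) ^ 2) := by
            refine Finset.sum_congr rfl fun a _ => ?_
            rw [Finset.mul_sum, Finset.mul_sum, Finset.mul_sum, ← Finset.sum_add_distrib,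
              ← Finset.sum_add_distrib]
            exact Finset.sum_congr rfl fun z _ => by ring
        _ = _ := by
            rw [ih.1, hone, ih.2]
            simp only [mul_one, mul_zero, add_zero]
            rw [Finset.sum_add_distrib, ← Finset.sum_mul, hq]
            push_cast
            ring

/-- The variance of a sum of independent letter scores. -/
lemma sum_prod_mul_sq_sub {q : Z → ℝ} (hq : ∑ a, q a = 1) (s : Z → ℝ) :
    ∑ z : Fin m → Z, (∏ i, q (z i)) * (∑ i, s (z i) - m * ∑ a, q a * s a) ^ 2 =
      m * ∑ a, q a * (s a - ∑ a, q a * s a) ^ 2 := by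
  have h := (sum_prod_mul_sum_and_sq (q := q) (t := fun a => s a - ∑ a, q a * s a) hq ?_ m).2
  · simpa [Finset.sum_sub_distrib] using h
  · simp only [mul_sub, Finset.sum_sub_distrib]
    rw [← Finset.sum_mul, hq, one_mul, sub_self]

end Sequences

/-! ### Segmentation of a pair of blocks -/

section Blocks

variable {X Y : Type*} {n : ℕ}

/-- The aligned part of a pair of blocks: the first `n - d` letters of the first block paired
with the last `n - d` letters of the second one. -/
def pairSeg (d : Fin (n + 1)) (x : Fin n → X) (y : Fin n → Y) : Fin (n - (d : ℕ)) → X × Y :=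
  fun i => (headSeg (n - (d : ℕ)) (by omega) x i, tailSeg (n - (d : ℕ)) (by omega) y i)

/-- Cutting a block into its first `k` and its last `m` letters. -/
def splitEquiv {A : Type*} (k m : ℕ) (h : k + m = n) :
    (Fin n → A) ≃ (Fin k → A) × (Fin m → A) where
  toFun z := (headSeg k (by omega) z, tailSeg m (by omega) z)
  invFun w j := if hj : (j : ℕ) < k then w.1 ⟨j, hj⟩ else w.2 ⟨j - k, by omega⟩
  left_inv z := by
    funext j
    by_cases hj : (j : ℕ) < k
    · simp [hj, headSeg]
    · simp only [hj, dite_false, tailSeg]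
      congr 1
      ext
      simp only
      omega
  right_inv w := by
    refine Prod.ext (funext fun i => ?_) (funext fun i => ?_)
    · simp [headSeg]
    · have h1 : ¬ (n - m + (i : ℕ) < k) := by omega
      simp only [tailSeg, h1, dite_false]
      exact congrArg w.2 (Fin.ext (by simp only; omega))

variable [Fintype X] [Fintype Y]

/-- Sums over pairs of blocks factor over the three segments. -/
lemma sum_blocks (d : Fin (n + 1)) (F : (Fin (d : ℕ) → Y) → ℝ)
    (G : (Fin (n - (d : ℕ)) → X × Y) → ℝ) (H : (Fin (d : ℕ) → X) → ℝ) :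
    ∑ ω : (Fin n → X) × (Fin n → Y),
        F (headSeg (d : ℕ) (by omega) ω.2) * G (pairSeg d ω.1 ω.2) *
          H (tailSeg (d : ℕ) (by omega) ω.1) =
      (∑ u, F u) * (∑ v, G v) * ∑ w, H w := by
  have hX : ∀ K : (Fin (n - (d : ℕ)) → X) → (Fin (d : ℕ) → X) → ℝ,
      ∑ x : Fin n → X, K (headSeg (n - (d : ℕ)) (by omega) x) (tailSeg (d : ℕ) (by omega) x) =
        ∑ u, ∑ v, K u v := by
    intro K
    rw [← Fintype.sum_prod_type']
    exact Equiv.sum_comp (splitEquiv (n - (d : ℕ)) (d : ℕ) (by omega)) fun w => K w.1 w.2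
  have hY : ∀ K : (Fin (d : ℕ) → Y) → (Fin (n - (d : ℕ)) → Y) → ℝ,
      ∑ y : Fin n → Y, K (headSeg (d : ℕ) (by omega) y) (tailSeg (n - (d : ℕ)) (by omega) y) =
        ∑ u, ∑ v, K u v := by
    intro K
    rw [← Fintype.sum_prod_type']
    exact Equiv.sum_comp (splitEquiv (d : ℕ) (n - (d : ℕ)) (by omega)) fun w => K w.1 w.2
  have hG : ∑ v, G v = ∑ x : Fin (n - (d : ℕ)) → X, ∑ y : Fin (n - (d : ℕ)) → Y,
      G fun i => (x i, y i) := by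
    rw [← Fintype.sum_prod_type']
    exact (Equiv.sum_comp (Equiv.arrowProdEquivProdArrow _ (fun _ => X) fun _ => Y).symm G).symm
  have hXY : ∀ K : (Fin (d : ℕ) → Y) → (Fin (n - (d : ℕ)) → Y) → (Fin (n - (d : ℕ)) → X) →
      (Fin (d : ℕ) → X) → ℝ,
      ∑ x : Fin n → X, ∑ y : Fin n → Y,
        K (headSeg (d : ℕ) (by omega) y) (tailSeg (n - (d : ℕ)) (by omega) y)
          (headSeg (n - (d : ℕ)) (by omega) x) (tailSeg (d : ℕ) (by omega) x) =
      ∑ x₁, ∑ x₂, ∑ y₁, ∑ y₂, K y₁ y₂ x₁ x₂ := by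
    intro K
    rw [← hX fun x₁ x₂ => ∑ y₁, ∑ y₂, K y₁ y₂ x₁ x₂]
    exact Finset.sum_congr rfl fun x _ => hY fun y₁ y₂ => K y₁ y₂ _ _
  rw [Fintype.sum_prod_type]
  refine (hXY fun y₁ y₂ x₁ x₂ => F y₁ * G (fun i => (x₁ i, y₂ i)) * H x₂).trans ?_
  rw [hG, mul_assoc, Finset.sum_mul_sum, Finset.mul_sum]
  refine Finset.sum_congr rfl fun x₁ _ => ?_
  rw [Finset.mul_sum]
  refine Finset.sum_congr rfl fun x₂ _ => ?_
  rw [Finset.sum_mul]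
  refine Finset.sum_congr rfl fun u _ => ?_
  rw [Finset.sum_mul, Finset.mul_sum]
  exact Finset.sum_congr rfl fun v _ => by ring

/-- Product of letter weights over the three segments of a pair of blocks. -/
def blockProd (a : Y → ℝ) (b : X × Y → ℝ) (c : X → ℝ) (d : Fin (n + 1))
    (ω : (Fin n → X) × (Fin n → Y)) : ℝ :=
  (∏ i, a (headSeg (d : ℕ) (by omega) ω.2 i)) * (∏ i, b (pairSeg d ω.1 ω.2 i)) *
    ∏ i, c (tailSeg (d : ℕ) (by omega) ω.1 i)

/-- Sum of letter scores over the three segments of a pair of blocks. -/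
def blockSum (a : Y → ℝ) (b : X × Y → ℝ) (c : X → ℝ) (d : Fin (n + 1))
    (ω : (Fin n → X) × (Fin n → Y)) : ℝ :=
  (∑ i, a (headSeg (d : ℕ) (by omega) ω.2 i)) + (∑ i, b (pairSeg d ω.1 ω.2 i)) +
    ∑ i, c (tailSeg (d : ℕ) (by omega) ω.1 i)

/-- The combination of three letter quantities weighted by the lengths of the segments. -/
def blockMean (d : Fin (n + 1)) (a b c : ℝ) : ℝ :=
  (d : ℕ) * a + ((n - (d : ℕ) : ℕ) : ℝ) * b + (d : ℕ) * c

lemma blockProb_eq_blockProd (P : X × Y → ℝ) (d : Fin (n + 1)) (x : Fin n → X) (y : Fin n → Y) :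
    blockProb P d x y = blockProd (margSnd P) P (margFst P) d (x, y) := rfl

lemma blockProd_nonneg {a : Y → ℝ} {b : X × Y → ℝ} {c : X → ℝ} (ha : ∀ z, 0 ≤ a z)
    (hb : ∀ z, 0 ≤ b z) (hc : ∀ z, 0 ≤ c z) (d : Fin (n + 1))
    (ω : (Fin n → X) × (Fin n → Y)) : 0 ≤ blockProd a b c d ω :=
  mul_nonneg (mul_nonneg (Finset.prod_nonneg fun _ _ => ha _) (Finset.prod_nonneg fun _ _ => hb _))
    (Finset.prod_nonneg fun _ _ => hc _)

/-- Every letter of the three segments of `ω` lies in the support of the letter weights. -/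
def InSupport (a : Y → ℝ) (b : X × Y → ℝ) (c : X → ℝ) (d : Fin (n + 1))
    (ω : (Fin n → X) × (Fin n → Y)) : Prop :=
  (∀ i, 0 < a (headSeg (d : ℕ) (by omega) ω.2 i)) ∧ (∀ i, 0 < b (pairSeg d ω.1 ω.2 i)) ∧
    ∀ i, 0 < c (tailSeg (d : ℕ) (by omega) ω.1 i)

lemma InSupport.blockProd_pos {a : Y → ℝ} {b : X × Y → ℝ} {c : X → ℝ} {d : Fin (n + 1)}
    {ω : (Fin n → X) × (Fin n → Y)} (h : InSupport a b c d ω) : 0 < blockProd a b c d ω :=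
  mul_pos (mul_pos (Finset.prod_pos fun i _ => h.1 i) (Finset.prod_pos fun i _ => h.2.1 i))
    (Finset.prod_pos fun i _ => h.2.2 i)

lemma inSupport_of_blockProd_ne_zero {a : Y → ℝ} {b : X × Y → ℝ} {c : X → ℝ} (ha : ∀ z, 0 ≤ a z)
    (hb : ∀ z, 0 ≤ b z) (hc : ∀ z, 0 ≤ c z) {d : Fin (n + 1)}
    {ω : (Fin n → X) × (Fin n → Y)} (h : blockProd a b c d ω ≠ 0) : InSupport a b c d ω := by
  unfold blockProd at h
  simp only [mul_ne_zero_iff, Finset.prod_ne_zero_iff] at h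
  exact ⟨fun i => (ha _).lt_of_ne' (h.1.1 i (Finset.mem_univ i)),
    fun i => (hb _).lt_of_ne' (h.1.2 i (Finset.mem_univ i)),
    fun i => (hc _).lt_of_ne' (h.2 i (Finset.mem_univ i))⟩

lemma InSupport.mono {a a' : Y → ℝ} {b b' : X × Y → ℝ} {c c' : X → ℝ} {d : Fin (n + 1)}
    {ω : (Fin n → X) × (Fin n → Y)} (h : InSupport a b c d ω) (ha : ∀ z, 0 < a z → 0 < a' z)
    (hb : ∀ z, 0 < b z → 0 < b' z) (hc : ∀ z, 0 < c z → 0 < c' z) : InSupport a' b' c' d ω :=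
  ⟨fun i => ha _ (h.1 i), fun i => hb _ (h.2.1 i), fun i => hc _ (h.2.2 i)⟩

/-- A product of positive letter weights is the exponential of the sum of their logarithms. -/
lemma InSupport.blockProd_eq_rpow {a : Y → ℝ} {b : X × Y → ℝ} {c : X → ℝ} {d : Fin (n + 1)}
    {ω : (Fin n → X) × (Fin n → Y)} (h : InSupport a b c d ω) :
    blockProd a b c d ω = (2 : ℝ) ^ (-blockSum (fun z => -Real.logb 2 (a z))
      (fun z => -Real.logb 2 (b z)) (fun z => -Real.logb 2 (c z)) d ω) := by
  have key : ∀ {ι : Type} [Fintype ι] (f : ι → ℝ), (∀ i, 0 < f i) →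
      ∏ i, f i = (2 : ℝ) ^ (∑ i, Real.logb 2 (f i)) := by
    intro ι _ f hf
    rw [Real.rpow_sum_of_pos two_pos]
    exact Finset.prod_congr rfl fun i _ => (Real.rpow_logb two_pos (by norm_num) (hf i)).symm
  unfold blockProd blockSum
  simp only [Finset.sum_neg_distrib]
  rw [key _ h.1, key _ h.2.1, key _ h.2.2, ← Real.rpow_add two_pos, ← Real.rpow_add two_pos]
  congr 1
  ring

lemma sum_blockProd (a : Y → ℝ) (b : X × Y → ℝ) (c : X → ℝ) (d : Fin (n + 1)) :
    ∑ ω : (Fin n → X) × (Fin n → Y), blockProd a b c d ω =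
      (∑ z, a z) ^ (d : ℕ) * (∑ z, b z) ^ (n - (d : ℕ)) * (∑ z, c z) ^ (d : ℕ) := by
  rw [Fintype.sum_pow, Fintype.sum_pow, Fintype.sum_pow]
  exact sum_blocks d (fun u => ∏ i, a (u i)) (fun v => ∏ i, b (v i)) (fun w => ∏ i, c (w i))

lemma sum_blockProd_eq_one {a : Y → ℝ} {b : X × Y → ℝ} {c : X → ℝ} (ha : ∑ z, a z = 1)
    (hb : ∑ z, b z = 1) (hc : ∑ z, c z = 1) (d : Fin (n + 1)) :
    ∑ ω : (Fin n → X) × (Fin n → Y), blockProd a b c d ω = 1 := by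
  simp [sum_blockProd, ha, hb, hc]

section Variance

variable [DecidableEq X] [DecidableEq Y]

/-- Variance bound for the sum of letter scores of a pair of blocks with a product law. -/
lemma sum_blockProd_mul_sq_le {a : Y → ℝ} {b : X × Y → ℝ} {c : X → ℝ} (ha : a ∈ stdSimplex ℝ Y)
    (hb : b ∈ stdSimplex ℝ (X × Y)) (hc : c ∈ stdSimplex ℝ X) (s : Y → ℝ) (t : X × Y → ℝ)
    (r : X → ℝ) (d : Fin (n + 1)) :
    ∑ ω : (Fin n → X) × (Fin n → Y), blockProd a b c d ω *
        (blockSum s t r d ω - blockMean d (∑ z, a z * s z) (∑ z, b z * t z) (∑ z, c z * r z)) ^ 2 ≤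
      3 * n * (∑ z, a z * (s z - ∑ z, a z * s z) ^ 2 + ∑ z, b z * (t z - ∑ z, b z * t z) ^ 2 +
        ∑ z, c z * (r z - ∑ z, c z * r z) ^ 2) := by
  have hd : ((d : ℕ) : ℝ) ≤ n := by exact_mod_cast Nat.lt_succ_iff.1 d.2
  have hnd : ((n - (d : ℕ) : ℕ) : ℝ) ≤ n := by exact_mod_cast Nat.sub_le _ _
  have h1 := sum_blocks (X := X) (Y := Y) d
    (fun u => (∏ i, a (u i)) * (∑ i, s (u i) - (d : ℕ) * ∑ z, a z * s z) ^ 2)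
    (fun v => ∏ i, b (v i)) (fun w => ∏ i, c (w i))
  have h2 := sum_blocks (X := X) (Y := Y) d (fun u => ∏ i, a (u i))
    (fun v => (∏ i, b (v i)) * (∑ i, t (v i) - (n - (d : ℕ) : ℕ) * ∑ z, b z * t z) ^ 2)
    (fun w => ∏ i, c (w i))
  have h3 := sum_blocks (X := X) (Y := Y) d (fun u => ∏ i, a (u i)) (fun v => ∏ i, b (v i))
    (fun w => (∏ i, c (w i)) * (∑ i, r (w i) - (d : ℕ) * ∑ z, c z * r z) ^ 2)
  rw [sum_prod_mul_sq_sub ha.2, sum_prod_eq_one hb.2, sum_prod_eq_one hc.2, mul_one, mul_one] at h1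
  rw [sum_prod_mul_sq_sub hb.2, sum_prod_eq_one ha.2, sum_prod_eq_one hc.2, mul_one, one_mul] at h2
  rw [sum_prod_mul_sq_sub hc.2, sum_prod_eq_one ha.2, sum_prod_eq_one hb.2, mul_one, one_mul] at h3
  have hva : 0 ≤ ∑ z, a z * (s z - ∑ z, a z * s z) ^ 2 :=
    Finset.sum_nonneg fun z _ => mul_nonneg (ha.1 z) (sq_nonneg _)
  have hvb : 0 ≤ ∑ z, b z * (t z - ∑ z, b z * t z) ^ 2 :=
    Finset.sum_nonneg fun z _ => mul_nonneg (hb.1 z) (sq_nonneg _)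
  have hvc : 0 ≤ ∑ z, c z * (r z - ∑ z, c z * r z) ^ 2 :=
    Finset.sum_nonneg fun z _ => mul_nonneg (hc.1 z) (sq_nonneg _)
  have h4 := mul_le_mul_of_nonneg_right hd hva
  have h5 := mul_le_mul_of_nonneg_right hnd hvb
  have h6 := mul_le_mul_of_nonneg_right hd hvc
  rw [← h1] at h4
  rw [← h2] at h5
  rw [← h3] at h6
  have h7 := mul_le_mul_of_nonneg_left (add_le_add (add_le_add h4 h5) h6)
    (zero_le_three : (0 : ℝ) ≤ 3)
  refine le_trans ?_ (h7.trans_eq (by ring))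
  rw [← Finset.sum_add_distrib, ← Finset.sum_add_distrib, Finset.mul_sum]
  refine Finset.sum_le_sum fun ω _ => ?_
  have hsq : ∀ u v w : ℝ, (u + v + w) ^ 2 ≤ 3 * (u ^ 2 + v ^ 2 + w ^ 2) := fun u v w => by
    nlinarith [sq_nonneg (u - v), sq_nonneg (u - w), sq_nonneg (v - w)]
  have hnn := blockProd_nonneg ha.1 hb.1 hc.1 d ω
  have := mul_le_mul_of_nonneg_left (hsq
    (∑ i, s (headSeg (d : ℕ) (by omega) ω.2 i) - (d : ℕ) * ∑ z, a z * s z)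
    (∑ i, t (pairSeg d ω.1 ω.2 i) - (n - (d : ℕ) : ℕ) * ∑ z, b z * t z)
    (∑ i, r (tailSeg (d : ℕ) (by omega) ω.1 i) - (d : ℕ) * ∑ z, c z * r z)) hnn
  refine le_trans (le_of_eq ?_) (this.trans (le_of_eq ?_))
  · unfold blockSum blockMean
    ring
  · unfold blockProd
    ring

/-- Chebyshev's inequality for the sum of letter scores of a pair of blocks: the constant does
not depend on the block length or the delay. -/
lemma exists_sum_blockProd_deviation_le {a : Y → ℝ} {b : X × Y → ℝ} {c : X → ℝ}
    (ha : a ∈ stdSimplex ℝ Y) (hb : b ∈ stdSimplex ℝ (X × Y)) (hc : c ∈ stdSimplex ℝ X)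
    (s : Y → ℝ) (t : X × Y → ℝ) (r : X → ℝ) {ε : ℝ} (hε : 0 < ε) :
    ∃ K : ℝ, ∀ (n : ℕ) (d : Fin (n + 1)), 0 < n →
      ∑ ω : (Fin n → X) × (Fin n → Y) with
        n * ε < |blockSum s t r d ω -
          blockMean d (∑ z, a z * s z) (∑ z, b z * t z) (∑ z, c z * r z)|,
        blockProd a b c d ω ≤ K / n := by
  refine ⟨3 * (∑ z, a z * (s z - ∑ z, a z * s z) ^ 2 + ∑ z, b z * (t z - ∑ z, b z * t z) ^ 2 +
        ∑ z, c z * (r z - ∑ z, c z * r z) ^ 2) / ε ^ 2, fun n d hn => ?_⟩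
  have hn' : (0 : ℝ) < n := by exact_mod_cast hn
  have hv := sum_blockProd_mul_sq_le ha hb hc s t r d
  have hsub : (n * ε) ^ 2 * ∑ ω : (Fin n → X) × (Fin n → Y) with
        n * ε < |blockSum s t r d ω -
          blockMean d (∑ z, a z * s z) (∑ z, b z * t z) (∑ z, c z * r z)|,
        blockProd a b c d ω ≤ ∑ ω : (Fin n → X) × (Fin n → Y), blockProd a b c d ω *
        (blockSum s t r d ω -
          blockMean d (∑ z, a z * s z) (∑ z, b z * t z) (∑ z, c z * r z)) ^ 2 := by
    rw [Finset.mul_sum]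
    refine le_trans (Finset.sum_le_sum fun ω hω => ?_)
      (Finset.sum_le_sum_of_subset_of_nonneg (Finset.filter_subset _ _) fun ω _ _ =>
        mul_nonneg (blockProd_nonneg ha.1 hb.1 hc.1 d ω) (sq_nonneg _))
    rw [mul_comm]
    refine mul_le_mul_of_nonneg_left ?_ (blockProd_nonneg ha.1 hb.1 hc.1 d ω)
    rw [← sq_abs (blockSum s t r d ω - _)]
    have := (Finset.mem_filter.1 hω).2
    gcongr
  have aux : ∀ D V : ℝ, (n * ε) ^ 2 * D ≤ 3 * n * V → D ≤ 3 * V / ε ^ 2 / n := by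
    intro D V h
    rw [div_div, le_div_iff₀ (by positivity)]
    refine le_of_mul_le_mul_left ?_ hn'
    calc n * (D * (ε ^ 2 * n)) = (n * ε) ^ 2 * D := by ring
      _ ≤ 3 * n * V := h
      _ = n * (3 * V) := by ring
  exact aux _ _ (hsub.trans hv)

end Variance

/-! ### Fibres of the side information -/

section Fibre

variable [DecidableEq X] [DecidableEq Y]
variable {B₁ B₂ B₃ : Type*} [Fintype B₁] [DecidableEq B₁] [Fintype B₂] [DecidableEq B₂]
  [Fintype B₃] [DecidableEq B₃] (π₁ : Y → B₁) (π₂ : X × Y → B₂) (π₃ : X → B₃)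

/-- Two pairs of blocks have the same side information: the letters of each segment have the same
images. With `(id, snd, const)` this says that the second blocks agree, with `(const, fst, id)`
that the first blocks agree, and with constant maps it is no condition. -/
def SameSide (d : Fin (n + 1)) (ω ω' : (Fin n → X) × (Fin n → Y)) : Prop :=
  (∀ i, π₁ (headSeg (d : ℕ) (by omega) ω'.2 i) = π₁ (headSeg (d : ℕ) (by omega) ω.2 i)) ∧
  (∀ i, π₂ (pairSeg d ω'.1 ω'.2 i) = π₂ (pairSeg d ω.1 ω.2 i)) ∧
  ∀ i, π₃ (tailSeg (d : ℕ) (by omega) ω'.1 i) = π₃ (tailSeg (d : ℕ) (by omega) ω.1 i)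

instance (d : Fin (n + 1)) (ω ω' : (Fin n → X) × (Fin n → Y)) :
    Decidable (SameSide π₁ π₂ π₃ d ω ω') := by
  unfold SameSide
  infer_instance

lemma sum_sameSide (d : Fin (n + 1)) (F : (Fin (d : ℕ) → Y) → ℝ)
    (G : (Fin (n - (d : ℕ)) → X × Y) → ℝ) (H : (Fin (d : ℕ) → X) → ℝ)
    (ω : (Fin n → X) × (Fin n → Y)) :
    ∑ ω' with SameSide π₁ π₂ π₃ d ω ω',
        F (headSeg (d : ℕ) (by omega) ω'.2) * G (pairSeg d ω'.1 ω'.2) *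
          H (tailSeg (d : ℕ) (by omega) ω'.1) =
      (∑ u with (∀ i, π₁ (u i) = π₁ (headSeg (d : ℕ) (by omega) ω.2 i)), F u) *
      (∑ v with (∀ i, π₂ (v i) = π₂ (pairSeg d ω.1 ω.2 i)), G v) *
      ∑ w with (∀ i, π₃ (w i) = π₃ (tailSeg (d : ℕ) (by omega) ω.1 i)), H w := by
  rw [Finset.sum_filter, Finset.sum_filter, Finset.sum_filter, Finset.sum_filter, ← sum_blocks]
  have key : ∀ (p q r : Prop) [Decidable (p ∧ q ∧ r)] [Decidable p] [Decidable q] [Decidable r]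
      (a b c : ℝ), (if p ∧ q ∧ r then a * b * c else 0) =
        (if p then a else 0) * (if q then b else 0) * (if r then c else 0) := by
    intro p q r _ _ _ _ a b c
    by_cases hp : p <;> by_cases hq : q <;> by_cases hr : r <;> simp [hp, hq, hr]
  exact Finset.sum_congr rfl fun ω' _ => key _ _ _ _ _ _

/-- The probability of a fibre under a product law. -/
lemma sum_sameSide_blockProd (a : Y → ℝ) (b : X × Y → ℝ) (c : X → ℝ) (d : Fin (n + 1))
    (ω : (Fin n → X) × (Fin n → Y)) :
    ∑ ω' with SameSide π₁ π₂ π₃ d ω ω', blockProd a b c d ω' =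
      blockProd (fun z => fibSum π₁ a (π₁ z)) (fun z => fibSum π₂ b (π₂ z))
        (fun z => fibSum π₃ c (π₃ z)) d ω := by
  refine (sum_sameSide π₁ π₂ π₃ d (fun u => ∏ i, a (u i)) (fun v => ∏ i, b (v i))
    (fun w => ∏ i, c (w i)) ω).trans ?_
  rw [sum_fiber_prod, sum_fiber_prod, sum_fiber_prod]
  rfl

lemma blockProd_mul (a a' : Y → ℝ) (b b' : X × Y → ℝ) (c c' : X → ℝ) (d : Fin (n + 1))
    (ω : (Fin n → X) × (Fin n → Y)) :
    blockProd (fun z => a z * a' z) (fun z => b z * b' z) (fun z => c z * c' z) d ω =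
      blockProd a b c d ω * blockProd a' b' c' d ω := by
  unfold blockProd
  simp only [Finset.prod_mul_distrib]
  ring

lemma fibSum_mul_div {Z B : Type*} [Fintype Z] [Fintype B] [DecidableEq B] (π : Z → B) {q : Z → ℝ}
    (hq : ∀ z, 0 ≤ q z) : (fun z => fibSum π q (π z) * (q z / fibSum π q (π z))) = q := by
  funext z
  rcases (hq z).eq_or_lt with h | h
  · simp [← h]
  · exact mul_div_cancel₀ _ (fibSum_pos π hq h).ne'

/-- Chain rule: a product law is the product of the law of the side information and of the
conditional law. -/
lemma blockProd_eq_mul_cond {a : Y → ℝ} {b : X × Y → ℝ} {c : X → ℝ} (ha : ∀ z, 0 ≤ a z)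
    (hb : ∀ z, 0 ≤ b z) (hc : ∀ z, 0 ≤ c z) (d : Fin (n + 1))
    (ω : (Fin n → X) × (Fin n → Y)) :
    blockProd a b c d ω = (∑ ω' with SameSide π₁ π₂ π₃ d ω ω', blockProd a b c d ω') *
      blockProd (fun z => a z / fibSum π₁ a (π₁ z)) (fun z => b z / fibSum π₂ b (π₂ z))
        (fun z => c z / fibSum π₃ c (π₃ z)) d ω := by
  rw [sum_sameSide_blockProd, ← blockProd_mul, fibSum_mul_div π₁ ha, fibSum_mul_div π₂ hb,
    fibSum_mul_div π₃ hc]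

/-- The empirical conditional entropy of a pair of blocks given the side information, added up
over the segments for the delay `d`. -/
def segMetric (d : Fin (n + 1)) (ω : (Fin n → X) × (Fin n → Y)) : ℝ :=
  blockMean d (condEnt π₁ (empirical (headSeg (d : ℕ) (by omega) ω.2)))
    (condEnt π₂ (empirical (pairSeg d ω.1 ω.2)))
    (condEnt π₃ (empirical (tailSeg (d : ℕ) (by omega) ω.1)))

/-- Kraft-type inequality for the metrics: few pairs of blocks with the given side information
have a small metric. -/
lemma sum_sameSide_two_rpow_neg_segMetric_le (d : Fin (n + 1))
    (ω : (Fin n → X) × (Fin n → Y)) :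
    ∑ ω' with SameSide π₁ π₂ π₃ d ω ω', (2 : ℝ) ^ (-segMetric π₁ π₂ π₃ d ω') ≤
      ((n : ℝ) + 1) ^ (Fintype.card Y + Fintype.card (X × Y) + Fintype.card X) := by
  have hd : ((d : ℕ) : ℝ) ≤ n := by exact_mod_cast Nat.lt_succ_iff.1 d.2
  have hnd : ((n - (d : ℕ) : ℕ) : ℝ) ≤ n := by exact_mod_cast Nat.sub_le _ _
  have h := sum_sameSide π₁ π₂ π₃ d (fun u => (2 : ℝ) ^ (-((d : ℕ) * condEnt π₁ (empirical u))))
    (fun v => (2 : ℝ) ^ (-((n - (d : ℕ) : ℕ) * condEnt π₂ (empirical v))))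
    (fun w => (2 : ℝ) ^ (-((d : ℕ) * condEnt π₃ (empirical w)))) ω
  have h' : ∀ ω' : (Fin n → X) × (Fin n → Y), (2 : ℝ) ^ (-segMetric π₁ π₂ π₃ d ω') =
      (2 : ℝ) ^ (-((d : ℕ) * condEnt π₁ (empirical (headSeg (d : ℕ) (by omega) ω'.2)))) *
      (2 : ℝ) ^ (-((n - (d : ℕ) : ℕ) * condEnt π₂ (empirical (pairSeg d ω'.1 ω'.2)))) *
      (2 : ℝ) ^ (-((d : ℕ) * condEnt π₃ (empirical (tailSeg (d : ℕ) (by omega) ω'.1)))) := by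
    intro ω'
    rw [← Real.rpow_add two_pos, ← Real.rpow_add two_pos]
    congr 1
    unfold segMetric blockMean
    ring
  rw [Finset.sum_congr rfl fun ω' _ => h' ω', h, pow_add, pow_add]
  have e1 := sum_fiber_two_rpow_neg_condEnt_le π₁
    fun i => π₁ (headSeg (d : ℕ) (by omega) ω.2 i)
  have e2 := sum_fiber_two_rpow_neg_condEnt_le π₂ fun i => π₂ (pairSeg d ω.1 ω.2 i)
  have e3 := sum_fiber_two_rpow_neg_condEnt_le π₃
    fun i => π₃ (tailSeg (d : ℕ) (by omega) ω.1 i)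
  refine mul_le_mul (mul_le_mul (e1.trans ?_) (e2.trans ?_) ?_ ?_) (e3.trans ?_) ?_ ?_
  any_goals gcongr
  all_goals positivity

/-- Exponential moment of the metric for the true delay: its empirical entropies are at most the
code lengths of the tilted kernels, whose moments are Gallager's functions. -/
lemma sum_blockProd_mul_two_rpow_segMetric_le {a : Y → ℝ} {b : X × Y → ℝ} {c : X → ℝ}
    (ha : a ∈ stdSimplex ℝ Y) (hb : b ∈ stdSimplex ℝ (X × Y)) (hc : c ∈ stdSimplex ℝ X) {ρ : ℝ}
    (hρ : 0 ≤ ρ) (d : Fin (n + 1)) :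
    ∑ ω : (Fin n → X) × (Fin n → Y),
        blockProd a b c d ω * (2 : ℝ) ^ (ρ * segMetric π₁ π₂ π₃ d ω) ≤
      (2 : ℝ) ^ blockMean d (gallagerFn π₁ a ρ) (gallagerFn π₂ b ρ) (gallagerFn π₃ c ρ) := by
  have hterm : ∀ ω : (Fin n → X) × (Fin n → Y),
      blockProd a b c d ω * (2 : ℝ) ^ (ρ * segMetric π₁ π₂ π₃ d ω) ≤
        blockProd (fun z => a z * tiltKer π₁ a ρ z ^ (-ρ))
          (fun z => b z * tiltKer π₂ b ρ z ^ (-ρ)) (fun z => c z * tiltKer π₃ c ρ z ^ (-ρ)) d ω := by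
    intro ω
    rw [blockProd_mul]
    by_cases h0 : blockProd a b c d ω = 0
    · rw [h0, zero_mul, zero_mul]
    have hs := inSupport_of_blockProd_ne_zero ha.1 hb.1 hc.1 h0
    have hk : InSupport (tiltKer π₁ a ρ) (tiltKer π₂ b ρ) (tiltKer π₃ c ρ) d ω :=
      hs.mono (fun z hz => tiltKer_pos π₁ ha.1 hz) (fun z hz => tiltKer_pos π₂ hb.1 hz)
        (fun z hz => tiltKer_pos π₃ hc.1 hz)
    have hk' : InSupport (fun z => tiltKer π₁ a ρ z ^ (-ρ)) (fun z => tiltKer π₂ b ρ z ^ (-ρ))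
        (fun z => tiltKer π₃ c ρ z ^ (-ρ)) d ω :=
      ⟨fun i => Real.rpow_pos_of_pos (hk.1 i) _, fun i => Real.rpow_pos_of_pos (hk.2.1 i) _,
        fun i => Real.rpow_pos_of_pos (hk.2.2 i) _⟩
    refine mul_le_mul_of_nonneg_left ?_ (blockProd_nonneg ha.1 hb.1 hc.1 d ω)
    rw [hk'.blockProd_eq_rpow]
    refine Real.rpow_le_rpow_of_exponent_le one_le_two ?_
    have e1 := mul_condEnt_empirical_le π₁ (tiltKer_nonneg (ρ := ρ) π₁ ha.1) (fibSum_tiltKer_le π₁)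
      _ hk.1
    have e2 := mul_condEnt_empirical_le π₂ (tiltKer_nonneg (ρ := ρ) π₂ hb.1) (fibSum_tiltKer_le π₂)
      _ hk.2.1
    have e3 := mul_condEnt_empirical_le π₃ (tiltKer_nonneg (ρ := ρ) π₃ hc.1) (fibSum_tiltKer_le π₃)
      _ hk.2.2
    have e := mul_le_mul_of_nonneg_left (add_le_add (add_le_add e1 e2) e3) hρ
    unfold segMetric blockMean blockSum
    refine e.trans (le_of_eq ?_)
    have hl : ∀ {ι : Type} [Fintype ι] (f : ι → ℝ), (∀ i, 0 < f i) →
        ∑ i, -Real.logb 2 (f i ^ (-ρ)) = ρ * ∑ i, Real.logb 2 (f i) := by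
      intro ι _ f hf
      rw [Finset.mul_sum]
      refine Finset.sum_congr rfl fun i _ => ?_
      rw [Real.logb_rpow_eq_mul_logb_of_pos (hf i)]
      ring
    rw [hl _ hk.1, hl _ hk.2.1, hl _ hk.2.2]
    ring
  refine (Finset.sum_le_sum fun ω _ => hterm ω).trans (le_of_eq ?_)
  rw [sum_blockProd, sum_mul_tiltKer_rpow π₁ ha.1 hρ, sum_mul_tiltKer_rpow π₂ hb.1 hρ,
    sum_mul_tiltKer_rpow π₃ hc.1 hρ]
  unfold blockMean gallagerFn
  have hp : ∀ (t : ℝ) (m : ℕ), 0 < t → t ^ m = (2 : ℝ) ^ ((m : ℝ) * Real.logb 2 t) := by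
    intro t m ht
    rw [mul_comm, Real.rpow_mul two_pos.le, Real.rpow_logb two_pos (by norm_num) ht,
      Real.rpow_natCast]
  rw [Real.rpow_add two_pos, Real.rpow_add two_pos, ← hp _ _ (tiltTotal_pos π₁ ha),
    ← hp _ _ (tiltTotal_pos π₂ hb), ← hp _ _ (tiltTotal_pos π₃ hc)]

end Fibre

end Blocks

/-! ### Random binning -/

section Binning

variable {α β : Type*} [Fintype α] [DecidableEq α] [Fintype β] [DecidableEq β] {M Mx My : ℕ}

/-- Average over a uniformly random map into `M` bins. -/
def mapAvg (F : (α → Fin M) → ℝ) : ℝ := (∑ f, F f) / (Fintype.card (α → Fin M) : ℝ)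

/-- Average over two independent uniformly random binning maps. -/
def binAvg (F : (α → Fin Mx) → (β → Fin My) → ℝ) : ℝ :=
  (∑ f, ∑ g, F f g) / ((Fintype.card (α → Fin Mx) : ℝ) * (Fintype.card (β → Fin My) : ℝ))

lemma binAvg_mono {F G : (α → Fin Mx) → (β → Fin My) → ℝ} (h : ∀ f g, F f g ≤ G f g) :
    binAvg F ≤ binAvg G :=
  div_le_div_of_nonneg_right
    (Finset.sum_le_sum fun f _ => Finset.sum_le_sum fun g _ => h f g) (by positivity)

lemma binAvg_nonneg {F : (α → Fin Mx) → (β → Fin My) → ℝ} (h : ∀ f g, 0 ≤ F f g) :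
    0 ≤ binAvg F :=
  div_nonneg (Finset.sum_nonneg fun f _ => Finset.sum_nonneg fun g _ => h f g) (by positivity)

lemma binAvg_sum {ι : Type*} (s : Finset ι) (F : ι → (α → Fin Mx) → (β → Fin My) → ℝ) :
    binAvg (fun f g => ∑ i ∈ s, F i f g) = ∑ i ∈ s, binAvg (F i) := by
  unfold binAvg
  rw [← Finset.sum_div]
  congr 1
  rw [Finset.sum_comm]
  simp_rw [Finset.sum_comm (s := s)]
  rw [Finset.sum_comm]

lemma binAvg_const_mul (c : ℝ) (F : (α → Fin Mx) → (β → Fin My) → ℝ) :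
    binAvg (fun f g => c * F f g) = c * binAvg F := by
  unfold binAvg
  simp only [← Finset.mul_sum]
  rw [mul_div_assoc]

lemma binAvg_mul (F : (α → Fin Mx) → ℝ) (G : (β → Fin My) → ℝ) :
    binAvg (fun f g => F f * G g) = mapAvg F * mapAvg G := by
  unfold binAvg mapAvg
  rw [← Finset.sum_mul_sum, div_mul_div_comm]

lemma card_binMaps_pos (hM : 0 < M) : (0 : ℝ) < Fintype.card (α → Fin M) := by
  have : Nonempty (α → Fin M) := ⟨fun _ => ⟨0, hM⟩⟩
  exact_mod_cast Fintype.card_pos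

lemma mapAvg_const (hM : 0 < M) (c : ℝ) : mapAvg (fun _ : α → Fin M => c) = c := by
  unfold mapAvg
  rw [Finset.sum_const, nsmul_eq_mul, Finset.card_univ]
  exact mul_div_cancel_left₀ _ (card_binMaps_pos hM).ne'

lemma mapAvg_mono {F G : (α → Fin M) → ℝ} (h : ∀ f, F f ≤ G f) : mapAvg F ≤ mapAvg G :=
  div_le_div_of_nonneg_right (Finset.sum_le_sum fun f _ => h f) (by positivity)

lemma mapAvg_nonneg {F : (α → Fin M) → ℝ} (h : ∀ f, 0 ≤ F f) : 0 ≤ mapAvg F :=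
  div_nonneg (Finset.sum_nonneg fun f _ => h f) (by positivity)

lemma binAvg_const (hMx : 0 < Mx) (hMy : 0 < My) (c : ℝ) :
    binAvg (fun (_ : α → Fin Mx) (_ : β → Fin My) => c) = c := by
  have h := binAvg_mul (fun _ : α → Fin Mx => c) (fun _ : β → Fin My => (1 : ℝ))
  simpa [mapAvg_const hMx, mapAvg_const hMy] using h

/-- Redrawing one value of a map covers every map equally often. -/
lemma sum_sum_update {B : Type*} [Fintype B] (a : α) (F : (α → B) → ℝ) :
    ∑ f, ∑ b, F (Function.update f a b) = Fintype.card B * ∑ f, F f := by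
  let e : (α → B) × B → (α → B) × B := fun p => (Function.update p.1 a p.2, p.1 a)
  have he : Function.Involutive e := by
    rintro ⟨f, b⟩
    simp [e]
  rw [← Fintype.sum_prod_type' (f := fun f b => F (Function.update f a b))]
  have h1 := Equiv.sum_comp he.toPerm fun p : (α → B) × B => F p.1
  simp only [Function.Involutive.coe_toPerm, e] at h1
  rw [h1, Fintype.sum_prod_type]
  simp [Finset.mul_sum]

lemma mapAvg_resample (hM : 0 < M) (a : α) (F : (α → Fin M) → ℝ) :
    mapAvg F = mapAvg fun f => (∑ b, F (Function.update f a b)) / M := by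
  have hM' : (0 : ℝ) < M := by exact_mod_cast hM
  unfold mapAvg
  rw [← Finset.sum_div, sum_sum_update, Fintype.card_fin, mul_div_cancel_left₀ _ hM'.ne']

/-- Probability that two points get the same bin. -/
def collProb (M : ℕ) (x x' : α) : ℝ := mapAvg fun f : α → Fin M => if f x = f x' then 1 else 0

lemma collProb_nonneg (x x' : α) : 0 ≤ collProb M x x' :=
  mapAvg_nonneg fun f => by split_ifs <;> norm_num

lemma collProb_self (hM : 0 < M) (x : α) : collProb M x x = 1 := by
  simp [collProb, mapAvg_const hM]

lemma collProb_of_ne (hM : 0 < M) {x x' : α} (h : x ≠ x') : collProb M x x' = 1 / M := by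
  unfold collProb
  rw [mapAvg_resample hM x']
  simp [Function.update_of_ne h, mapAvg_const hM]

lemma one_div_le_collProb (hM : 0 < M) (x x' : α) : 1 / (M : ℝ) ≤ collProb M x x' := by
  by_cases h : x = x'
  · rw [h, collProb_self hM]
    have : (1 : ℝ) ≤ M := by exact_mod_cast hM
    exact div_le_one_of_le₀ this (by positivity)
  · rw [collProb_of_ne hM h]

/-- Three-point collisions: given a collision of `x` and `x'`, a further point joins with
probability `1/M` unless it is one of them. -/
lemma mapAvg_triple_le (hM : 0 < M) (x x' x'' : α) :
    (mapAvg fun f : α → Fin M => if f x = f x' ∧ f x = f x'' then (1 : ℝ) else 0) ≤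
      collProb M x x' * (1 / M + ((if x'' = x then 1 else 0) + if x'' = x' then 1 else 0)) := by
  have hM' : (0 : ℝ) < M := by exact_mod_cast hM
  by_cases h : x'' = x ∨ x'' = x'
  · have h1 : (1 : ℝ) ≤ 1 / M + ((if x'' = x then 1 else 0) + if x'' = x' then 1 else 0) := by
      have : (0 : ℝ) < 1 / M := by positivity
      rcases h with h | h <;> simp only [h, if_true] <;> split_ifs <;> linarith
    refine le_trans ?_ (le_mul_of_one_le_right (collProb_nonneg x x') h1)
    refine mapAvg_mono fun f => ?_
    split_ifs with h2 h3 <;> first | exact absurd h2.1 h3 | norm_num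
  · push Not at h
    rw [if_neg h.1, if_neg h.2, add_zero, add_zero, mapAvg_resample hM x'']
    refine le_of_eq ?_
    have : ∀ f : α → Fin M, (∑ b, if Function.update f x'' b x = Function.update f x'' b x' ∧
        Function.update f x'' b x = Function.update f x'' b x'' then (1 : ℝ) else 0) / M =
        (if f x = f x' then 1 else 0) * (1 / M) := by
      intro f
      simp only [Function.update_of_ne h.1.symm, Function.update_of_ne h.2.symm,
        Function.update_self]
      by_cases hf : f x = f x' <;> simp [hf]
    simp only [this]
    unfold collProb mapAvg
    rw [← Finset.sum_mul]
    ring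

/-- Two pairs of blocks with the same pair of bins. -/
def SameBins (f : α → Fin Mx) (g : β → Fin My) (t t' : α × β) : Prop :=
  f t.1 = f t'.1 ∧ g t.2 = g t'.2

instance (f : α → Fin Mx) (g : β → Fin My) (t t' : α × β) : Decidable (SameBins f g t t') := by
  unfold SameBins
  infer_instance

lemma binAvg_sameBins (t t' : α × β) :
    (binAvg fun (f : α → Fin Mx) (g : β → Fin My) => if SameBins f g t t' then (1 : ℝ) else 0) =
      collProb Mx t.1 t'.1 * collProb My t.2 t'.2 := by
  unfold collProb
  rw [← binAvg_mul]
  congr 1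
  funext f g
  by_cases h1 : f t.1 = f t'.1 <;> by_cases h2 : g t.2 = g t'.2 <;> simp [SameBins, h1, h2]

lemma binAvg_sameBins_triple_le (hMx : 0 < Mx) (hMy : 0 < My) (t t' t'' : α × β) :
    (binAvg fun (f : α → Fin Mx) (g : β → Fin My) =>
        if SameBins f g t t' ∧ SameBins f g t t'' then (1 : ℝ) else 0) ≤
      collProb Mx t.1 t'.1 * collProb My t.2 t'.2 *
        ((1 / Mx + ((if t''.1 = t.1 then 1 else 0) + if t''.1 = t'.1 then 1 else 0)) *
          (1 / My + ((if t''.2 = t.2 then 1 else 0) + if t''.2 = t'.2 then 1 else 0))) := by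
  have h1 := mapAvg_triple_le hMx t.1 t'.1 t''.1
  have h2 := mapAvg_triple_le hMy t.2 t'.2 t''.2
  have h := mul_le_mul h1 h2 (mapAvg_nonneg fun f => by split_ifs <;> norm_num)
    (le_trans (mapAvg_nonneg fun f => by split_ifs <;> norm_num) h1)
  rw [← binAvg_mul] at h
  refine le_trans (le_of_eq ?_) (h.trans (le_of_eq (by ring)))
  congr 1
  funext f g
  rw [ite_zero_mul_ite_zero, mul_one]
  exact if_congr (by unfold SameBins; tauto) rfl rfl

/-! ### Errors of a decoder at a given pair of blocks -/

variable (dec : (α → Fin Mx) → (β → Fin My) → Fin Mx → Fin My → α × β)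

/-- Probability over the random bins that the pair of blocks `t` is decoded wrongly. -/
def pairErr (t : α × β) : ℝ :=
  binAvg fun f g => if dec f g (f t.1) (g t.2) ≠ t then 1 else 0

lemma pairErr_nonneg (t : α × β) : 0 ≤ pairErr dec t :=
  binAvg_nonneg fun f g => by split_ifs <;> norm_num

lemma pairErr_le_one (hMx : 0 < Mx) (hMy : 0 < My) (t : α × β) : pairErr dec t ≤ 1 := by
  rw [← binAvg_const (α := α) (β := β) hMx hMy 1]
  exact binAvg_mono fun f g => by split_ifs <;> norm_num

/-- Union bound for a decoder that minimizes the metric `q` over the received bins. -/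
lemma pairErr_le_sum {q : α → β → ℝ}
    (hdec : ∀ f g x y, f (dec f g (f x) (g y)).1 = f x ∧ g (dec f g (f x) (g y)).2 = g y ∧
      q (dec f g (f x) (g y)).1 (dec f g (f x) (g y)).2 ≤ q x y) (t : α × β) :
    pairErr dec t ≤ ∑ t' with t' ≠ t ∧ q t'.1 t'.2 ≤ q t.1 t.2,
      collProb Mx t.1 t'.1 * collProb My t.2 t'.2 := by
  unfold pairErr
  simp only [← binAvg_sameBins]
  rw [← binAvg_sum]
  refine binAvg_mono fun f g => ?_
  split_ifs with h
  · obtain ⟨h1, h2, h3⟩ := hdec f g t.1 t.2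
    refine le_trans (le_of_eq ?_) (Finset.single_le_sum
      (f := fun t' => if SameBins f g t t' then (1 : ℝ) else 0)
      (fun i _ => by split_ifs <;> norm_num)
      (Finset.mem_filter.2 ⟨Finset.mem_univ (dec f g (f t.1) (g t.2)), h, h3⟩))
    exact (if_pos ⟨h1.symm, h2.symm⟩).symm
  · exact Finset.sum_nonneg fun i _ => by split_ifs <;> norm_num

/-- The points of `T` that share their bins with another point of `T` number at most twice the
wrongly decoded ones: a correct point forces its partner to be wrong. -/
lemma card_collided_le (T : Finset (α × β)) (f : α → Fin Mx) (g : β → Fin My) :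
    (T.filter fun t => ∃ t' ∈ T, t' ≠ t ∧ SameBins f g t t').card ≤
      2 * (T.filter fun t => dec f g (f t.1) (g t.2) ≠ t).card := by
  set Zs := T.filter fun t => ∃ t' ∈ T, t' ≠ t ∧ SameBins f g t t'
  set W := T.filter fun t => dec f g (f t.1) (g t.2) ≠ t
  have hpartner : ∀ t ∈ Zs, ∃ t' ∈ T, t' ≠ t ∧ SameBins f g t t' := fun t ht =>
    (Finset.mem_filter.1 ht).2
  choose! φ hφT hφne hφS using hpartner
  have hdecφ : ∀ t ∈ Zs \ W, dec f g (f (φ t).1) (g (φ t).2) = t := by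
    intro t ht
    obtain ⟨htZ, htW⟩ := Finset.mem_sdiff.1 ht
    have hc : dec f g (f t.1) (g t.2) = t := by
      by_contra hne
      exact htW (Finset.mem_filter.2 ⟨(Finset.mem_filter.1 htZ).1, hne⟩)
    rw [← (hφS t htZ).1, ← (hφS t htZ).2, hc]
  have h1 : (Zs \ W).card ≤ W.card := by
    refine Finset.card_le_card_of_injOn φ (fun t ht => ?_) fun t ht t' ht' h => ?_
    · have htZ := (Finset.mem_sdiff.1 ht).1
      refine Finset.mem_coe.2 (Finset.mem_filter.2 ⟨hφT t htZ, ?_⟩)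
      rw [hdecφ t ht]
      exact (hφne t htZ).symm
    · rw [← hdecφ t ht, ← hdecφ t' ht', h]
  have h2 : Zs.card ≤ (Zs \ W).card + W.card := by
    have := Finset.card_le_card_sdiff_add_card (s := Zs) (t := W)
    omega
  omega

/-- Second-moment lower bound, valid for every decoder: if the fibres of `T` over the two
coordinates have at most `a` and `b` elements, the expected number of wrongly decoded points of `T`
is at least half the expected number of colliding pairs, divided by the largest conditional
expectation of the number of further collisions. -/
lemma sum_collProb_le_mul_sum_pairErr (hMx : 0 < Mx) (hMy : 0 < My) (T : Finset (α × β)) {a b : ℝ}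
    (ha : ∀ y, ((T.filter fun t => t.2 = y).card : ℝ) ≤ a)
    (hb : ∀ x, ((T.filter fun t => t.1 = x).card : ℝ) ≤ b) :
    ∑ t ∈ T, ∑ t' ∈ T.erase t, collProb Mx t.1 t'.1 * collProb My t.2 t'.2 ≤
      2 * (T.card / (Mx * My) + 2 * a / Mx + 2 * b / My + 4) * ∑ t ∈ T, pairErr dec t := by
  have hMx' : (0 : ℝ) < Mx := by exact_mod_cast hMx
  have hMy' : (0 : ℝ) < My := by exact_mod_cast hMy
  rcases T.eq_empty_or_nonempty with rfl | ⟨t₀, -⟩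
  · simp
  have ha0 : 0 ≤ a := le_trans (Nat.cast_nonneg _) (ha t₀.2)
  have hb0 : 0 ≤ b := le_trans (Nat.cast_nonneg _) (hb t₀.1)
  set S := ∑ t ∈ T, ∑ t' ∈ T.erase t, collProb Mx t.1 t'.1 * collProb My t.2 t'.2 with hS
  set Λ : ℝ := T.card / (Mx * My) + 2 * a / Mx + 2 * b / My + 4 with hΛ
  -- the number of points of `T` colliding with `t`
  let N : (α → Fin Mx) → (β → Fin My) → α × β → ℝ := fun f g t =>
    ∑ t' ∈ T.erase t, if SameBins f g t t' then 1 else 0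
  have hN0 : ∀ f g t, 0 ≤ N f g t := fun f g t =>
    Finset.sum_nonneg fun _ _ => by split_ifs <;> norm_num
  have hS1 : binAvg (fun f g => ∑ t ∈ T, N f g t) = S := by
    rw [binAvg_sum]
    refine Finset.sum_congr rfl fun t _ => ?_
    rw [binAvg_sum]
    exact Finset.sum_congr rfl fun t' _ => binAvg_sameBins t t'
  have hsum : ∀ t t' : α × β, ∑ t'' ∈ T,
      ((1 / (Mx : ℝ) + ((if t''.1 = t.1 then 1 else 0) + if t''.1 = t'.1 then 1 else 0)) *
          (1 / (My : ℝ) + ((if t''.2 = t.2 then 1 else 0) + if t''.2 = t'.2 then 1 else 0))) ≤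
        Λ := by
    intro t t'
    have e1 : ∀ x, ∑ t'' ∈ T, (if t''.1 = x then (1 : ℝ) else 0) ≤ b := fun x => by
      rw [Finset.sum_boole]
      exact hb x
    have e2 : ∀ y, ∑ t'' ∈ T, (if t''.2 = y then (1 : ℝ) else 0) ≤ a := fun y => by
      rw [Finset.sum_boole]
      exact ha y
    have e3 : ∀ x y, ∑ t'' ∈ T, (if t''.1 = x then (1 : ℝ) else 0) *
        (if t''.2 = y then (1 : ℝ) else 0) ≤ 1 := fun x y => by
      have : ∀ t'' : α × β, (if t''.1 = x then (1 : ℝ) else 0) *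
          (if t''.2 = y then (1 : ℝ) else 0) = if t'' = (x, y) then 1 else 0 := by
        intro t''
        by_cases h1 : t''.1 = x <;> by_cases h2 : t''.2 = y <;> simp [h1, h2, Prod.ext_iff]
      simp only [this]
      rw [Finset.sum_ite_eq']
      split_ifs <;> norm_num
    have e4 : ∑ t'' ∈ T,
      ((1 / (Mx : ℝ) + ((if t''.1 = t.1 then 1 else 0) + if t''.1 = t'.1 then 1 else 0)) *
          (1 / (My : ℝ) + ((if t''.2 = t.2 then 1 else 0) + if t''.2 = t'.2 then 1 else 0))) =
        T.card / (Mx * My) +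
        (1 / Mx) * (∑ t'' ∈ T, (if t''.2 = t.2 then (1 : ℝ) else 0) +
          ∑ t'' ∈ T, (if t''.2 = t'.2 then (1 : ℝ) else 0)) +
        (1 / My) * (∑ t'' ∈ T, (if t''.1 = t.1 then (1 : ℝ) else 0) +
          ∑ t'' ∈ T, (if t''.1 = t'.1 then (1 : ℝ) else 0)) +
        (∑ t'' ∈ T, (if t''.1 = t.1 then (1 : ℝ) else 0) * (if t''.2 = t.2 then (1 : ℝ) else 0) +
        ∑ t'' ∈ T, (if t''.1 = t.1 then (1 : ℝ) else 0) * (if t''.2 = t'.2 then (1 : ℝ) else 0) +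
        ∑ t'' ∈ T, (if t''.1 = t'.1 then (1 : ℝ) else 0) * (if t''.2 = t.2 then (1 : ℝ) else 0) +
        ∑ t'' ∈ T, (if t''.1 = t'.1 then (1 : ℝ) else 0) *
          (if t''.2 = t'.2 then (1 : ℝ) else 0)) := by
      have : (T.card : ℝ) / (Mx * My) = ∑ t'' ∈ T, 1 / (Mx * My : ℝ) := by
        rw [Finset.sum_const, nsmul_eq_mul]
        ring
      rw [this]
      simp only [← Finset.sum_add_distrib, Finset.mul_sum]
      refine Finset.sum_congr rfl fun t'' _ => ?_
      ring
    rw [e4, hΛ]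
    have f1 : (1 / (Mx : ℝ)) * (∑ t'' ∈ T, (if t''.2 = t.2 then (1 : ℝ) else 0) +
          ∑ t'' ∈ T, (if t''.2 = t'.2 then (1 : ℝ) else 0)) ≤ 2 * a / Mx := by
      rw [one_div, inv_mul_eq_div]
      refine div_le_div_of_nonneg_right ?_ hMx'.le
      linarith [e2 t.2, e2 t'.2]
    have f2 : (1 / (My : ℝ)) * (∑ t'' ∈ T, (if t''.1 = t.1 then (1 : ℝ) else 0) +
          ∑ t'' ∈ T, (if t''.1 = t'.1 then (1 : ℝ) else 0)) ≤ 2 * b / My := by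
      rw [one_div, inv_mul_eq_div]
      refine div_le_div_of_nonneg_right ?_ hMy'.le
      linarith [e1 t.1, e1 t'.1]
    linarith [e3 t.1 t.2, e3 t.1 t'.2, e3 t'.1 t.2, e3 t'.1 t'.2]
  have hS2 : binAvg (fun f g => ∑ t ∈ T, N f g t ^ 2) ≤ Λ * S := by
    rw [binAvg_sum, hS, Finset.mul_sum]
    refine Finset.sum_le_sum fun t _ => ?_
    have hsq : ∀ f g, N f g t ^ 2 = ∑ t' ∈ T.erase t, ∑ t'' ∈ T.erase t,
        if SameBins f g t t' ∧ SameBins f g t t'' then (1 : ℝ) else 0 := by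
      intro f g
      simp only [N]
      rw [sq, Finset.sum_mul_sum]
      refine Finset.sum_congr rfl fun t' _ => Finset.sum_congr rfl fun t'' _ => ?_
      by_cases h1 : SameBins f g t t' <;> by_cases h2 : SameBins f g t t'' <;> simp [h1, h2]
    simp only [hsq]
    rw [binAvg_sum, Finset.mul_sum]
    refine Finset.sum_le_sum fun t' _ => ?_
    rw [binAvg_sum]
    have hc : 0 ≤ collProb Mx t.1 t'.1 * collProb My t.2 t'.2 :=
      mul_nonneg (collProb_nonneg _ _) (collProb_nonneg _ _)
    calc _ ≤ ∑ t'' ∈ T.erase t, collProb Mx t.1 t'.1 * collProb My t.2 t'.2 *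
        ((1 / Mx + ((if t''.1 = t.1 then 1 else 0) + if t''.1 = t'.1 then 1 else 0)) *
          (1 / My + ((if t''.2 = t.2 then 1 else 0) + if t''.2 = t'.2 then 1 else 0))) :=
          Finset.sum_le_sum fun t'' _ => binAvg_sameBins_triple_le hMx hMy t t' t''
      _ ≤ ∑ t'' ∈ T, collProb Mx t.1 t'.1 * collProb My t.2 t'.2 *
        ((1 / Mx + ((if t''.1 = t.1 then 1 else 0) + if t''.1 = t'.1 then 1 else 0)) *
          (1 / My + ((if t''.2 = t.2 then 1 else 0) + if t''.2 = t'.2 then 1 else 0))) := by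
          refine Finset.sum_le_sum_of_subset_of_nonneg (Finset.erase_subset _ _) fun t'' _ _ => ?_
          refine mul_nonneg hc (mul_nonneg ?_ ?_) <;> positivity
      _ ≤ Λ * (collProb Mx t.1 t'.1 * collProb My t.2 t'.2) := by
          rw [← Finset.mul_sum, mul_comm Λ]
          exact mul_le_mul_of_nonneg_left (hsum t t') hc
  -- the expected number of colliding points
  set C := binAvg fun (f : α → Fin Mx) (g : β → Fin My) =>
    ((T.filter fun t => ∃ t' ∈ T, t' ≠ t ∧ SameBins f g t t').card : ℝ) with hC
  have hCS : S ^ 2 ≤ C * (Λ * S) := by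
    have hpt : ∀ f g t, t ∈ T → N f g t =
        (if ∃ t' ∈ T, t' ≠ t ∧ SameBins f g t t' then 1 else 0) * N f g t := by
      intro f g t _
      split_ifs with h
      · rw [one_mul]
      · rw [zero_mul]
        refine Finset.sum_eq_zero fun t' ht' => if_neg fun hs => h ?_
        exact ⟨t', Finset.mem_of_mem_erase ht', Finset.ne_of_mem_erase ht', hs⟩
    have hcs := Finset.sum_mul_sq_le_sq_mul_sq
      (Finset.univ ×ˢ Finset.univ ×ˢ T : Finset ((α → Fin Mx) × (β → Fin My) × (α × β)))
      (fun p => if ∃ t' ∈ T, t' ≠ p.2.2 ∧ SameBins p.1 p.2.1 p.2.2 t' then (1 : ℝ) else 0)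
      (fun p => N p.1 p.2.1 p.2.2)
    simp only [Finset.sum_product] at hcs
    have hK : (0 : ℝ) < (Fintype.card (α → Fin Mx) : ℝ) * (Fintype.card (β → Fin My) : ℝ) :=
      mul_pos (card_binMaps_pos hMx) (card_binMaps_pos hMy)
    have h1 : S * ((Fintype.card (α → Fin Mx) : ℝ) * (Fintype.card (β → Fin My) : ℝ)) =
        ∑ f : α → Fin Mx, ∑ g : β → Fin My, ∑ t ∈ T,
          (if ∃ t' ∈ T, t' ≠ t ∧ SameBins f g t t' then 1 else 0) * N f g t := by
      rw [← hS1, binAvg, div_mul_cancel₀ _ hK.ne']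
      exact Finset.sum_congr rfl fun f _ => Finset.sum_congr rfl fun g _ =>
        Finset.sum_congr rfl fun t ht => hpt f g t ht
    have h2 : C * ((Fintype.card (α → Fin Mx) : ℝ) * (Fintype.card (β → Fin My) : ℝ)) =
        ∑ f : α → Fin Mx, ∑ g : β → Fin My, ∑ t ∈ T,
          (if ∃ t' ∈ T, t' ≠ t ∧ SameBins f g t t' then (1 : ℝ) else 0) ^ 2 := by
      rw [hC, binAvg, div_mul_cancel₀ _ hK.ne']
      refine Finset.sum_congr rfl fun f _ => Finset.sum_congr rfl fun g _ => ?_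
      rw [← Finset.sum_boole]
      exact Finset.sum_congr rfl fun t _ => by split_ifs <;> norm_num
    have h3 : (∑ f : α → Fin Mx, ∑ g : β → Fin My, ∑ t ∈ T, N f g t ^ 2) ≤
        Λ * S * ((Fintype.card (α → Fin Mx) : ℝ) * (Fintype.card (β → Fin My) : ℝ)) := by
      rw [← div_le_iff₀ hK]
      exact hS2
    rw [← h1, ← h2] at hcs
    have hC0 : 0 ≤ C := binAvg_nonneg fun f g => Nat.cast_nonneg _
    have h4 := hcs.trans (mul_le_mul_of_nonneg_left h3 (mul_nonneg hC0 hK.le))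
    have hK2 := mul_pos hK hK
    refine le_of_mul_le_mul_right ?_ hK2
    linarith
  have hCW : C ≤ 2 * ∑ t ∈ T, pairErr dec t := by
    unfold pairErr
    rw [← binAvg_sum, ← binAvg_const_mul]
    refine binAvg_mono fun f g => ?_
    rw [Finset.sum_boole]
    exact_mod_cast card_collided_le dec T f g
  have hS0 : 0 ≤ S := Finset.sum_nonneg fun _ _ => Finset.sum_nonneg fun _ _ =>
    mul_nonneg (collProb_nonneg _ _) (collProb_nonneg _ _)
  have hΛ0 : 0 ≤ Λ := by positivity
  have h1 : S ≤ C * Λ := by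
    rcases hS0.eq_or_lt with h0 | h0
    · rw [← h0]
      exact mul_nonneg (binAvg_nonneg fun f g => Nat.cast_nonneg _) hΛ0
    · refine le_of_mul_le_mul_right ?_ h0
      linarith
  calc S ≤ C * Λ := h1
    _ ≤ (2 * ∑ t ∈ T, pairErr dec t) * Λ := mul_le_mul_of_nonneg_right hCW hΛ0
    _ = _ := by ring

/-- A decoder that maximizes the probability has the smallest average error. -/
lemma sum_mul_pairErr_le_of_maximizer
    (dec' : (α → Fin Mx) → (β → Fin My) → Fin Mx → Fin My → α × β) {P : α → β → ℝ}
    (hP : ∀ x y, 0 ≤ P x y)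
    (hdec : ∀ f g x y, f (dec f g (f x) (g y)).1 = f x ∧ g (dec f g (f x) (g y)).2 = g y ∧
      -P (dec f g (f x) (g y)).1 (dec f g (f x) (g y)).2 ≤ -P x y) :
    ∑ t : α × β, P t.1 t.2 * pairErr dec t ≤ ∑ t : α × β, P t.1 t.2 * pairErr dec' t := by
  unfold pairErr
  simp only [← binAvg_const_mul]
  rw [← binAvg_sum, ← binAvg_sum]
  refine binAvg_mono fun f g => ?_
  have hcompl : ∀ D : (α → Fin Mx) → (β → Fin My) → Fin Mx → Fin My → α × β,
      ∑ t : α × β, P t.1 t.2 * (if D f g (f t.1) (g t.2) ≠ t then 1 else 0) =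
        ∑ t : α × β, P t.1 t.2 - ∑ t with D f g (f t.1) (g t.2) = t, P t.1 t.2 := by
    intro D
    rw [Finset.sum_filter, ← Finset.sum_sub_distrib]
    refine Finset.sum_congr rfl fun t _ => ?_
    by_cases h : D f g (f t.1) (g t.2) = t <;> simp [h]
  rw [hcompl, hcompl]
  refine sub_le_sub_left ?_ _
  let m : α × β → α × β := fun t => dec f g (f t.1) (g t.2)
  have hm : ∀ t, f (m t).1 = f t.1 ∧ g (m t).2 = g t.2 := fun t =>
    ⟨(hdec f g t.1 t.2).1, (hdec f g t.1 t.2).2.1⟩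
  calc ∑ t with dec' f g (f t.1) (g t.2) = t, P t.1 t.2
      ≤ ∑ t with dec' f g (f t.1) (g t.2) = t, P (m t).1 (m t).2 :=
        Finset.sum_le_sum fun t _ => neg_le_neg_iff.1 (hdec f g t.1 t.2).2.2
    _ = ∑ t ∈ (Finset.univ.filter fun t => dec' f g (f t.1) (g t.2) = t).image m, P t.1 t.2 := by
        rw [Finset.sum_image]
        intro t ht t' ht' h
        have h1 : dec' f g (f t.1) (g t.2) = t := by simpa using ht
        have h2 : dec' f g (f t'.1) (g t'.2) = t' := by simpa using ht'
        rw [← h1, ← h2, ← (hm t).1, ← (hm t).2, ← (hm t').1, ← (hm t').2, h]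
    _ ≤ _ := by
        refine Finset.sum_le_sum_of_subset_of_nonneg (fun t ht => ?_) fun t _ _ => hP _ _
        obtain ⟨t', _, rfl⟩ := Finset.mem_image.1 ht
        refine Finset.mem_filter.2 ⟨Finset.mem_univ _, ?_⟩
        rw [(hm t').1, (hm t').2]

end Binning

section ErrorProb

variable {X Y : Type*} [Fintype X] [Fintype Y] [DecidableEq X] [DecidableEq Y] {n Mx My : ℕ}

lemma errorProb_eq_sum_pairErr (P : X × Y → ℝ) (d : Fin (n + 1)) (dec : Decoder X Y n Mx My) :
    errorProb P d dec =
      ∑ ω : (Fin n → X) × (Fin n → Y), blockProb P d ω.1 ω.2 * pairErr dec ω := by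
  unfold pairErr
  simp only [← binAvg_const_mul]
  rw [← binAvg_sum]
  unfold errorProb binAvg
  congr 1
  refine Finset.sum_congr rfl fun f _ => Finset.sum_congr rfl fun g _ => ?_
  simp only
  rw [Fintype.sum_prod_type]
  refine Finset.sum_congr rfl fun x _ => Finset.sum_congr rfl fun y _ => ?_
  split_ifs <;> simp

end ErrorProb

/-! ### Upper bound on the error probability of the universal decoder -/

lemma one_le_two_rpow_mul {n : ℕ} {R : ℝ} (hR : 0 ≤ R) : (1 : ℝ) ≤ (2 : ℝ) ^ ((n : ℝ) * R) :=
  Real.one_le_rpow one_le_two (by positivity)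

lemma numBins_pos (n : ℕ) {R : ℝ} (hR : 0 ≤ R) : 0 < numBins n R :=
  Nat.floor_pos.2 (one_le_two_rpow_mul hR)

lemma numBins_le (n : ℕ) (R : ℝ) : (numBins n R : ℝ) ≤ (2 : ℝ) ^ ((n : ℝ) * R) :=
  Nat.floor_le (by positivity)

lemma one_div_numBins_le (n : ℕ) {R : ℝ} (hR : 0 ≤ R) :
    1 / (numBins n R : ℝ) ≤ 2 * (2 : ℝ) ^ (-((n : ℝ) * R)) := by
  have h1 : (1 : ℝ) ≤ numBins n R := by exact_mod_cast numBins_pos n hR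
  have h2 : (2 : ℝ) ^ ((n : ℝ) * R) < numBins n R + 1 := Nat.lt_floor_add_one _
  rw [Real.rpow_neg two_pos.le, ← div_eq_mul_inv, div_le_div_iff₀ (by linarith) (by positivity)]
  linarith

section Metrics

variable {X Y : Type*} [Fintype X] [Fintype Y] [DecidableEq X] [DecidableEq Y] {n : ℕ}

lemma empEntropy_eq_condEnt {A : Type*} [Fintype A] [DecidableEq A] {m : ℕ} (z : Fin m → A) :
    entropy (empirical z) = condEnt (fun _ => ()) (empirical z) := by
  rcases Nat.eq_zero_or_pos m with rfl | hm
  · have : empirical z = 0 := by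
      funext a
      simp [empirical]
    simp [this, entropy, condEnt]
  · refine entropy_eq_condEnt ?_
    have hm' : (m : ℝ) ≠ 0 := by exact_mod_cast hm.ne'
    have h := sum_comp_eq_empirical z fun _ => 1
    simp only [Finset.sum_const, Finset.card_univ, Fintype.card_fin, nsmul_eq_mul, mul_one] at h
    exact (mul_left_cancel₀ hm' (by rw [mul_one]; exact h)).symm

lemma condEnt_id {A : Type*} [Fintype A] [DecidableEq A] (q : A → ℝ) : condEnt id q = 0 := by
  have : ∀ a, fibSum id q a = q a := fun a => by simp [fibSum, Finset.filter_eq']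
  unfold condEnt
  rw [neg_eq_zero]
  refine Finset.sum_eq_zero fun a _ => ?_
  by_cases h : q a = 0
  · simp [h]
  · rw [id, this, div_self h, Real.logb_one, mul_zero]

lemma cast_sub_delay (k : Fin (n + 1)) : ((n - (k : ℕ) : ℕ) : ℝ) = (n : ℝ) - (k : ℕ) :=
  Nat.cast_sub (Nat.lt_succ_iff.1 k.2)

lemma uMetric_eq_segMetric (k : Fin (n + 1)) (ω : (Fin n → X) × (Fin n → Y)) :
    uMetric k ω.1 ω.2 = segMetric (fun _ => ()) (fun _ => ()) (fun _ => ()) k ω := by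
  unfold uMetric segMetric blockMean empEntropy empJoint
  rw [empEntropy_eq_condEnt, empEntropy_eq_condEnt, empEntropy_eq_condEnt, cast_sub_delay]
  rfl

lemma vMetric_eq_segMetric (k : Fin (n + 1)) (ω : (Fin n → X) × (Fin n → Y)) :
    vMetric k ω.1 ω.2 = segMetric id Prod.snd (fun _ => ()) k ω := by
  unfold vMetric segMetric blockMean empEntropy empCond
  rw [empEntropy_eq_condEnt, condEntropy_eq_condEnt, condEnt_id, mul_zero, zero_add,
    cast_sub_delay]
  rfl

lemma empirical_swap {A B : Type*} [DecidableEq A] [DecidableEq B] {m : ℕ} (x : Fin m → A)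
    (y : Fin m → B) :
    empirical (fun i => (y i, x i)) = swapLaw (empirical fun i => (x i, y i)) := by
  funext ⟨b, a⟩
  simp only [empirical, swapLaw, Prod.mk.injEq, and_comm]

lemma wMetric_eq_segMetric (k : Fin (n + 1)) (ω : (Fin n → X) × (Fin n → Y)) :
    wMetric k ω.1 ω.2 = segMetric (fun _ => ()) Prod.fst id k ω := by
  unfold wMetric segMetric blockMean empEntropy empCond
  rw [empEntropy_eq_condEnt, empirical_swap, condEntropy_swapLaw_eq_condEnt, condEnt_id, mul_zero,
    add_zero, cast_sub_delay]
  rfl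

/-- The side information of the first error event is the whole second block. -/
lemma sameSide_snd_iff (k : Fin (n + 1)) (ω ω' : (Fin n → X) × (Fin n → Y)) :
    SameSide id Prod.snd (fun _ => ()) k ω ω' ↔ ω'.2 = ω.2 := by
  constructor
  · rintro ⟨h1, h2, -⟩
    refine (splitEquiv (k : ℕ) (n - (k : ℕ)) (by omega)).injective ?_
    exact Prod.ext (funext h1) (funext h2)
  · intro h
    unfold SameSide
    rw [h]
    simp [pairSeg]

lemma sameSide_fst_iff (k : Fin (n + 1)) (ω ω' : (Fin n → X) × (Fin n → Y)) :
    SameSide (fun _ => ()) Prod.fst id k ω ω' ↔ ω'.1 = ω.1 := by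
  constructor
  · rintro ⟨-, h2, h3⟩
    refine (splitEquiv (n - (k : ℕ)) (k : ℕ) (by omega)).injective ?_
    exact Prod.ext (funext h2) (funext h3)
  · intro h
    unfold SameSide
    rw [h]
    simp [pairSeg]

lemma sameSide_const (k : Fin (n + 1)) (ω ω' : (Fin n → X) × (Fin n → Y)) :
    SameSide (fun _ => ()) (fun _ => ()) (fun _ => ()) k ω ω' :=
  ⟨fun _ => rfl, fun _ => rfl, fun _ => rfl⟩

end Metrics

/-- Counting by a Kraft-type inequality: few points can have one of the metrics `D k` at
most `t`. -/
lemma card_le_of_kraft {ι Ω : Type*} [Fintype ι] (D : ι → Ω → ℝ) (S : Finset Ω) {K t : ℝ}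
    (hK : ∀ k, ∑ ω ∈ S, (2 : ℝ) ^ (-D k ω) ≤ K) (hS : ∀ ω ∈ S, ∃ k, D k ω ≤ t) :
    (S.card : ℝ) ≤ Fintype.card ι * K * (2 : ℝ) ^ t := by
  have h2 : ∀ z : ℝ, 0 < (2 : ℝ) ^ z := fun z => Real.rpow_pos_of_pos two_pos z
  calc (S.card : ℝ) = ∑ ω ∈ S, (1 : ℝ) := by simp
    _ ≤ ∑ ω ∈ S, ∑ k, (2 : ℝ) ^ t * (2 : ℝ) ^ (-D k ω) := by
        refine Finset.sum_le_sum fun ω hω => ?_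
        obtain ⟨k, hk⟩ := hS ω hω
        refine le_trans ?_ (Finset.single_le_sum (f := fun k => (2 : ℝ) ^ t * (2 : ℝ) ^ (-D k ω))
          (fun k _ => (mul_pos (h2 _) (h2 _)).le) (Finset.mem_univ k))
        rw [← Real.rpow_add two_pos]
        exact Real.one_le_rpow one_le_two (by linarith)
    _ = ∑ k, (2 : ℝ) ^ t * ∑ ω ∈ S, (2 : ℝ) ^ (-D k ω) := by
        rw [Finset.sum_comm]
        simp only [Finset.mul_sum]
    _ ≤ ∑ _k : ι, (2 : ℝ) ^ t * K :=
        Finset.sum_le_sum fun k _ => mul_le_mul_of_nonneg_left (hK k) (h2 t).le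
    _ = _ := by
        rw [Finset.sum_const, nsmul_eq_mul, Finset.card_univ]
        ring

section Universal

variable {X Y : Type*} [Fintype X] [Fintype Y] [DecidableEq X] [DecidableEq Y]

/-- Degree of the polynomial factor lost by the universal decoder. -/
def polyDeg (X Y : Type*) [Fintype X] [Fintype Y] : ℕ :=
  Fintype.card Y + Fintype.card (X × Y) + Fintype.card X + 1

/-- Each of the three kinds of wrong candidates contributes at most a polynomial multiple of
`2^q` to the expected number of competitors. -/
lemma pairErr_le_qMetric {n : ℕ} {Rx Ry : ℝ} (hRx : 0 ≤ Rx) (hRy : 0 ≤ Ry)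
    {dec : Decoder X Y n (numBins n Rx) (numBins n Ry)}
    (hdec : IsMetricDecoder (qMetric Rx Ry) dec) (ω : (Fin n → X) × (Fin n → Y)) :
    pairErr dec ω ≤ 8 * ((n : ℝ) + 1) ^ polyDeg X Y * (2 : ℝ) ^ qMetric Rx Ry ω.1 ω.2 := by
  have hMx := numBins_pos n hRx
  have hMy := numBins_pos n hRy
  set K : ℝ := ((n : ℝ) + 1) ^ (Fintype.card Y + Fintype.card (X × Y) + Fintype.card X) with hKdef
  set t := qMetric Rx Ry ω.1 ω.2 with ht
  have hK0 : 0 < K := by positivity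
  have hatt : ∀ ω' : (Fin n → X) × (Fin n → Y), qMetric Rx Ry ω'.1 ω'.2 ≤ t →
      ∃ k, qMetricAt Rx Ry k ω'.1 ω'.2 ≤ t := by
    intro ω' h
    obtain ⟨k, -, hk⟩ := Finset.exists_mem_eq_inf' Finset.univ_nonempty
      fun k : Fin (n + 1) => qMetricAt Rx Ry k ω'.1 ω'.2
    exact ⟨k, hk ▸ h⟩
  have hcard : ∀ (D : Fin (n + 1) → (Fin n → X) × (Fin n → Y) → ℝ)
      (S : Finset ((Fin n → X) × (Fin n → Y))) (R : ℝ),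
      (∀ k, ∑ ω' ∈ S, (2 : ℝ) ^ (-D k ω') ≤ K) →
      (∀ ω' ∈ S, qMetric Rx Ry ω'.1 ω'.2 ≤ t) →
      (∀ k ω', D k ω' - n * R ≤ qMetricAt Rx Ry k ω'.1 ω'.2) →
      (S.card : ℝ) ≤ ((n : ℝ) + 1) ^ polyDeg X Y * ((2 : ℝ) ^ t * (2 : ℝ) ^ (n * R)) := by
    intro D S R h1 h2 h3
    have := card_le_of_kraft D S (t := t + n * R) h1 fun ω' hω' => by
      obtain ⟨k, hk⟩ := hatt ω' (h2 ω' hω')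
      exact ⟨k, by linarith [h3 k ω']⟩
    refine this.trans (le_of_eq ?_)
    rw [Real.rpow_add two_pos, hKdef, Fintype.card_fin, polyDeg, pow_succ]
    push_cast
    ring
  have hkraft : ∀ (S S' : Finset ((Fin n → X) × (Fin n → Y))) (D : _ → ℝ), S ⊆ S' →
      ∑ ω' ∈ S', (2 : ℝ) ^ (-D ω') ≤ K → ∑ ω' ∈ S, (2 : ℝ) ^ (-D ω') ≤ K :=
    fun S S' D hS h => (Finset.sum_le_sum_of_subset_of_nonneg hS fun _ _ _ =>
      (Real.rpow_pos_of_pos two_pos _).le).trans h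
  let A := Finset.univ.filter fun ω' : (Fin n → X) × (Fin n → Y) =>
    ω' ≠ ω ∧ qMetric Rx Ry ω'.1 ω'.2 ≤ t
  have hA : ∀ ω' ∈ A, qMetric Rx Ry ω'.1 ω'.2 ≤ t := fun ω' h => (Finset.mem_filter.1 h).2.2
  let Sv := A.filter fun ω' => ω'.2 = ω.2
  let Sw := A.filter fun ω' => ω'.1 = ω.1
  have hv := hcard (fun k => segMetric id Prod.snd (fun _ => ()) k) Sv Rx
    (fun k => by
      refine hkraft Sv _ _ (fun ω' h => ?_)
        (sum_sameSide_two_rpow_neg_segMetric_le id Prod.snd (fun _ => ()) k ω)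
      exact Finset.mem_filter.2 ⟨Finset.mem_univ _,
        (sameSide_snd_iff k ω ω').2 (Finset.mem_filter.1 h).2⟩)
    (fun ω' h => hA ω' (Finset.mem_filter.1 h).1)
    (fun k ω' => by
      rw [← vMetric_eq_segMetric]
      exact (le_max_left _ _).trans (le_max_right _ _))
  have hw := hcard (fun k => segMetric (fun _ => ()) Prod.fst id k) Sw Ry
    (fun k => by
      refine hkraft Sw _ _ (fun ω' h => ?_)
        (sum_sameSide_two_rpow_neg_segMetric_le (fun _ => ()) Prod.fst id k ω)
      exact Finset.mem_filter.2 ⟨Finset.mem_univ _,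
        (sameSide_fst_iff k ω ω').2 (Finset.mem_filter.1 h).2⟩)
    (fun ω' h => hA ω' (Finset.mem_filter.1 h).1)
    (fun k ω' => by
      rw [← wMetric_eq_segMetric]
      exact (le_max_right _ _).trans (le_max_right _ _))
  have hu := hcard (fun k => segMetric (fun _ => ()) (fun _ => ()) (fun _ => ()) k) A (Rx + Ry)
    (fun k => by
      refine hkraft A _ _ (fun ω' h => ?_)
        (sum_sameSide_two_rpow_neg_segMetric_le (fun _ => ()) (fun _ => ()) (fun _ => ()) k ω)
      exact Finset.mem_filter.2 ⟨Finset.mem_univ _, sameSide_const k ω ω'⟩)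
    hA
    (fun k ω' => by
      rw [← uMetric_eq_segMetric]
      exact le_max_left _ _)
  have hcx := one_div_numBins_le n hRx
  have hcy := one_div_numBins_le n hRy
  have hx0 : (0 : ℝ) ≤ 1 / (numBins n Rx : ℝ) := by positivity
  have hy0 : (0 : ℝ) ≤ 1 / (numBins n Ry : ℝ) := by positivity
  have hterm : ∀ ω' ∈ A, collProb (numBins n Rx) ω.1 ω'.1 * collProb (numBins n Ry) ω.2 ω'.2 ≤
      (if ω'.2 = ω.2 then 1 / (numBins n Rx : ℝ) else 0) +
      (if ω'.1 = ω.1 then 1 / (numBins n Ry : ℝ) else 0) +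
      1 / (numBins n Rx : ℝ) * (1 / (numBins n Ry : ℝ)) := by
    intro ω' hω'
    have hne : ω' ≠ ω := (Finset.mem_filter.1 hω').2.1
    have hxy0 := mul_nonneg hx0 hy0
    by_cases h1 : ω'.1 = ω.1
    · have h2 : ω'.2 ≠ ω.2 := fun h2 => hne (Prod.ext h1 h2)
      rw [h1, collProb_self hMx, collProb_of_ne hMy h2.symm, if_neg h2, if_pos rfl]
      linarith
    · by_cases h2 : ω'.2 = ω.2
      · rw [h2, collProb_self hMy, collProb_of_ne hMx (Ne.symm h1), if_pos rfl, if_neg h1]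
        linarith
      · rw [collProb_of_ne hMx (Ne.symm h1), collProb_of_ne hMy (Ne.symm h2), if_neg h1, if_neg h2]
        linarith
  have hcancel : ∀ R : ℝ, (2 : ℝ) ^ ((n : ℝ) * R) * (2 : ℝ) ^ (-((n : ℝ) * R)) = 1 := fun R => by
    rw [← Real.rpow_add two_pos, add_neg_cancel, Real.rpow_zero]
  set L : ℝ := ((n : ℝ) + 1) ^ polyDeg X Y * (2 : ℝ) ^ t with hL
  have hbound : ∀ (c r R : ℝ) (N : ℕ), 0 ≤ r →
      (N : ℝ) ≤ ((n : ℝ) + 1) ^ polyDeg X Y * ((2 : ℝ) ^ t * (2 : ℝ) ^ ((n : ℝ) * R)) →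
      r ≤ c * (2 : ℝ) ^ (-((n : ℝ) * R)) → N * r ≤ c * L := by
    intro c r R N hr hN hrc
    calc N * r ≤ (((n : ℝ) + 1) ^ polyDeg X Y * ((2 : ℝ) ^ t * (2 : ℝ) ^ ((n : ℝ) * R))) *
          (c * (2 : ℝ) ^ (-((n : ℝ) * R))) := mul_le_mul hN hrc hr (by positivity)
      _ = c * L * ((2 : ℝ) ^ ((n : ℝ) * R) * (2 : ℝ) ^ (-((n : ℝ) * R))) := by
          rw [hL]
          ring
      _ = c * L := by rw [hcancel, mul_one]
  have hbx := hbound 2 _ Rx Sv.card hx0 hv hcx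
  have hby := hbound 2 _ Ry Sw.card hy0 hw hcy
  have hbxy := hbound 4 _ (Rx + Ry) A.card (mul_nonneg hx0 hy0) hu (by
    refine (mul_le_mul hcx hcy hy0 (hx0.trans hcx)).trans (le_of_eq ?_)
    have : (2 : ℝ) ^ (-((n : ℝ) * (Rx + Ry))) =
        (2 : ℝ) ^ (-((n : ℝ) * Rx)) * (2 : ℝ) ^ (-((n : ℝ) * Ry)) := by
      rw [← Real.rpow_add two_pos]
      congr 1
      ring
    rw [this]
    ring)
  calc pairErr dec ω ≤ ∑ ω' ∈ A, collProb (numBins n Rx) ω.1 ω'.1 *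
        collProb (numBins n Ry) ω.2 ω'.2 := pairErr_le_sum dec hdec ω
    _ ≤ ∑ ω' ∈ A, ((if ω'.2 = ω.2 then 1 / (numBins n Rx : ℝ) else 0) +
      (if ω'.1 = ω.1 then 1 / (numBins n Ry : ℝ) else 0) +
      1 / (numBins n Rx : ℝ) * (1 / (numBins n Ry : ℝ))) := Finset.sum_le_sum hterm
    _ = Sv.card * (1 / (numBins n Rx : ℝ)) + Sw.card * (1 / (numBins n Ry : ℝ)) +
        A.card * (1 / (numBins n Rx : ℝ) * (1 / (numBins n Ry : ℝ))) := by
        rw [Finset.sum_add_distrib, Finset.sum_add_distrib, ← Finset.sum_filter,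
          ← Finset.sum_filter, Finset.sum_const, Finset.sum_const, Finset.sum_const, nsmul_eq_mul,
          nsmul_eq_mul, nsmul_eq_mul]
    _ ≤ 8 * L := by linarith
    _ = _ := by
        rw [hL]
        ring

lemma min_one_two_rpow_le {z ρ : ℝ} (h0 : 0 ≤ ρ) (h1 : ρ ≤ 1) :
    min 1 ((2 : ℝ) ^ z) ≤ (2 : ℝ) ^ (ρ * z) := by
  rcases le_total z 0 with hz | hz
  · refine (min_le_right _ _).trans (Real.rpow_le_rpow_of_exponent_le one_le_two ?_)
    nlinarith
  · exact (min_le_left _ _).trans (Real.one_le_rpow one_le_two (mul_nonneg h0 hz))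

/-- Non-asymptotic upper bound on the error probability of the universal decoder. -/
lemma errorProb_universal_le {P : X × Y → ℝ} (hP : P ∈ stdSimplex ℝ (X × Y)) {n : ℕ}
    (d : Fin (n + 1)) {Rx Ry : ℝ} (hRx : 0 ≤ Rx) (hRy : 0 ≤ Ry)
    {dec : Decoder X Y n (numBins n Rx) (numBins n Ry)}
    (hdec : IsMetricDecoder (qMetric Rx Ry) dec) {ρ₁ ρ₂ ρ₃ : ℝ} (h₁ : ρ₁ ∈ Set.Icc (0 : ℝ) 1)
    (h₂ : ρ₂ ∈ Set.Icc (0 : ℝ) 1) (h₃ : ρ₃ ∈ Set.Icc (0 : ℝ) 1) :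
    errorProb P d dec ≤ 8 * ((n : ℝ) + 1) ^ polyDeg X Y *
      ((2 : ℝ) ^ (blockMean d (gallagerFn id (margSnd P) ρ₁) (gallagerFn Prod.snd P ρ₁)
          (gallagerFn (fun _ => ()) (margFst P) ρ₁) - ρ₁ * (n * Rx)) +
        (2 : ℝ) ^ (blockMean d (gallagerFn (fun _ => ()) (margSnd P) ρ₂) (gallagerFn Prod.fst P ρ₂)
          (gallagerFn id (margFst P) ρ₂) - ρ₂ * (n * Ry)) +
        (2 : ℝ) ^ (blockMean d (gallagerFn (fun _ => ()) (margSnd P) ρ₃)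
          (gallagerFn (fun _ => ()) P ρ₃) (gallagerFn (fun _ => ()) (margFst P) ρ₃) -
          ρ₃ * (n * (Rx + Ry)))) := by
  have hMx := numBins_pos n hRx
  have hMy := numBins_pos n hRy
  have hX := margFst_mem hP
  have hY := margSnd_mem hP
  set A : ℝ := 8 * ((n : ℝ) + 1) ^ polyDeg X Y with hA
  have hA1 : 1 ≤ A := by
    have : (1 : ℝ) ≤ ((n : ℝ) + 1) ^ polyDeg X Y :=
      one_le_pow₀ (by linarith [Nat.cast_nonneg (α := ℝ) n])
    linarith
  have hterm : ∀ ω : (Fin n → X) × (Fin n → Y), pairErr dec ω ≤ A *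
      ((2 : ℝ) ^ (ρ₁ * (segMetric id Prod.snd (fun _ => ()) d ω - n * Rx)) +
        (2 : ℝ) ^ (ρ₂ * (segMetric (fun _ => ()) Prod.fst id d ω - n * Ry)) +
        (2 : ℝ) ^ (ρ₃ * (segMetric (fun _ => ()) (fun _ => ()) (fun _ => ()) d ω -
          n * (Rx + Ry)))) := by
    intro ω
    have hp : ∀ z : ℝ, 0 < (2 : ℝ) ^ z := fun z => Real.rpow_pos_of_pos two_pos z
    have hq : qMetric Rx Ry ω.1 ω.2 ≤ qMetricAt Rx Ry d ω.1 ω.2 :=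
      Finset.inf'_le _ (Finset.mem_univ d)
    have h : pairErr dec ω ≤ A * min 1 ((2 : ℝ) ^ qMetricAt Rx Ry d ω.1 ω.2) := by
      rw [mul_min_of_nonneg _ _ (by linarith)]
      refine le_min ?_ ?_
      · rw [mul_one]
        exact (pairErr_le_one dec hMx hMy ω).trans hA1
      · refine (pairErr_le_qMetric hRx hRy hdec ω).trans ?_
        exact mul_le_mul_of_nonneg_left (Real.rpow_le_rpow_of_exponent_le one_le_two hq)
          (by linarith)
    refine h.trans (mul_le_mul_of_nonneg_left ?_ (by linarith))
    unfold qMetricAt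
    rw [uMetric_eq_segMetric, vMetric_eq_segMetric, wMetric_eq_segMetric]
    rcases max_choice (segMetric (fun _ => ()) (fun _ => ()) (fun _ => ()) d ω - n * (Rx + Ry))
      (max (segMetric id Prod.snd (fun _ => ()) d ω - n * Rx)
        (segMetric (fun _ => ()) Prod.fst id d ω - n * Ry)) with e | e
    · rw [e]
      refine (min_one_two_rpow_le h₃.1 h₃.2).trans ?_
      exact le_add_of_nonneg_left (add_pos (hp _) (hp _)).le
    · rw [e]
      rcases max_choice (segMetric id Prod.snd (fun _ => ()) d ω - n * Rx)
        (segMetric (fun _ => ()) Prod.fst id d ω - n * Ry) with e' | e'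
      · rw [e']
        refine (min_one_two_rpow_le h₁.1 h₁.2).trans ?_
        rw [add_assoc]
        exact le_add_of_nonneg_right (add_pos (hp _) (hp _)).le
      · rw [e']
        refine (min_one_two_rpow_le h₂.1 h₂.2).trans ?_
        rw [add_right_comm]
        exact le_add_of_nonneg_left (add_pos (hp _) (hp _)).le
  have hP0 : ∀ ω : (Fin n → X) × (Fin n → Y), 0 ≤ blockProb P d ω.1 ω.2 := fun ω =>
    blockProd_nonneg hY.1 hP.1 hX.1 d ω
  have hmom : ∀ (ρ r : ℝ) (D : (Fin n → X) × (Fin n → Y) → ℝ) (Γ : ℝ),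
      ∑ ω, blockProd (margSnd P) P (margFst P) d ω * (2 : ℝ) ^ (ρ * D ω) ≤ (2 : ℝ) ^ Γ →
      ∑ ω : (Fin n → X) × (Fin n → Y), blockProb P d ω.1 ω.2 * (2 : ℝ) ^ (ρ * (D ω - r)) ≤
        (2 : ℝ) ^ (Γ - ρ * r) := by
    intro ρ r D Γ h
    have : ∀ ω : (Fin n → X) × (Fin n → Y), blockProb P d ω.1 ω.2 * (2 : ℝ) ^ (ρ * (D ω - r)) =
        blockProd (margSnd P) P (margFst P) d ω * (2 : ℝ) ^ (ρ * D ω) * (2 : ℝ) ^ (-(ρ * r)) := by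
      intro ω
      rw [blockProb_eq_blockProd, mul_assoc, ← Real.rpow_add two_pos]
      congr 2
      ring
    rw [Finset.sum_congr rfl fun ω _ => this ω, ← Finset.sum_mul, sub_eq_add_neg,
      Real.rpow_add two_pos]
    exact mul_le_mul_of_nonneg_right h (Real.rpow_pos_of_pos two_pos _).le
  rw [errorProb_eq_sum_pairErr]
  calc _ ≤ ∑ ω : (Fin n → X) × (Fin n → Y), blockProb P d ω.1 ω.2 * (A *
      ((2 : ℝ) ^ (ρ₁ * (segMetric id Prod.snd (fun _ => ()) d ω - n * Rx)) +
        (2 : ℝ) ^ (ρ₂ * (segMetric (fun _ => ()) Prod.fst id d ω - n * Ry)) +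
        (2 : ℝ) ^ (ρ₃ * (segMetric (fun _ => ()) (fun _ => ()) (fun _ => ()) d ω -
          n * (Rx + Ry))))) :=
        Finset.sum_le_sum fun ω _ => mul_le_mul_of_nonneg_left (hterm ω) (hP0 ω)
    _ = A * (∑ ω : (Fin n → X) × (Fin n → Y), blockProb P d ω.1 ω.2 *
          (2 : ℝ) ^ (ρ₁ * (segMetric id Prod.snd (fun _ => ()) d ω - n * Rx)) +
        ∑ ω : (Fin n → X) × (Fin n → Y), blockProb P d ω.1 ω.2 *
          (2 : ℝ) ^ (ρ₂ * (segMetric (fun _ => ()) Prod.fst id d ω - n * Ry)) +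
        ∑ ω : (Fin n → X) × (Fin n → Y), blockProb P d ω.1 ω.2 *
          (2 : ℝ) ^ (ρ₃ * (segMetric (fun _ => ()) (fun _ => ()) (fun _ => ()) d ω -
          n * (Rx + Ry)))) := by
        rw [← Finset.sum_add_distrib, ← Finset.sum_add_distrib, Finset.mul_sum]
        exact Finset.sum_congr rfl fun ω _ => by ring
    _ ≤ _ := by
        refine mul_le_mul_of_nonneg_left (add_le_add (add_le_add ?_ ?_) ?_) (by linarith)
        · exact hmom _ _ _ _ (sum_blockProd_mul_two_rpow_segMetric_le id Prod.snd (fun _ => ())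
            hY hP hX h₁.1 d)
        · exact hmom _ _ _ _ (sum_blockProd_mul_two_rpow_segMetric_le (fun _ => ()) Prod.fst id
            hY hP hX h₂.1 d)
        · exact hmom _ _ _ _ (sum_blockProd_mul_two_rpow_segMetric_le (fun _ => ()) (fun _ => ())
            (fun _ => ()) hY hP hX h₃.1 d)

end Universal

/-! ### Lower bounds for every decoder at a fixed block length -/

section LowerFinite

variable {α β : Type*} [Fintype α] [DecidableEq α] [Fintype β] [DecidableEq β] {Mx My : ℕ}

/-- Arithmetic of the second-moment bound, for `N` points in `M` bins and the expected number `s`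
of errors among them. -/
lemma mul_min_le_of_collisions {N M s : ℝ} (hN : 2 ≤ N) (hM : 0 < M)
    (h : N * (N - 1) / M ≤ 2 * (3 * N / M + 6) * s) : N * min 1 (N / M) / 36 ≤ s := by
  have h1 : N * (N - 1) ≤ 2 * (3 * N + 6 * M) * s := by
    have := mul_le_mul_of_nonneg_right h hM.le
    rw [div_mul_cancel₀ _ hM.ne'] at this
    refine this.trans (le_of_eq ?_)
    field_simp
  have h2 : N * N / 2 ≤ 2 * (3 * N + 6 * M) * s := by nlinarith
  have hs : 0 ≤ s := by
    by_contra hs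
    have : 2 * (3 * N + 6 * M) * s < 0 := mul_neg_of_pos_of_neg (by positivity) (not_le.1 hs)
    nlinarith
  rcases le_total N M with hNM | hNM
  · rw [min_eq_right (div_le_one_of_le₀ hNM hM.le), mul_div_assoc', div_div, div_le_iff₀ (by positivity)]
    nlinarith
  · rw [min_eq_left ((one_le_div hM).2 hNM), mul_one, div_le_iff₀ (by norm_num)]
    have : N * (N / 2) ≤ N * (18 * s) := by nlinarith
    have := le_of_mul_le_mul_left this (by linarith)
    linarith

variable (dec : (α → Fin Mx) → (β → Fin My) → Fin Mx → Fin My → α × β)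

/-- Points of `T` that share the second coordinate: any decoder errs on a fraction of order
`min(1, |T| / Mx)` of them. -/
lemma mul_min_le_sum_pairErr_fst (hMx : 0 < Mx) (hMy : 0 < My) (T : Finset (α × β)) (y : β)
    (hT : ∀ t ∈ T, t.2 = y) (hN : 2 ≤ T.card) :
    (T.card : ℝ) * min 1 ((T.card : ℝ) / Mx) / 36 ≤ ∑ t ∈ T, pairErr dec t := by
  have hMx' : (0 : ℝ) < Mx := by exact_mod_cast hMx
  have hMy' : (1 : ℝ) ≤ My := by exact_mod_cast hMy
  have hN' : (2 : ℝ) ≤ T.card := by exact_mod_cast hN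
  have h := sum_collProb_le_mul_sum_pairErr dec hMx hMy T (a := T.card) (b := 1)
    (fun _ => by exact_mod_cast Finset.card_le_card (Finset.filter_subset _ _))
    (fun x => by
      have : (T.filter fun t => t.1 = x).card ≤ 1 := Finset.card_le_one.2 fun t ht t' ht' => by
        rw [Finset.mem_filter] at ht ht'
        exact Prod.ext (ht.2.trans ht'.2.symm) ((hT t ht.1).trans (hT t' ht'.1).symm)
      exact_mod_cast this)
  have hS : ∑ t ∈ T, ∑ t' ∈ T.erase t, collProb Mx t.1 t'.1 * collProb My t.2 t'.2 =
      T.card * (T.card - 1) / Mx := by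
    have : ∀ t ∈ T, ∑ t' ∈ T.erase t, collProb Mx t.1 t'.1 * collProb My t.2 t'.2 =
        ((T.card : ℝ) - 1) / Mx := by
      intro t ht
      rw [Finset.sum_congr rfl (g := fun _ => 1 / (Mx : ℝ)), Finset.sum_const, nsmul_eq_mul,
        Finset.card_erase_of_mem ht, Nat.cast_sub (by omega)]
      · push_cast
        ring
      · intro t' ht'
        have h2 := (hT t ht).trans (hT t' (Finset.mem_of_mem_erase ht')).symm
        have h1 : t.1 ≠ t'.1 := fun h1 => Finset.ne_of_mem_erase ht' (Prod.ext h1.symm h2.symm)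
        rw [h2, collProb_self hMy, collProb_of_ne hMx h1, mul_one]
    rw [Finset.sum_congr rfl this, Finset.sum_const, nsmul_eq_mul]
    ring
  rw [hS] at h
  refine mul_min_le_of_collisions hN' hMx' (h.trans ?_)
  refine mul_le_mul_of_nonneg_right ?_ (Finset.sum_nonneg fun t _ => pairErr_nonneg dec t)
  have e1 : (T.card : ℝ) / (Mx * My) ≤ T.card / Mx := by
    gcongr
    exact le_mul_of_one_le_right hMx'.le hMy'
  have e2 : 2 * (1 : ℝ) / My ≤ 2 := by
    rw [mul_one]
    exact div_le_self zero_le_two hMy'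
  have e3 : 3 * (T.card : ℝ) / Mx = T.card / Mx + 2 * T.card / Mx := by ring
  linarith

lemma mul_min_le_sum_pairErr_snd (hMx : 0 < Mx) (hMy : 0 < My) (T : Finset (α × β)) (x : α)
    (hT : ∀ t ∈ T, t.1 = x) (hN : 2 ≤ T.card) :
    (T.card : ℝ) * min 1 ((T.card : ℝ) / My) / 36 ≤ ∑ t ∈ T, pairErr dec t := by
  have hMx' : (1 : ℝ) ≤ Mx := by exact_mod_cast hMx
  have hMy' : (0 : ℝ) < My := by exact_mod_cast hMy
  have hN' : (2 : ℝ) ≤ T.card := by exact_mod_cast hN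
  have h := sum_collProb_le_mul_sum_pairErr dec hMx hMy T (a := 1) (b := T.card)
    (fun y => by
      have : (T.filter fun t => t.2 = y).card ≤ 1 := Finset.card_le_one.2 fun t ht t' ht' => by
        rw [Finset.mem_filter] at ht ht'
        exact Prod.ext ((hT t ht.1).trans (hT t' ht'.1).symm) (ht.2.trans ht'.2.symm)
      exact_mod_cast this)
    (fun _ => by exact_mod_cast Finset.card_le_card (Finset.filter_subset _ _))
  have hS : ∑ t ∈ T, ∑ t' ∈ T.erase t, collProb Mx t.1 t'.1 * collProb My t.2 t'.2 =
      T.card * (T.card - 1) / My := by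
    have : ∀ t ∈ T, ∑ t' ∈ T.erase t, collProb Mx t.1 t'.1 * collProb My t.2 t'.2 =
        ((T.card : ℝ) - 1) / My := by
      intro t ht
      rw [Finset.sum_congr rfl (g := fun _ => 1 / (My : ℝ)), Finset.sum_const, nsmul_eq_mul,
        Finset.card_erase_of_mem ht, Nat.cast_sub (by omega)]
      · push_cast
        ring
      · intro t' ht'
        have h2 := (hT t ht).trans (hT t' (Finset.mem_of_mem_erase ht')).symm
        have h1 : t.2 ≠ t'.2 := fun h1 => Finset.ne_of_mem_erase ht' (Prod.ext h2.symm h1.symm)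
        rw [h2, collProb_self hMx, collProb_of_ne hMy h1, one_mul]
    rw [Finset.sum_congr rfl this, Finset.sum_const, nsmul_eq_mul]
    ring
  rw [hS] at h
  refine mul_min_le_of_collisions hN' hMy' (h.trans ?_)
  refine mul_le_mul_of_nonneg_right ?_ (Finset.sum_nonneg fun t _ => pairErr_nonneg dec t)
  have e1 : (T.card : ℝ) / (Mx * My) ≤ T.card / My := by
    gcongr
    exact le_mul_of_one_le_left hMy'.le hMx'
  have e2 : 2 * (1 : ℝ) / Mx ≤ 2 := by
    rw [mul_one]
    exact div_le_self zero_le_two hMx'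
  have e3 : 3 * (T.card : ℝ) / My = T.card / My + 2 * T.card / My := by ring
  linarith

/-- Errors with both blocks wrong: `c` bounds the expected number of competitors that share one
of the two blocks. -/
lemma mul_min_le_sum_pairErr (hMx : 0 < Mx) (hMy : 0 < My) (T : Finset (α × β)) {a b c : ℝ}
    (hN : 2 ≤ T.card) (ha : ∀ y, ((T.filter fun t => t.2 = y).card : ℝ) ≤ a)
    (hb : ∀ x, ((T.filter fun t => t.1 = x).card : ℝ) ≤ b) (hc : 2 ≤ c) (hac : a / Mx ≤ c)
    (hbc : b / My ≤ c) :
    (T.card : ℝ) * min 1 ((T.card : ℝ) / (Mx * My)) / (36 * c) ≤ ∑ t ∈ T, pairErr dec t := by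
  have hMx' : (0 : ℝ) < Mx := by exact_mod_cast hMx
  have hMy' : (0 : ℝ) < My := by exact_mod_cast hMy
  have hN' : (2 : ℝ) ≤ T.card := by exact_mod_cast hN
  have hM : (0 : ℝ) < Mx * My := by positivity
  have h := sum_collProb_le_mul_sum_pairErr dec hMx hMy T ha hb
  have hS : (T.card : ℝ) * (T.card - 1) / (Mx * My) ≤
      ∑ t ∈ T, ∑ t' ∈ T.erase t, collProb Mx t.1 t'.1 * collProb My t.2 t'.2 := by
    calc (T.card : ℝ) * (T.card - 1) / (Mx * My) =
        ∑ t ∈ T, ∑ t' ∈ T.erase t, (1 / (Mx : ℝ)) * (1 / (My : ℝ)) := by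
          rw [Finset.sum_congr rfl (g := fun _ => ((T.card : ℝ) - 1) / (Mx * My)),
            Finset.sum_const, nsmul_eq_mul]
          · ring
          · intro t ht
            rw [Finset.sum_const, nsmul_eq_mul, Finset.card_erase_of_mem ht,
              Nat.cast_sub (by omega)]
            push_cast
            field_simp
      _ ≤ _ := by
          refine Finset.sum_le_sum fun t _ => Finset.sum_le_sum fun t' _ => ?_
          exact mul_le_mul (one_div_le_collProb hMx _ _) (one_div_le_collProb hMy _ _)
            (by positivity) (collProb_nonneg _ _)
  have hE : 0 ≤ ∑ t ∈ T, pairErr dec t := Finset.sum_nonneg fun t _ => pairErr_nonneg dec t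
  rw [mul_comm (36 : ℝ) c, ← div_div, div_right_comm, div_le_iff₀ (by linarith)]
  refine mul_min_le_of_collisions hN' hM (hS.trans (h.trans ?_))
  have e1 : (T.card : ℝ) / (Mx * My) + 2 * a / Mx + 2 * b / My + 4 ≤
      (3 * T.card / (Mx * My) + 6) * c := by
    have f1 : 2 * a / Mx ≤ 2 * c := by
      rw [mul_div_assoc]
      linarith
    have f2 : 2 * b / My ≤ 2 * c := by
      rw [mul_div_assoc]
      linarith
    have f3 : (T.card : ℝ) / (Mx * My) ≤ 3 * T.card / (Mx * My) * c := by
      have : (0 : ℝ) ≤ T.card / (Mx * My) := by positivity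
      rw [mul_div_assoc]
      nlinarith
    linarith
  calc _ ≤ 2 * ((3 * T.card / (Mx * My) + 6) * c) * ∑ t ∈ T, pairErr dec t :=
        mul_le_mul_of_nonneg_right (by linarith) hE
    _ = _ := by ring

end LowerFinite

/-- Lower bound obtained fibre by fibre. Under a law `Q`, the set `T` has substantial mass, its
points have probability at most `qM`, and conditionally on the fibre at most `r`; so typical
fibres of `T` have at least `1/(4r)` points, and such fibres hold at least `1/(4qM)` points. -/
lemma fiberwise_lower_bound {Ω K : Type*} [Fintype Ω] [Fintype K] [DecidableEq K] (κ : Ω → K)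
    (T : Finset Ω) {Q e : Ω → ℝ} {qM r M : ℝ} (hQ : ∀ ω, 0 ≤ Q ω) (hQ1 : ∑ ω, Q ω ≤ 1)
    (he : ∀ ω, 0 ≤ e ω) (hqM : 0 < qM) (hr : 0 < r) (hM : 0 < M) (hr2 : 2 ≤ 1 / (4 * r))
    (hT : 1 / 2 ≤ ∑ ω ∈ T, Q ω) (hTq : ∀ ω ∈ T, Q ω ≤ qM)
    (hTr : ∀ ω ∈ T, Q ω ≤ (∑ ω' with κ ω' = κ ω, Q ω') * r)
    (hfib : ∀ k, 2 ≤ (T.filter fun ω => κ ω = k).card →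
      ((T.filter fun ω => κ ω = k).card : ℝ) *
        min 1 (((T.filter fun ω => κ ω = k).card : ℝ) / M) / 36 ≤
        ∑ ω ∈ T with κ ω = k, e ω) :
    1 / (4 * qM) * (min 1 (1 / (4 * r) / M) / 36) ≤ ∑ ω ∈ T, e ω := by
  classical
  let N : K → ℝ := fun k => ((T.filter fun ω => κ ω = k).card : ℝ)
  let Qk : K → ℝ := fun k => ∑ ω with κ ω = k, Q ω
  have hQk : ∀ k, 0 ≤ Qk k := fun k => Finset.sum_nonneg fun ω _ => hQ ω
  have hQk1 : ∑ k, Qk k ≤ 1 := (Finset.sum_fiberwise Finset.univ κ Q).trans_le hQ1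
  let G : K → Prop := fun k => 1 / (4 * r) ≤ N k
  set m : ℝ := min 1 (1 / (4 * r) / M) with hm
  have hm0 : 0 ≤ m := le_min zero_le_one (by positivity)
  have hbad : ∀ k, (∑ ω ∈ T with κ ω = k, Q ω) ≤ (if G k then N k * qM else 0) + Qk k / 4 := by
    intro k
    split_ifs with hk
    · calc _ ≤ ∑ ω ∈ T with κ ω = k, qM :=
            Finset.sum_le_sum fun ω hω => hTq ω (Finset.mem_filter.1 hω).1
        _ = N k * qM := by rw [Finset.sum_const, nsmul_eq_mul]
        _ ≤ _ := le_add_of_nonneg_right (by linarith [hQk k])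
    · have hk' : N k ≤ 1 / (4 * r) := (not_le.1 hk).le
      calc _ ≤ ∑ ω ∈ T with κ ω = k, Qk k * r := Finset.sum_le_sum fun ω hω => by
            have h := hTr ω (Finset.mem_filter.1 hω).1
            rw [(Finset.mem_filter.1 hω).2] at h
            exact h
        _ = N k * (Qk k * r) := by rw [Finset.sum_const, nsmul_eq_mul]
        _ ≤ 1 / (4 * r) * (Qk k * r) :=
            mul_le_mul_of_nonneg_right hk' (mul_nonneg (hQk k) hr.le)
        _ = 0 + Qk k / 4 := by
            field_simp
            ring
  have h1 : 1 / 4 ≤ (∑ k, if G k then N k else 0) * qM := by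
    have h := Finset.sum_le_sum fun k (_ : k ∈ Finset.univ) => hbad k
    rw [Finset.sum_fiberwise, Finset.sum_add_distrib, ← Finset.sum_div] at h
    rw [Finset.sum_mul]
    simp only [ite_mul, zero_mul]
    linarith
  have h2 : (∑ k, if G k then N k else 0) * (m / 36) ≤ ∑ ω ∈ T, e ω := by
    rw [← Finset.sum_fiberwise T κ e, Finset.sum_mul]
    refine Finset.sum_le_sum fun k _ => ?_
    split_ifs with hk
    · have hk2 : 2 ≤ (T.filter fun ω => κ ω = k).card := by
        have : (2 : ℝ) ≤ N k := hr2.trans hk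
        simp only [N] at this
        exact_mod_cast this
      refine le_trans ?_ (hfib k hk2)
      rw [mul_div_assoc]
      refine mul_le_mul_of_nonneg_left ?_ (Nat.cast_nonneg _)
      refine div_le_div_of_nonneg_right (min_le_min_left 1 ?_) (by norm_num)
      exact div_le_div_of_nonneg_right hk hM.le
    · rw [zero_mul]
      exact Finset.sum_nonneg fun ω _ => he ω
  refine le_trans (mul_le_mul_of_nonneg_right ?_ (by positivity)) h2
  rw [div_le_iff₀ (by positivity)]
  linarith

/-- Lower bound from redrawing a single letter, where `Φ c` sets that letter to `c`: if the errors
after setting it to `a` and to `b` always sum to at least `s`, then the average error is at least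
`s` times the smaller of the probabilities of `a` and `b`. -/
lemma letter_swap_lower_bound {Ω A : Type*} [Fintype Ω] [Fintype A] (Φ : A → Ω → Ω)
    (hΦ : ∀ F : Ω → ℝ, ∑ ω, ∑ c, F (Φ c ω) = Fintype.card A * ∑ ω, F ω) {P R e : Ω → ℝ} {w : A → ℝ}
    (hP : ∑ ω, P ω = 1) (hR : ∀ ω, 0 ≤ R ω) (he : ∀ ω, 0 ≤ e ω) (hw : w ∈ stdSimplex ℝ A)
    (hPR : ∀ c ω, P (Φ c ω) = R ω * w c) {a b : A} (hab : a ≠ b) {m s : ℝ} (hm : 0 ≤ m)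
    (ha : m ≤ w a) (hb : m ≤ w b) (hs : ∀ ω, s ≤ e (Φ a ω) + e (Φ b ω)) :
    m * s ≤ ∑ ω, P ω * e ω := by
  classical
  have hA : (0 : ℝ) < Fintype.card A := by exact_mod_cast Fintype.card_pos_iff.2 ⟨a⟩
  have h1 : ∑ ω, R ω = Fintype.card A := by
    have h := hΦ P
    simp only [hPR, ← Finset.mul_sum, hw.2, mul_one, hP] at h
    exact h
  have h2 : ∀ ω, m * s * R ω ≤ ∑ c, P (Φ c ω) * e (Φ c ω) := by
    intro ω
    calc m * s * R ω ≤ m * (e (Φ a ω) + e (Φ b ω)) * R ω :=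
          mul_le_mul_of_nonneg_right (mul_le_mul_of_nonneg_left (hs ω) hm) (hR ω)
      _ = R ω * m * e (Φ a ω) + R ω * m * e (Φ b ω) := by ring
      _ ≤ R ω * w a * e (Φ a ω) + R ω * w b * e (Φ b ω) := by
          refine add_le_add ?_ ?_
          · exact mul_le_mul_of_nonneg_right (mul_le_mul_of_nonneg_left ha (hR ω)) (he _)
          · exact mul_le_mul_of_nonneg_right (mul_le_mul_of_nonneg_left hb (hR ω)) (he _)
      _ = ∑ c ∈ {a, b}, P (Φ c ω) * e (Φ c ω) := by
          rw [Finset.sum_pair hab, hPR, hPR]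
      _ ≤ _ := Finset.sum_le_sum_of_subset_of_nonneg (Finset.subset_univ _) fun c _ _ => by
          rw [hPR]
          exact mul_nonneg (mul_nonneg (hR ω) (hw.1 c)) (he _)
  have h3 := Finset.sum_le_sum fun ω (_ : ω ∈ Finset.univ) => h2 ω
  rw [hΦ fun ω => P ω * e ω, ← Finset.mul_sum, h1, mul_comm] at h3
  exact le_of_mul_le_mul_left h3 hA

/-! ### Typical pairs of blocks -/

section Typical

variable {X Y : Type*} [Fintype X] [Fintype Y] [DecidableEq X] [DecidableEq Y]
variable {B₁ B₂ B₃ : Type*} [Fintype B₁] [DecidableEq B₁] [Fintype B₂] [DecidableEq B₂]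
  [Fintype B₃] [DecidableEq B₃]

/-- Ideal conditional code length, in bits, of a letter given its image under `π`. -/
def condScore {Z B : Type*} [Fintype Z] [DecidableEq B] (π : Z → B) (q : Z → ℝ) (z : Z) : ℝ :=
  -Real.logb 2 (q z / fibSum π q (π z))

lemma sum_mul_condScore {Z B : Type*} [Fintype Z] [DecidableEq B] (π : Z → B) (q : Z → ℝ) :
    ∑ z, q z * condScore π q z = condEnt π q := by
  simp [condScore, condEnt]

/-- Under the law with letter weights `a`, `b`, `c`, the probability of a pair of blocks is that
of its fibre times `2` to the minus conditional code length. -/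
lemma InSupport.blockProd_eq_fiber_mul (π₁ : Y → B₁) (π₂ : X × Y → B₂) (π₃ : X → B₃) {a : Y → ℝ}
    {b : X × Y → ℝ} {c : X → ℝ} (ha : ∀ z, 0 ≤ a z) (hb : ∀ z, 0 ≤ b z) (hc : ∀ z, 0 ≤ c z)
    {n : ℕ} {d : Fin (n + 1)} {ω : (Fin n → X) × (Fin n → Y)} (h : InSupport a b c d ω) :
    blockProd a b c d ω = (∑ ω' with SameSide π₁ π₂ π₃ d ω ω', blockProd a b c d ω') *
      (2 : ℝ) ^ (-blockSum (condScore π₁ a) (condScore π₂ b) (condScore π₃ c) d ω) := by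
  have h' : InSupport (fun z => a z / fibSum π₁ a (π₁ z)) (fun z => b z / fibSum π₂ b (π₂ z))
      (fun z => c z / fibSum π₃ c (π₃ z)) d ω :=
    h.mono (fun z hz => div_pos hz (fibSum_pos π₁ ha hz))
      (fun z hz => div_pos hz (fibSum_pos π₂ hb hz)) (fun z hz => div_pos hz (fibSum_pos π₃ hc hz))
  have e := blockProd_eq_mul_cond π₁ π₂ π₃ ha hb hc d ω
  rw [h'.blockProd_eq_rpow] at e
  exact e

/-- Change of measure between two product laws. -/
lemma InSupport.blockProd_eq_mul_rpow {a a' : Y → ℝ} {b b' : X × Y → ℝ} {c c' : X → ℝ} {n : ℕ}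
    {d : Fin (n + 1)} {ω : (Fin n → X) × (Fin n → Y)} (h : InSupport a b c d ω)
    (h' : InSupport a' b' c' d ω) :
    blockProd a' b' c' d ω = blockProd a b c d ω *
      (2 : ℝ) ^ (-blockSum (fun z => Real.logb 2 (a z / a' z)) (fun z => Real.logb 2 (b z / b' z))
        (fun z => Real.logb 2 (c z / c' z)) d ω) := by
  rw [h.blockProd_eq_rpow, h'.blockProd_eq_rpow, ← Real.rpow_add two_pos]
  congr 1
  have key : ∀ {ι : Type} [Fintype ι] (f g : ι → ℝ), (∀ i, 0 < f i) → (∀ i, 0 < g i) →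
      ∑ i, Real.logb 2 (f i / g i) = ∑ i, Real.logb 2 (f i) - ∑ i, Real.logb 2 (g i) := by
    intro ι _ f g hf hg
    rw [← Finset.sum_sub_distrib]
    exact Finset.sum_congr rfl fun i _ => Real.logb_div (hf i).ne' (hg i).ne'
  unfold blockSum
  rw [key _ _ h.1 h'.1, key _ _ h.2.1 h'.2.1, key _ _ h.2.2 h'.2.2]
  simp only [Finset.sum_neg_distrib]
  ring

/-- For long blocks, sets of typical pairs for a product law have probability at least `1/2`,
uniformly in the delay: the probability, two conditional probabilities and the likelihood ratio to
another product law are all within a factor `2^{± n ε}` of their nominal values. -/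
lemma exists_typical (π₁ : Y → B₁) (π₂ : X × Y → B₂) (π₃ : X → B₃) {B₁' B₂' B₃' : Type*}
    [Fintype B₁'] [DecidableEq B₁'] [Fintype B₂'] [DecidableEq B₂'] [Fintype B₃'] [DecidableEq B₃']
    (π₁' : Y → B₁') (π₂' : X × Y → B₂') (π₃' : X → B₃') {p₁ q₁ : Y → ℝ} {p₂ q₂ : X × Y → ℝ}
    {p₃ q₃ : X → ℝ} (hq₁ : q₁ ∈ stdSimplex ℝ Y) (hq₂ : q₂ ∈ stdSimplex ℝ (X × Y))
    (hq₃ : q₃ ∈ stdSimplex ℝ X) (h₁ : ∀ z, 0 < q₁ z → 0 < p₁ z) (h₂ : ∀ z, 0 < q₂ z → 0 < p₂ z)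
    (h₃ : ∀ z, 0 < q₃ z → 0 < p₃ z) {ε : ℝ} (hε : 0 < ε) :
    ∀ᶠ n : ℕ in atTop, ∀ d : Fin (n + 1), ∃ T : Finset ((Fin n → X) × (Fin n → Y)),
      1 / 2 ≤ ∑ ω ∈ T, blockProd q₁ q₂ q₃ d ω ∧ ∀ ω ∈ T,
        0 < blockProd q₁ q₂ q₃ d ω ∧
        (2 : ℝ) ^ (-(blockMean d (condEnt (fun _ => ()) q₁) (condEnt (fun _ => ()) q₂)
          (condEnt (fun _ => ()) q₃) + n * ε)) ≤ blockProd q₁ q₂ q₃ d ω ∧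
        blockProd q₁ q₂ q₃ d ω ≤ (2 : ℝ) ^ (-(blockMean d (condEnt (fun _ => ()) q₁)
          (condEnt (fun _ => ()) q₂) (condEnt (fun _ => ()) q₃) - n * ε)) ∧
        (∑ ω' with SameSide π₁ π₂ π₃ d ω ω', blockProd q₁ q₂ q₃ d ω') *
          (2 : ℝ) ^ (-(blockMean d (condEnt π₁ q₁) (condEnt π₂ q₂) (condEnt π₃ q₃) + n * ε)) ≤
            blockProd q₁ q₂ q₃ d ω ∧
        blockProd q₁ q₂ q₃ d ω ≤ (∑ ω' with SameSide π₁ π₂ π₃ d ω ω', blockProd q₁ q₂ q₃ d ω') *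
          (2 : ℝ) ^ (-(blockMean d (condEnt π₁ q₁) (condEnt π₂ q₂) (condEnt π₃ q₃) - n * ε)) ∧
        (∑ ω' with SameSide π₁' π₂' π₃' d ω ω', blockProd q₁ q₂ q₃ d ω') *
          (2 : ℝ) ^ (-(blockMean d (condEnt π₁' q₁) (condEnt π₂' q₂) (condEnt π₃' q₃) + n * ε)) ≤
            blockProd q₁ q₂ q₃ d ω ∧
        blockProd q₁ q₂ q₃ d ω *
          (2 : ℝ) ^ (-(blockMean d (relEnt q₁ p₁) (relEnt q₂ p₂) (relEnt q₃ p₃) + n * ε)) ≤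
            blockProd p₁ p₂ p₃ d ω := by
  classical
  obtain ⟨K, hK⟩ := exists_sum_blockProd_deviation_le hq₁ hq₂ hq₃ (condScore (fun _ => ()) q₁)
    (condScore (fun _ => ()) q₂) (condScore (fun _ => ()) q₃) hε
  obtain ⟨K', hK'⟩ := exists_sum_blockProd_deviation_le hq₁ hq₂ hq₃ (condScore π₁ q₁)
    (condScore π₂ q₂) (condScore π₃ q₃) hε
  obtain ⟨K'', hK''⟩ := exists_sum_blockProd_deviation_le hq₁ hq₂ hq₃ (condScore π₁' q₁)
    (condScore π₂' q₂) (condScore π₃' q₃) hε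
  obtain ⟨J, hJ⟩ := exists_sum_blockProd_deviation_le hq₁ hq₂ hq₃
    (fun z => Real.logb 2 (q₁ z / p₁ z)) (fun z => Real.logb 2 (q₂ z / p₂ z))
    (fun z => Real.logb 2 (q₃ z / p₃ z)) hε
  simp only [sum_mul_condScore] at hK hK' hK''
  have hlim : Tendsto (fun n : ℕ => (K + K' + K'' + J) / (n : ℝ)) atTop (𝓝 0) :=
    tendsto_const_div_atTop_nhds_zero_nat _
  filter_upwards [hlim.eventually (gt_mem_nhds (by norm_num : (0 : ℝ) < 1 / 2)),
    eventually_gt_atTop 0] with n hn hn0 d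
  have e := hK n d hn0
  have e' := hK' n d hn0
  have e'' := hK'' n d hn0
  have eJ := hJ n d hn0
  have hQ0 := blockProd_nonneg (n := n) hq₁.1 hq₂.1 hq₃.1 d
  have hQ1 := sum_blockProd_eq_one (n := n) hq₁.2 hq₂.2 hq₃.2 d
  set F := Finset.univ.filter fun ω : (Fin n → X) × (Fin n → Y) => n * ε <
    |blockSum (condScore (fun _ => ()) q₁) (condScore (fun _ => ()) q₂)
      (condScore (fun _ => ()) q₃) d ω - blockMean d (condEnt (fun _ => ()) q₁)
      (condEnt (fun _ => ()) q₂) (condEnt (fun _ => ()) q₃)| with hF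
  set F' := Finset.univ.filter fun ω : (Fin n → X) × (Fin n → Y) => n * ε <
    |blockSum (condScore π₁ q₁) (condScore π₂ q₂) (condScore π₃ q₃) d ω -
      blockMean d (condEnt π₁ q₁) (condEnt π₂ q₂) (condEnt π₃ q₃)| with hF'
  set F'' := Finset.univ.filter fun ω : (Fin n → X) × (Fin n → Y) => n * ε <
    |blockSum (condScore π₁' q₁) (condScore π₂' q₂) (condScore π₃' q₃) d ω -
      blockMean d (condEnt π₁' q₁) (condEnt π₂' q₂) (condEnt π₃' q₃)| with hF''
  set FJ := Finset.univ.filter fun ω : (Fin n → X) × (Fin n → Y) => n * ε <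
    |blockSum (fun z => Real.logb 2 (q₁ z / p₁ z)) (fun z => Real.logb 2 (q₂ z / p₂ z))
      (fun z => Real.logb 2 (q₃ z / p₃ z)) d ω -
      blockMean d (relEnt q₁ p₁) (relEnt q₂ p₂) (relEnt q₃ p₃)| with hFJ
  set T := Finset.univ.filter fun ω : (Fin n → X) × (Fin n → Y) =>
    blockProd q₁ q₂ q₃ d ω ≠ 0 ∧ ω ∉ F ∧ ω ∉ F' ∧ ω ∉ F'' ∧ ω ∉ FJ with hT
  refine ⟨T, ?_, fun ω hω => ?_⟩
  · have hcover : ∑ ω, blockProd q₁ q₂ q₃ d ω ≤ ∑ ω ∈ T, blockProd q₁ q₂ q₃ d ω +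
        (∑ ω ∈ F, blockProd q₁ q₂ q₃ d ω + ∑ ω ∈ F', blockProd q₁ q₂ q₃ d ω +
        ∑ ω ∈ F'', blockProd q₁ q₂ q₃ d ω + ∑ ω ∈ FJ, blockProd q₁ q₂ q₃ d ω) := by
      have hind : ∀ S : Finset ((Fin n → X) × (Fin n → Y)), ∑ ω ∈ S, blockProd q₁ q₂ q₃ d ω =
          ∑ ω, if ω ∈ S then blockProd q₁ q₂ q₃ d ω else 0 := fun S => by
        rw [Finset.sum_ite_mem, Finset.univ_inter]
      rw [hind T, hind F, hind F', hind F'', hind FJ, ← Finset.sum_add_distrib,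
        ← Finset.sum_add_distrib, ← Finset.sum_add_distrib, ← Finset.sum_add_distrib]
      refine Finset.sum_le_sum fun ω _ => ?_
      have h0 := hQ0 ω
      by_cases hz : blockProd q₁ q₂ q₃ d ω = 0
      · simp [hz]
      have hTω : ω ∈ T ↔ ω ∉ F ∧ ω ∉ F' ∧ ω ∉ F'' ∧ ω ∉ FJ := by
        rw [hT, Finset.mem_filter]
        simp [hz]
      by_cases a1 : ω ∈ F
      · rw [if_pos a1]
        split_ifs <;> linarith
      by_cases a2 : ω ∈ F'
      · rw [if_pos a2]
        split_ifs <;> linarith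
      by_cases a3 : ω ∈ F''
      · rw [if_pos a3]
        split_ifs <;> linarith
      by_cases a4 : ω ∈ FJ
      · rw [if_pos a4]
        split_ifs <;> linarith
      rw [if_pos (hTω.2 ⟨a1, a2, a3, a4⟩)]
      split_ifs <;> linarith
    have hsplit : (K + K' + K'' + J) / (n : ℝ) = K / n + K' / n + K'' / n + J / n := by ring
    rw [hQ1] at hcover
    have eJ' : ∑ ω ∈ FJ, blockProd q₁ q₂ q₃ d ω ≤ J / n := eJ
    linarith
  · obtain ⟨hne, a1, a2, a3, a4⟩ := (Finset.mem_filter.1 hω).2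
    have hs := inSupport_of_blockProd_ne_zero hq₁.1 hq₂.1 hq₃.1 hne
    have hpos := hs.blockProd_pos
    simp only [hF, hF', hF'', hFJ, Finset.mem_filter, Finset.mem_univ, true_and, not_lt,
      abs_le] at a1 a2 a3 a4
    have hmono : ∀ {s t : ℝ}, s ≤ t → (2 : ℝ) ^ s ≤ (2 : ℝ) ^ t := fun h =>
      Real.rpow_le_rpow_of_exponent_le one_le_two h
    have b1 := hs.blockProd_eq_fiber_mul (fun _ => ()) (fun _ => ()) (fun _ => ()) hq₁.1 hq₂.1 hq₃.1
    have hone : ∑ ω' with SameSide (fun _ => ()) (fun _ => ()) (fun _ => ()) d ω ω',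
        blockProd q₁ q₂ q₃ d ω' = 1 := by
      rw [Finset.filter_true_of_mem fun ω' _ => sameSide_const d ω ω', hQ1]
    rw [hone, one_mul] at b1
    have b2 := hs.blockProd_eq_fiber_mul π₁ π₂ π₃ hq₁.1 hq₂.1 hq₃.1
    have b3 := hs.blockProd_eq_fiber_mul π₁' π₂' π₃' hq₁.1 hq₂.1 hq₃.1
    have b4 := hs.blockProd_eq_mul_rpow (hs.mono h₁ h₂ h₃)
    have hfib : ∀ s : Finset ((Fin n → X) × (Fin n → Y)),
        0 ≤ ∑ ω' ∈ s, blockProd q₁ q₂ q₃ d ω' := fun s => Finset.sum_nonneg fun ω' _ => hQ0 ω'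
    refine ⟨hpos, ?_, ?_, ?_, ?_, ?_, ?_⟩
    · rw [b1]
      exact hmono (by linarith)
    · rw [b1]
      exact hmono (by linarith)
    · refine le_trans ?_ b2.ge
      exact mul_le_mul_of_nonneg_left (hmono (by linarith)) (hfib _)
    · refine b2.le.trans ?_
      exact mul_le_mul_of_nonneg_left (hmono (by linarith)) (hfib _)
    · refine le_trans ?_ b3.ge
      exact mul_le_mul_of_nonneg_left (hmono (by linarith)) (hfib _)
    · rw [b4]
      exact mul_le_mul_of_nonneg_left (hmono (by linarith)) hpos.le

end Typical

/-! ### Exponential lower bounds -/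

/-- The sequence decays at most exponentially with rate `E`, up to a vanishing correction. -/
def ExpLowerBound (pe : ℕ → ℝ) (E : ℝ) : Prop :=
  ∀ ε : ℝ, 0 < ε → ∀ᶠ n : ℕ in atTop, (2 : ℝ) ^ (-((n : ℝ) * (E + ε))) ≤ pe n

lemma ExpLowerBound.mono {pe : ℕ → ℝ} {E E' : ℝ} (h : ExpLowerBound pe E) (hE : E ≤ E') :
    ExpLowerBound pe E' := by
  intro ε hε
  filter_upwards [h ε hε] with n hn
  refine le_trans (Real.rpow_le_rpow_of_exponent_le one_le_two ?_) hn
  have : (n : ℝ) * (E + ε) ≤ n * (E' + ε) := by gcongr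
  linarith

/-- Constant factors are absorbed by the exponential. -/
lemma eventually_two_rpow_neg_le {c : ℝ} (hc : 0 < c) {ε : ℝ} (hε : 0 < ε) :
    ∀ᶠ n : ℕ in atTop, (2 : ℝ) ^ (-((n : ℝ) * ε)) ≤ c := by
  have h : Tendsto (fun n : ℕ => (n : ℝ) * ε) atTop atTop :=
    tendsto_natCast_atTop_atTop.atTop_mul_const hε
  filter_upwards [h.eventually_ge_atTop (-Real.logb 2 c)] with n hn
  rw [← Real.le_logb_iff_rpow_le one_lt_two hc]
  linarith

/-- The weighted length combination, divided by `n`, converges. -/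
lemma tendsto_blockMean_div {d : ∀ n : ℕ, Fin (n + 1)} {δ : ℝ}
    (hd : Tendsto (fun n : ℕ => ((d n : ℕ) : ℝ) / (n : ℝ)) atTop (𝓝 δ)) (a b c : ℝ) :
    Tendsto (fun n : ℕ => blockMean (d n) a b c / n) atTop (𝓝 (δ * a + (1 - δ) * b + δ * c)) := by
  have h := ((hd.mul_const a).add ((tendsto_const_nhds (x := (1 : ℝ)).sub hd).mul_const b)).add
    (hd.mul_const c)
  refine h.congr' ?_
  filter_upwards [eventually_gt_atTop 0] with n hn
  have hn' : (n : ℝ) ≠ 0 := by exact_mod_cast hn.ne'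
  unfold blockMean
  rw [cast_sub_delay]
  field_simp

lemma eventually_blockMean_near {d : ∀ n : ℕ, Fin (n + 1)} {δ : ℝ}
    (hd : Tendsto (fun n : ℕ => ((d n : ℕ) : ℝ) / (n : ℝ)) atTop (𝓝 δ)) (a b c : ℝ) {ε : ℝ}
    (hε : 0 < ε) : ∀ᶠ n : ℕ in atTop,
      n * (δ * a + (1 - δ) * b + δ * c - ε) ≤ blockMean (d n) a b c ∧
      blockMean (d n) a b c ≤ n * (δ * a + (1 - δ) * b + δ * c + ε) := by
  have h := tendsto_blockMean_div hd a b c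
  filter_upwards [h.eventually (lt_mem_nhds (sub_lt_self _ hε)),
    h.eventually (gt_mem_nhds (lt_add_of_pos_right _ hε)), eventually_gt_atTop 0] with n h1 h2 hn
  have hn' : (0 : ℝ) < n := by exact_mod_cast hn
  rw [lt_div_iff₀ hn'] at h1
  rw [div_lt_iff₀ hn'] at h2
  constructor <;> linarith

/-- The minimum in the finite-length bounds, in exponential form. -/
lemma two_rpow_neg_max_le_min {s M u z : ℝ} (hM : 0 < M) (hMs : M ≤ (2 : ℝ) ^ s) {c : ℝ}
    (hc : 1 ≤ c) (hz : max (s - u) 0 ≤ z) :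
    (2 : ℝ) ^ (-z) / c ≤ min 1 ((2 : ℝ) ^ u / c / M) := by
  have hc0 : 0 < c := by linarith
  refine le_min ?_ ?_
  · refine div_le_one_of_le₀ (le_trans ?_ hc) hc0.le
    exact Real.rpow_le_one_of_one_le_of_nonpos one_le_two (by linarith [le_max_right (s - u) 0])
  · rw [div_right_comm]
    refine div_le_div_of_nonneg_right ?_ hc0.le
    rw [le_div_iff₀ hM]
    calc (2 : ℝ) ^ (-z) * M ≤ (2 : ℝ) ^ (-z) * (2 : ℝ) ^ s := by gcongr
      _ = (2 : ℝ) ^ (-z + s) := (Real.rpow_add two_pos _ _).symm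
      _ ≤ (2 : ℝ) ^ u := Real.rpow_le_rpow_of_exponent_le one_le_two
          (by linarith [le_max_left (s - u) 0])

section LowerExponent

variable {X Y : Type*} [Fintype X] [Fintype Y] [DecidableEq X] [DecidableEq Y]
variable {B₁ B₂ B₃ : Type*} [Fintype B₁] [DecidableEq B₁] [Fintype B₂] [DecidableEq B₂]
  [Fintype B₃] [DecidableEq B₃]

/-- Lower bound for the errors in one of the blocks. Here `κ` is that part of the pair which is
decoded correctly, `M` the number of bins of the other block, and `q` an arbitrary law under which
that block has positive conditional entropy rate. -/
lemma expLowerBound_of_fibers (π₁ : Y → B₁) (π₂ : X × Y → B₂) (π₃ : X → B₃)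
    {p₁ q₁ : Y → ℝ} {p₂ q₂ : X × Y → ℝ} {p₃ q₃ : X → ℝ} (hp₁ : ∀ z, 0 ≤ p₁ z)
    (hp₂ : ∀ z, 0 ≤ p₂ z) (hp₃ : ∀ z, 0 ≤ p₃ z) (hq₁ : q₁ ∈ stdSimplex ℝ Y)
    (hq₂ : q₂ ∈ stdSimplex ℝ (X × Y)) (hq₃ : q₃ ∈ stdSimplex ℝ X) (h₁ : ∀ z, 0 < q₁ z → 0 < p₁ z)
    (h₂ : ∀ z, 0 < q₂ z → 0 < p₂ z) (h₃ : ∀ z, 0 < q₃ z → 0 < p₃ z)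
    {d : ∀ n : ℕ, Fin (n + 1)} {δ : ℝ}
    (hd : Tendsto (fun n : ℕ => ((d n : ℕ) : ℝ) / (n : ℝ)) atTop (𝓝 δ))
    {K : ℕ → Type*} [∀ n, Fintype (K n)] [∀ n, DecidableEq (K n)]
    (κ : ∀ n, (Fin n → X) × (Fin n → Y) → K n)
    (hκ : ∀ n ω ω', SameSide π₁ π₂ π₃ (d n) ω ω' ↔ κ n ω' = κ n ω) {R : ℝ} {M : ℕ → ℕ}
    (hM : ∀ n, 0 < M n) (hMR : ∀ n : ℕ, (M n : ℝ) ≤ (2 : ℝ) ^ ((n : ℝ) * R))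
    (e : ∀ n, (Fin n → X) × (Fin n → Y) → ℝ) (he : ∀ n ω, 0 ≤ e n ω)
    (hfib : ∀ n (S : Finset ((Fin n → X) × (Fin n → Y))) (k : K n), (∀ ω ∈ S, κ n ω = k) →
      2 ≤ S.card → (S.card : ℝ) * min 1 ((S.card : ℝ) / M n) / 36 ≤ ∑ ω ∈ S, e n ω)
    (hpos : 0 < δ * condEnt π₁ q₁ + (1 - δ) * condEnt π₂ q₂ + δ * condEnt π₃ q₃) :
    ExpLowerBound (fun n => ∑ ω, blockProd p₁ p₂ p₃ (d n) ω * e n ω)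
      (δ * relEnt q₁ p₁ + (1 - δ) * relEnt q₂ p₂ + δ * relEnt q₃ p₃ +
        max (R - (δ * condEnt π₁ q₁ + (1 - δ) * condEnt π₂ q₂ + δ * condEnt π₃ q₃)) 0) := by
  intro ε₀ hε₀
  set h := δ * condEnt π₁ q₁ + (1 - δ) * condEnt π₂ q₂ + δ * condEnt π₃ q₃ with hh
  set D := δ * relEnt q₁ p₁ + (1 - δ) * relEnt q₂ p₂ + δ * relEnt q₃ p₃ with hD
  -- The estimates below lose `7 n ε` in the exponent; `4 ε ≤ h` keeps the typical fibres large.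
  obtain ⟨ε, hε, hε1, hε2⟩ : ∃ ε : ℝ, 0 < ε ∧ 7 * ε ≤ ε₀ ∧ 4 * ε ≤ h :=
    ⟨min (ε₀ / 7) (h / 4), lt_min (by positivity) (by positivity),
      by linarith [min_le_left (ε₀ / 7) (h / 4)], by linarith [min_le_right (ε₀ / 7) (h / 4)]⟩
  filter_upwards [exists_typical π₁ π₂ π₃ π₁ π₂ π₃ hq₁ hq₂ hq₃ h₁ h₂ h₃ hε,
    eventually_blockMean_near hd (condEnt π₁ q₁) (condEnt π₂ q₂) (condEnt π₃ q₃) hε,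
    eventually_blockMean_near hd (relEnt q₁ p₁) (relEnt q₂ p₂) (relEnt q₃ p₃) hε,
    eventually_two_rpow_neg_le (by norm_num : (0 : ℝ) < 1 / 576) hε,
    eventually_two_rpow_neg_le (by norm_num : (0 : ℝ) < 1 / 8) hε] with n htyp hhn hDn hc1 hc2
  obtain ⟨T, hT, hTω⟩ := htyp (d n)
  set hx := blockMean (d n) (condEnt π₁ q₁) (condEnt π₂ q₂) (condEnt π₃ q₃) with hhx
  set hxy := blockMean (d n) (condEnt (fun _ => ()) q₁) (condEnt (fun _ => ()) q₂)
    (condEnt (fun _ => ()) q₃) with hhxy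
  set Dn := blockMean (d n) (relEnt q₁ p₁) (relEnt q₂ p₂) (relEnt q₃ p₃) with hDn'
  have h2 : ∀ z : ℝ, 0 < (2 : ℝ) ^ z := fun z => Real.rpow_pos_of_pos two_pos z
  have hM' : (0 : ℝ) < M n := by exact_mod_cast hM n
  have hinv : ∀ z : ℝ, 1 / (4 * (2 : ℝ) ^ (-z)) = (2 : ℝ) ^ z / 4 := fun z => by
    rw [Real.rpow_neg two_pos.le]
    have := (h2 z).ne'
    field_simp
  have hr2 : 2 ≤ 1 / (4 * (2 : ℝ) ^ (-(hx - n * ε))) := by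
    rw [hinv]
    have h8 : (8 : ℝ) ≤ (2 : ℝ) ^ ((n : ℝ) * ε) := by
      rw [Real.rpow_neg two_pos.le] at hc2
      rw [inv_le_comm₀ (h2 _) (by norm_num)] at hc2
      linarith
    have : (2 : ℝ) ^ ((n : ℝ) * ε) ≤ (2 : ℝ) ^ (hx - n * ε) := by
      refine Real.rpow_le_rpow_of_exponent_le one_le_two ?_
      have : (n : ℝ) * (h - ε) ≥ n * (2 * ε) := by
        refine mul_le_mul_of_nonneg_left ?_ (Nat.cast_nonneg n)
        linarith
      linarith [hhn.1]
    linarith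
  have hbase := fiberwise_lower_bound (κ n) T (Q := blockProd q₁ q₂ q₃ (d n)) (e := e n)
    (qM := (2 : ℝ) ^ (-(hxy - n * ε))) (r := (2 : ℝ) ^ (-(hx - n * ε))) (M := M n)
    (blockProd_nonneg hq₁.1 hq₂.1 hq₃.1 (d n)) (sum_blockProd_eq_one hq₁.2 hq₂.2 hq₃.2 (d n)).le
    (he n) (h2 _) (h2 _) hM' hr2 hT (fun ω hω => (hTω ω hω).2.2.1)
    (fun ω hω => by
      have := (hTω ω hω).2.2.2.2.1
      simp only [hκ] at this
      exact this)
    (fun k hk => hfib n _ k (fun ω hω => (Finset.mem_filter.1 hω).2) hk)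
  rw [hinv, hinv] at hbase
  set z : ℝ := max (n * R - (hx - n * ε)) 0 with hz
  have hmin := two_rpow_neg_max_le_min hM' (hMR n) (u := hx - n * ε) (c := 4) (by norm_num)
    (le_refl z)
  have hP : ∀ ω ∈ T, (2 : ℝ) ^ (-(hxy + Dn + 2 * (n * ε))) ≤ blockProd p₁ p₂ p₃ (d n) ω := by
    intro ω hω
    obtain ⟨-, hlow, -, -, -, -, hrel⟩ := hTω ω hω
    refine le_trans (le_trans (le_of_eq ?_) (mul_le_mul_of_nonneg_right hlow (h2 _).le)) hrel
    rw [← Real.rpow_add two_pos]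
    congr 1
    ring
  have hzbound : z ≤ n * (max (R - h) 0 + 2 * ε) := by
    refine max_le ?_ (by positivity)
    have : (n : ℝ) * (R - h) ≤ n * max (R - h) 0 := by gcongr; exact le_max_left _ _
    linarith [hhn.1]
  calc (2 : ℝ) ^ (-((n : ℝ) * (D + max (R - h) 0 + ε₀)))
      ≤ (2 : ℝ) ^ (-(n * ε) + -(hxy + Dn + 2 * (n * ε)) + (hxy - n * ε) + -z) := by
        refine Real.rpow_le_rpow_of_exponent_le one_le_two ?_
        have : (n : ℝ) * (7 * ε) ≤ n * ε₀ := by gcongr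
        linarith [hDn.2]
    _ = (2 : ℝ) ^ (-(n * ε)) * (2 : ℝ) ^ (-(hxy + Dn + 2 * (n * ε))) * (2 : ℝ) ^ (hxy - n * ε) *
        (2 : ℝ) ^ (-z) := by
        rw [Real.rpow_add two_pos, Real.rpow_add two_pos, Real.rpow_add two_pos]
    _ ≤ 1 / 576 * (2 : ℝ) ^ (-(hxy + Dn + 2 * (n * ε))) * (2 : ℝ) ^ (hxy - n * ε) *
        (2 : ℝ) ^ (-z) := by gcongr
    _ = (2 : ℝ) ^ (-(hxy + Dn + 2 * (n * ε))) *
        ((2 : ℝ) ^ (hxy - n * ε) / 4 * ((2 : ℝ) ^ (-z) / 4 / 36)) := by ring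
    _ ≤ (2 : ℝ) ^ (-(hxy + Dn + 2 * (n * ε))) * ∑ ω ∈ T, e n ω := by
        refine mul_le_mul_of_nonneg_left (le_trans ?_ hbase) (h2 _).le
        gcongr
    _ ≤ ∑ ω ∈ T, blockProd p₁ p₂ p₃ (d n) ω * e n ω := by
        rw [Finset.mul_sum]
        exact Finset.sum_le_sum fun ω hω => mul_le_mul_of_nonneg_right (hP ω hω) (he n ω)
    _ ≤ _ := Finset.sum_le_sum_of_subset_of_nonneg (Finset.subset_univ T) fun ω _ _ =>
        mul_nonneg (blockProd_nonneg hp₁ hp₂ hp₃ _ ω) (he n ω)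

end LowerExponent

/-! ### Errors in both blocks -/

section JointExponent

lemma card_le_of_mass {Ω : Type*} {S : Finset Ω} {Q : Ω → ℝ} {F z : ℝ} (hF : 0 < F)
    (hS : ∑ ω ∈ S, Q ω ≤ F) (h : ∀ ω ∈ S, F * (2 : ℝ) ^ (-z) ≤ Q ω) :
    (S.card : ℝ) ≤ (2 : ℝ) ^ z := by
  have h1 : (S.card : ℝ) * (F * (2 : ℝ) ^ (-z)) ≤ F := by
    rw [← nsmul_eq_mul, ← Finset.sum_const]
    exact (Finset.sum_le_sum h).trans hS
  have h2 : (S.card : ℝ) * (2 : ℝ) ^ (-z) ≤ 1 := by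
    refine le_of_mul_le_mul_left ?_ hF
    linarith
  rw [Real.rpow_neg two_pos.le, ← div_eq_mul_inv] at h2
  exact (div_le_one (Real.rpow_pos_of_pos two_pos _)).1 h2

/-- If each point of `T` carries at least the share `2^(-z)` of the mass of its fibre, then no fibre
holds more than `2^z` points of `T`. -/
lemma card_fiber_le {Ω K : Type*} [Fintype Ω] [DecidableEq K] (κ : Ω → K) {T : Finset Ω} {Q : Ω → ℝ}
    {z : ℝ} (hQ : ∀ ω, 0 ≤ Q ω) (hpos : ∀ ω ∈ T, 0 < Q ω)
    (hT : ∀ ω ∈ T, (∑ ω' with κ ω' = κ ω, Q ω') * (2 : ℝ) ^ (-z) ≤ Q ω) (k : K) :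
    ((T.filter fun ω => κ ω = k).card : ℝ) ≤ (2 : ℝ) ^ z := by
  rcases (T.filter fun ω => κ ω = k).eq_empty_or_nonempty with h0 | ⟨t, ht⟩
  · rw [h0, Finset.card_empty, Nat.cast_zero]
    exact (Real.rpow_pos_of_pos two_pos _).le
  · rw [Finset.mem_filter] at ht
    refine card_le_of_mass (Q := Q) (F := ∑ ω' with κ ω' = k, Q ω') ?_
      (Finset.sum_le_sum_of_subset_of_nonneg (Finset.filter_subset_filter _ (Finset.subset_univ _))
        fun ω _ _ => hQ ω) fun ω hω => ?_
    · exact (hpos t ht.1).trans_le (Finset.single_le_sum (fun ω _ => hQ ω)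
        (Finset.mem_filter.2 ⟨Finset.mem_univ _, ht.2⟩))
    · rw [Finset.mem_filter] at hω
      have := hT ω hω.1
      rwa [hω.2] at this

variable {X Y : Type*} [Fintype X] [Fintype Y] [DecidableEq X] [DecidableEq Y]

/-- Lower bound for errors in both blocks, under a law `q` for which the rates exceed the
conditional entropy rates: then competitors sharing one of the two blocks are rare. -/
lemma expLowerBound_joint_of_le {p₁ q₁ : Y → ℝ} {p₂ q₂ : X × Y → ℝ} {p₃ q₃ : X → ℝ}
    (hp₁ : ∀ z, 0 ≤ p₁ z) (hp₂ : ∀ z, 0 ≤ p₂ z) (hp₃ : ∀ z, 0 ≤ p₃ z) (hq₁ : q₁ ∈ stdSimplex ℝ Y)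
    (hq₂ : q₂ ∈ stdSimplex ℝ (X × Y)) (hq₃ : q₃ ∈ stdSimplex ℝ X) (h₁ : ∀ z, 0 < q₁ z → 0 < p₁ z)
    (h₂ : ∀ z, 0 < q₂ z → 0 < p₂ z) (h₃ : ∀ z, 0 < q₃ z → 0 < p₃ z)
    {d : ∀ n : ℕ, Fin (n + 1)} {δ : ℝ}
    (hd : Tendsto (fun n : ℕ => ((d n : ℕ) : ℝ) / (n : ℝ)) atTop (𝓝 δ)) {Rx Ry : ℝ}
    (hRx : 0 ≤ Rx) (hRy : 0 ≤ Ry) (dec : ∀ n, Decoder X Y n (numBins n Rx) (numBins n Ry))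
    (hx : δ * condEnt id q₁ + (1 - δ) * condEnt Prod.snd q₂ + δ * condEnt (fun _ => ()) q₃ ≤ Rx)
    (hy : δ * condEnt (fun _ => ()) q₁ + (1 - δ) * condEnt Prod.fst q₂ + δ * condEnt id q₃ ≤ Ry)
    (hpos : 0 < δ * condEnt (fun _ => ()) q₁ + (1 - δ) * condEnt (fun _ => ()) q₂ +
      δ * condEnt (fun _ => ()) q₃) :
    ExpLowerBound (fun n => ∑ ω, blockProd p₁ p₂ p₃ (d n) ω * pairErr (dec n) ω)
      (δ * relEnt q₁ p₁ + (1 - δ) * relEnt q₂ p₂ + δ * relEnt q₃ p₃ +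
        max (Rx + Ry - (δ * condEnt (fun _ => ()) q₁ + (1 - δ) * condEnt (fun _ => ()) q₂ +
          δ * condEnt (fun _ => ()) q₃)) 0) := by
  intro ε₀ hε₀
  set h := δ * condEnt (fun _ => ()) q₁ + (1 - δ) * condEnt (fun _ => ()) q₂ +
    δ * condEnt (fun _ => ()) q₃ with hh
  set D := δ * relEnt q₁ p₁ + (1 - δ) * relEnt q₂ p₂ + δ * relEnt q₃ p₃ with hD
  -- The estimates below lose `9 n ε` in the exponent; `4 ε ≤ h` makes the typical set large.
  obtain ⟨ε, hε, hε1, hε2⟩ : ∃ ε : ℝ, 0 < ε ∧ 9 * ε ≤ ε₀ ∧ 4 * ε ≤ h :=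
    ⟨min (ε₀ / 9) (h / 4), lt_min (by positivity) (by positivity),
      by linarith [min_le_left (ε₀ / 9) (h / 4)], by linarith [min_le_right (ε₀ / 9) (h / 4)]⟩
  filter_upwards [exists_typical id Prod.snd (fun _ => ()) (fun _ => ()) Prod.fst id hq₁ hq₂ hq₃
      h₁ h₂ h₃ hε,
    eventually_blockMean_near hd (condEnt (fun _ => ()) q₁) (condEnt (fun _ => ()) q₂)
      (condEnt (fun _ => ()) q₃) hε,
    eventually_blockMean_near hd (condEnt id q₁) (condEnt Prod.snd q₂)
      (condEnt (fun _ => ()) q₃) hε,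
    eventually_blockMean_near hd (condEnt (fun _ => ()) q₁) (condEnt Prod.fst q₂)
      (condEnt id q₃) hε,
    eventually_blockMean_near hd (relEnt q₁ p₁) (relEnt q₂ p₂) (relEnt q₃ p₃) hε,
    eventually_two_rpow_neg_le (by norm_num : (0 : ℝ) < 1 / 288) hε,
    eventually_two_rpow_neg_le (by norm_num : (0 : ℝ) < 1 / 4) hε]
    with n htyp hhn hxn hyn hDn hc1 hc2
  obtain ⟨T, hT, hTω⟩ := htyp (d n)
  set hbx := blockMean (d n) (condEnt id q₁) (condEnt Prod.snd q₂) (condEnt (fun _ => ()) q₃)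
  set hby := blockMean (d n) (condEnt (fun _ => ()) q₁) (condEnt Prod.fst q₂) (condEnt id q₃)
  set hxy := blockMean (d n) (condEnt (fun _ => ()) q₁) (condEnt (fun _ => ()) q₂)
    (condEnt (fun _ => ()) q₃)
  set Dn := blockMean (d n) (relEnt q₁ p₁) (relEnt q₂ p₂) (relEnt q₃ p₃)
  have h2 : ∀ z : ℝ, 0 < (2 : ℝ) ^ z := fun z => Real.rpow_pos_of_pos two_pos z
  have hmono : ∀ {s t : ℝ}, s ≤ t → (2 : ℝ) ^ s ≤ (2 : ℝ) ^ t := fun h =>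
    Real.rpow_le_rpow_of_exponent_le one_le_two h
  have hMx := numBins_pos n hRx
  have hMy := numBins_pos n hRy
  have hMx' : (0 : ℝ) < numBins n Rx := by exact_mod_cast hMx
  have hMy' : (0 : ℝ) < numBins n Ry := by exact_mod_cast hMy
  have hn0 : (0 : ℝ) ≤ n := Nat.cast_nonneg n
  have hQ0 := blockProd_nonneg (n := n) hq₁.1 hq₂.1 hq₃.1 (d n)
  -- Typical pairs have probability close to `2^(-hxy)`, so there are about `2^hxy` of them.
  have hN : (2 : ℝ) ^ (hxy - n * ε) / 2 ≤ T.card := by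
    have e1 : ∑ ω ∈ T, blockProd q₁ q₂ q₃ (d n) ω ≤ T.card * (2 : ℝ) ^ (-(hxy - n * ε)) := by
      rw [← nsmul_eq_mul, ← Finset.sum_const]
      exact Finset.sum_le_sum fun ω hω => (hTω ω hω).2.2.1
    rw [Real.rpow_neg two_pos.le, ← div_eq_mul_inv] at e1
    have e2 := hT.trans e1
    rw [le_div_iff₀ (h2 _)] at e2
    linarith
  have hN2 : 2 ≤ T.card := by
    have h4 : (4 : ℝ) ≤ (2 : ℝ) ^ ((n : ℝ) * ε) := by
      rw [Real.rpow_neg two_pos.le, inv_le_comm₀ (h2 _) (by norm_num)] at hc2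
      linarith
    have h5 : (2 : ℝ) ^ ((n : ℝ) * ε) ≤ (2 : ℝ) ^ (hxy - n * ε) := by
      refine hmono ?_
      have : (n : ℝ) * (2 * ε) ≤ n * (h - ε) := by
        refine mul_le_mul_of_nonneg_left ?_ hn0
        linarith
      linarith [hhn.1]
    have : (2 : ℝ) ≤ T.card := by linarith
    exact_mod_cast this
  -- Given one block, there are at most about `2^hbx` or `2^hby` typical completions.
  have ha : ∀ y, ((T.filter fun t => t.2 = y).card : ℝ) ≤ (2 : ℝ) ^ (hbx + n * ε) :=
    card_fiber_le Prod.snd hQ0 (fun ω hω => (hTω ω hω).1) fun ω hω => by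
      have := (hTω ω hω).2.2.2.1
      simp only [sameSide_snd_iff] at this
      exact this
  have hb : ∀ x, ((T.filter fun t => t.1 = x).card : ℝ) ≤ (2 : ℝ) ^ (hby + n * ε) :=
    card_fiber_le Prod.fst hQ0 (fun ω hω => (hTω ω hω).1) fun ω hω => by
      have := (hTω ω hω).2.2.2.2.2.1
      simp only [sameSide_fst_iff] at this
      exact this
  have hfew : ∀ {u R : ℝ}, 0 ≤ R → u ≤ n * (R + ε) →
      (2 : ℝ) ^ (u + n * ε) / numBins n R ≤ 2 * (2 : ℝ) ^ (2 * (n * ε)) := by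
    intro u R hR hu
    calc (2 : ℝ) ^ (u + n * ε) / numBins n R = (2 : ℝ) ^ (u + n * ε) * (1 / numBins n R) := by
          ring
      _ ≤ (2 : ℝ) ^ (u + n * ε) * (2 * (2 : ℝ) ^ (-((n : ℝ) * R))) :=
          mul_le_mul_of_nonneg_left (one_div_numBins_le n hR) (h2 _).le
      _ = 2 * (2 : ℝ) ^ (u + n * ε + -((n : ℝ) * R)) := by
          rw [Real.rpow_add two_pos (u + n * ε)]
          ring
      _ ≤ _ := by
          refine mul_le_mul_of_nonneg_left (hmono ?_) zero_le_two
          linarith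
  have hac : (2 : ℝ) ^ (hbx + n * ε) / numBins n Rx ≤ 2 * (2 : ℝ) ^ (2 * (n * ε)) := by
    refine hfew hRx (hxn.2.trans ?_)
    exact mul_le_mul_of_nonneg_left (by linarith) hn0
  have hbc : (2 : ℝ) ^ (hby + n * ε) / numBins n Ry ≤ 2 * (2 : ℝ) ^ (2 * (n * ε)) := by
    refine hfew hRy (hyn.2.trans ?_)
    exact mul_le_mul_of_nonneg_left (by linarith) hn0
  have hc : 2 ≤ 2 * (2 : ℝ) ^ (2 * (n * ε)) := by
    have : (1 : ℝ) ≤ (2 : ℝ) ^ (2 * (n * ε)) := Real.one_le_rpow one_le_two (by positivity)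
    linarith
  have hbase := mul_min_le_sum_pairErr (dec n) hMx hMy T hN2 ha hb hc hac hbc
  set z : ℝ := max (n * (Rx + Ry) - (hxy - n * ε)) 0 with hz
  have hMM : (numBins n Rx : ℝ) * numBins n Ry ≤ (2 : ℝ) ^ ((n : ℝ) * (Rx + Ry)) := by
    rw [mul_add, Real.rpow_add two_pos]
    exact mul_le_mul (numBins_le n Rx) (numBins_le n Ry) hMy'.le (h2 _).le
  have hmin := two_rpow_neg_max_le_min (mul_pos hMx' hMy') hMM (u := hxy - n * ε) (c := 2)
    (by norm_num) (le_refl z)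
  have hP : ∀ ω ∈ T, (2 : ℝ) ^ (-(hxy + Dn + 2 * (n * ε))) ≤ blockProd p₁ p₂ p₃ (d n) ω := by
    intro ω hω
    obtain ⟨-, hlow, -, -, -, -, hrel⟩ := hTω ω hω
    refine le_trans (le_trans (le_of_eq ?_) (mul_le_mul_of_nonneg_right hlow (h2 _).le)) hrel
    rw [← Real.rpow_add two_pos]
    congr 1
    ring
  have hzbound : z ≤ n * (max (Rx + Ry - h) 0 + 2 * ε) := by
    refine max_le ?_ (by positivity)
    have : (n : ℝ) * (Rx + Ry - h) ≤ n * max (Rx + Ry - h) 0 := by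
      gcongr
      exact le_max_left _ _
    linarith [hhn.1]
  calc (2 : ℝ) ^ (-((n : ℝ) * (D + max (Rx + Ry - h) 0 + ε₀)))
      ≤ (2 : ℝ) ^ (-(n * ε) + -(hxy + Dn + 2 * (n * ε)) + (hxy - n * ε) + -z +
          -(2 * (n * ε))) := by
        refine hmono ?_
        have : (n : ℝ) * (9 * ε) ≤ n * ε₀ := by gcongr
        linarith [hDn.2]
    _ = (2 : ℝ) ^ (-(n * ε)) * (2 : ℝ) ^ (-(hxy + Dn + 2 * (n * ε))) * (2 : ℝ) ^ (hxy - n * ε) *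
        (2 : ℝ) ^ (-z) * (2 : ℝ) ^ (-(2 * (n * ε))) := by
        rw [Real.rpow_add two_pos, Real.rpow_add two_pos, Real.rpow_add two_pos,
          Real.rpow_add two_pos]
    _ ≤ 1 / 288 * (2 : ℝ) ^ (-(hxy + Dn + 2 * (n * ε))) * (2 : ℝ) ^ (hxy - n * ε) *
        (2 : ℝ) ^ (-z) * (2 : ℝ) ^ (-(2 * (n * ε))) := by gcongr
    _ = (2 : ℝ) ^ (-(hxy + Dn + 2 * (n * ε))) *
        ((2 : ℝ) ^ (hxy - n * ε) / 2 * ((2 : ℝ) ^ (-z) / 2) /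
          (36 * (2 * (2 : ℝ) ^ (2 * (n * ε))))) := by
        rw [Real.rpow_neg two_pos.le (2 * (n * ε))]
        have := (h2 (2 * (n * ε))).ne'
        field_simp
        ring
    _ ≤ (2 : ℝ) ^ (-(hxy + Dn + 2 * (n * ε))) * ∑ ω ∈ T, pairErr (dec n) ω := by
        refine mul_le_mul_of_nonneg_left (le_trans ?_ hbase) (h2 _).le
        refine div_le_div_of_nonneg_right ?_ (by positivity)
        refine mul_le_mul hN (hmin.trans (min_le_min_left 1 ?_)) (by positivity) (by positivity)
        exact div_le_div_of_nonneg_right hN (by positivity)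
    _ ≤ ∑ ω ∈ T, blockProd p₁ p₂ p₃ (d n) ω * pairErr (dec n) ω := by
        rw [Finset.mul_sum]
        exact Finset.sum_le_sum fun ω hω =>
          mul_le_mul_of_nonneg_right (hP ω hω) (pairErr_nonneg (dec n) ω)
    _ ≤ _ := Finset.sum_le_sum_of_subset_of_nonneg (Finset.subset_univ T) fun ω _ _ =>
        mul_nonneg (blockProd_nonneg hp₁ hp₂ hp₃ _ ω) (pairErr_nonneg (dec n) ω)

/-! ### Errors in a single unpaired letter -/

lemma one_div_le_pairErr_pair_fst {α β : Type*} [Fintype α] [DecidableEq α] [Fintype β]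
    [DecidableEq β] {Mx My : ℕ} (dec : (α → Fin Mx) → (β → Fin My) → Fin Mx → Fin My → α × β)
    (hMx : 0 < Mx) (hMy : 0 < My) {x x' : α} (hx : x ≠ x') (y : β) :
    1 / (18 * (Mx : ℝ)) ≤ pairErr dec (x, y) + pairErr dec (x', y) := by
  have hne : ((x, y) : α × β) ≠ (x', y) := fun h => hx (Prod.ext_iff.1 h).1
  have h := mul_min_le_sum_pairErr_fst dec hMx hMy {(x, y), (x', y)} y (by simp)
    (Finset.card_pair hne).ge
  rw [Finset.card_pair hne, Finset.sum_pair hne] at h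
  refine le_trans ?_ h
  have hM : (1 : ℝ) ≤ Mx := by exact_mod_cast hMx
  have hmin : 1 / (Mx : ℝ) ≤ min 1 (((2 : ℕ) : ℝ) / Mx) :=
    le_min (div_le_one_of_le₀ hM (by linarith)) (by gcongr; norm_num)
  rw [one_div, mul_inv, ← one_div, ← one_div]
  push_cast at hmin ⊢
  linarith

lemma one_div_le_pairErr_pair_snd {α β : Type*} [Fintype α] [DecidableEq α] [Fintype β]
    [DecidableEq β] {Mx My : ℕ} (dec : (α → Fin Mx) → (β → Fin My) → Fin Mx → Fin My → α × β)
    (hMx : 0 < Mx) (hMy : 0 < My) (x : α) {y y' : β} (hy : y ≠ y') :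
    1 / (18 * (My : ℝ)) ≤ pairErr dec (x, y) + pairErr dec (x, y') := by
  have hne : ((x, y) : α × β) ≠ (x, y') := fun h => hy (Prod.ext_iff.1 h).2
  have h := mul_min_le_sum_pairErr_snd dec hMx hMy {(x, y), (x, y')} x (by simp)
    (Finset.card_pair hne).ge
  rw [Finset.card_pair hne, Finset.sum_pair hne] at h
  refine le_trans ?_ h
  have hM : (1 : ℝ) ≤ My := by exact_mod_cast hMy
  have hmin : 1 / (My : ℝ) ≤ min 1 (((2 : ℕ) : ℝ) / My) :=
    le_min (div_le_one_of_le₀ hM (by linarith)) (by gcongr; norm_num)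
  rw [one_div, mul_inv, ← one_div, ← one_div]
  push_cast at hmin ⊢
  linarith

lemma exists_two_letters {A : Type*} [Fintype A] {w : A → ℝ} (hw : w ∈ stdSimplex ℝ A)
    (h : 0 < entropy w) : ∃ a b, a ≠ b ∧ 0 < w a ∧ 0 < w b := by
  rw [entropy_eq_condEnt hw.2, condEnt_pos_iff _ hw.1] at h
  obtain ⟨a, b, hab, -, ha, hb⟩ := h
  exact ⟨a, b, hab, ha, hb⟩

lemma expLowerBound_of_mul_one_div {pe : ℕ → ℝ} {R m : ℝ} (hR : 0 ≤ R) (hm : 0 < m)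
    (h : ∀ᶠ n in atTop, m * (1 / (18 * (numBins n R : ℝ))) ≤ pe n) : ExpLowerBound pe R := by
  intro ε hε
  filter_upwards [h, eventually_two_rpow_neg_le (by positivity : 0 < m / 18) hε] with n hn hc
  refine le_trans ?_ hn
  have hM : (0 : ℝ) < numBins n R := by exact_mod_cast numBins_pos n hR
  calc (2 : ℝ) ^ (-((n : ℝ) * (R + ε))) = (2 : ℝ) ^ (-((n : ℝ) * R)) * (2 : ℝ) ^ (-((n : ℝ) * ε)) := by
        rw [← Real.rpow_add two_pos]
        congr 1
        ring
    _ ≤ (1 / numBins n R) * (m / 18) := by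
        refine mul_le_mul ?_ hc (Real.rpow_pos_of_pos two_pos _).le (by positivity)
        rw [Real.rpow_neg two_pos.le, ← one_div]
        exact one_div_le_one_div_of_le hM (numBins_le n R)
    _ = _ := by
        rw [one_div_mul_eq_div, div_div, mul_one_div]

/-- If some letter of the first block is unpaired, two values of its last letter cannot be told
apart once their bins agree. -/
lemma expLowerBound_unpaired_fst {p₁ : Y → ℝ} {p₂ : X × Y → ℝ} {p₃ : X → ℝ}
    (hp₁ : p₁ ∈ stdSimplex ℝ Y) (hp₂ : p₂ ∈ stdSimplex ℝ (X × Y)) (hp₃ : p₃ ∈ stdSimplex ℝ X)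
    (hX : 0 < entropy p₃) {d : ∀ n : ℕ, Fin (n + 1)} (hd : ∀ᶠ n in atTop, 1 ≤ (d n : ℕ))
    {Rx Ry : ℝ} (hRx : 0 ≤ Rx) (hRy : 0 ≤ Ry)
    (dec : ∀ n, Decoder X Y n (numBins n Rx) (numBins n Ry)) :
    ExpLowerBound (fun n => ∑ ω, blockProd p₁ p₂ p₃ (d n) ω * pairErr (dec n) ω) Rx := by
  obtain ⟨a, b, hab, ha, hb⟩ := exists_two_letters hp₃ hX
  refine expLowerBound_of_mul_one_div hRx (lt_min ha hb) ?_
  filter_upwards [hd] with n hn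
  have hdn := Nat.lt_succ_iff.1 (d n).2
  let last : Fin n := ⟨n - 1, by omega⟩
  let last' : Fin (d n : ℕ) := ⟨(d n : ℕ) - 1, by omega⟩
  refine letter_swap_lower_bound
    (fun c (ω : (Fin n → X) × (Fin n → Y)) => (Function.update ω.1 last c, ω.2))
    (fun F => ?_) (P := blockProd p₁ p₂ p₃ (d n))
    (R := fun ω => (∏ i, p₁ (headSeg (d n : ℕ) (by omega) ω.2 i)) *
      (∏ i, p₂ (pairSeg (d n) ω.1 ω.2 i)) *
      ∏ i ∈ Finset.univ.erase last', p₃ (tailSeg (d n : ℕ) (by omega) ω.1 i)) (w := p₃)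
    (sum_blockProd_eq_one hp₁.2 hp₂.2 hp₃.2 (d n)) (fun ω => ?_) (pairErr_nonneg (dec n)) hp₃
    (fun c ω => ?_) hab (lt_min ha hb).le (min_le_left _ _) (min_le_right _ _) (fun ω => ?_)
  · rw [Fintype.sum_prod_type, Fintype.sum_prod_type_right, Finset.sum_comm, Finset.mul_sum]
    exact Finset.sum_congr rfl fun y _ => sum_sum_update last fun x => F (x, y)
  · exact mul_nonneg (mul_nonneg (Finset.prod_nonneg fun _ _ => hp₁.1 _)
      (Finset.prod_nonneg fun _ _ => hp₂.1 _)) (Finset.prod_nonneg fun _ _ => hp₃.1 _)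
  · have h1 : pairSeg (d n) (Function.update ω.1 last c) ω.2 = pairSeg (d n) ω.1 ω.2 := by
      funext i
      unfold pairSeg headSeg
      rw [Function.update_of_ne]
      intro h
      have := congrArg Fin.val h
      simp only [last] at this
      omega
    have h2 : ∀ i, i ≠ last' → tailSeg (d n : ℕ) (by omega) (Function.update ω.1 last c) i =
        tailSeg (d n : ℕ) (by omega) ω.1 i := by
      intro i hi
      unfold tailSeg
      rw [Function.update_of_ne]
      intro h
      refine hi (Fin.ext ?_)
      have := congrArg Fin.val h
      simp only [last, last'] at this ⊢
      omega
    have h3 : tailSeg (d n : ℕ) (by omega) (Function.update ω.1 last c) last' = c := by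
      have : (⟨n - (d n : ℕ) + (last' : ℕ), by omega⟩ : Fin n) = last := by
        refine Fin.ext ?_
        simp only [last, last']
        omega
      unfold tailSeg
      rw [this, Function.update_self]
    unfold blockProd
    simp only
    rw [h1, ← Finset.prod_erase_mul Finset.univ (fun i => p₃ (tailSeg (d n : ℕ) (by omega)
      (Function.update ω.1 last c) i)) (Finset.mem_univ last'), h3, ← mul_assoc]
    congr 2
    exact Finset.prod_congr rfl fun i hi => by rw [h2 i (Finset.ne_of_mem_erase hi)]
  · refine one_div_le_pairErr_pair_fst (dec n) (numBins_pos n hRx) (numBins_pos n hRy) ?_ ω.2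
    intro h
    have := congrFun h last
    rw [Function.update_self, Function.update_self] at this
    exact hab this

/-- If some letter of the second block is unpaired, two values of its first letter cannot be told
apart once their bins agree. -/
lemma expLowerBound_unpaired_snd {p₁ : Y → ℝ} {p₂ : X × Y → ℝ} {p₃ : X → ℝ}
    (hp₁ : p₁ ∈ stdSimplex ℝ Y) (hp₂ : p₂ ∈ stdSimplex ℝ (X × Y)) (hp₃ : p₃ ∈ stdSimplex ℝ X)
    (hY : 0 < entropy p₁) {d : ∀ n : ℕ, Fin (n + 1)} (hd : ∀ᶠ n in atTop, 1 ≤ (d n : ℕ))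
    {Rx Ry : ℝ} (hRx : 0 ≤ Rx) (hRy : 0 ≤ Ry)
    (dec : ∀ n, Decoder X Y n (numBins n Rx) (numBins n Ry)) :
    ExpLowerBound (fun n => ∑ ω, blockProd p₁ p₂ p₃ (d n) ω * pairErr (dec n) ω) Ry := by
  obtain ⟨a, b, hab, ha, hb⟩ := exists_two_letters hp₁ hY
  refine expLowerBound_of_mul_one_div hRy (lt_min ha hb) ?_
  filter_upwards [hd] with n hn
  have hdn := Nat.lt_succ_iff.1 (d n).2
  let first : Fin n := ⟨0, by omega⟩
  let first' : Fin (d n : ℕ) := ⟨0, by omega⟩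
  refine letter_swap_lower_bound
    (fun c (ω : (Fin n → X) × (Fin n → Y)) => (ω.1, Function.update ω.2 first c))
    (fun F => ?_) (P := blockProd p₁ p₂ p₃ (d n))
    (R := fun ω => (∏ i ∈ Finset.univ.erase first', p₁ (headSeg (d n : ℕ) (by omega) ω.2 i)) *
      (∏ i, p₂ (pairSeg (d n) ω.1 ω.2 i)) *
      ∏ i, p₃ (tailSeg (d n : ℕ) (by omega) ω.1 i)) (w := p₁)
    (sum_blockProd_eq_one hp₁.2 hp₂.2 hp₃.2 (d n)) (fun ω => ?_) (pairErr_nonneg (dec n)) hp₁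
    (fun c ω => ?_) hab (lt_min ha hb).le (min_le_left _ _) (min_le_right _ _) (fun ω => ?_)
  · rw [Fintype.sum_prod_type, Fintype.sum_prod_type, Finset.mul_sum]
    exact Finset.sum_congr rfl fun x _ => sum_sum_update first fun y => F (x, y)
  · exact mul_nonneg (mul_nonneg (Finset.prod_nonneg fun _ _ => hp₁.1 _)
      (Finset.prod_nonneg fun _ _ => hp₂.1 _)) (Finset.prod_nonneg fun _ _ => hp₃.1 _)
  · have h1 : pairSeg (d n) ω.1 (Function.update ω.2 first c) = pairSeg (d n) ω.1 ω.2 := by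
      funext i
      unfold pairSeg tailSeg
      rw [Function.update_of_ne]
      intro h
      have := congrArg Fin.val h
      simp only [first] at this
      omega
    have h2 : ∀ i, i ≠ first' → headSeg (d n : ℕ) (by omega) (Function.update ω.2 first c) i =
        headSeg (d n : ℕ) (by omega) ω.2 i := by
      intro i hi
      unfold headSeg
      rw [Function.update_of_ne]
      intro h
      refine hi (Fin.ext ?_)
      have := congrArg Fin.val h
      simpa [first, first'] using this
    have h3 : headSeg (d n : ℕ) (by omega) (Function.update ω.2 first c) first' = c :=
      Function.update_self _ _ _
    unfold blockProd
    simp only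
    rw [h1, ← Finset.prod_erase_mul _ _ (Finset.mem_univ first'), h3,
      Finset.prod_congr rfl fun i hi => by rw [h2 i (Finset.ne_of_mem_erase hi)]]
    ring
  · refine one_div_le_pairErr_pair_snd (dec n) (numBins_pos n hRx) (numBins_pos n hRy) ω.1 ?_
    intro h
    have := congrFun h first
    rw [Function.update_self, Function.update_self] at this
    exact hab this

end JointExponent

/-! ### The maximization over the tilting parameter -/

/-- The exponent `max_ρ (ρ R - Γ(ρ))` of a convex `Γ` with slope `h`: at the maximizer, `ρ (R - h)`
is the positive part of `R - h`, since an interior maximizer has `h = R`, and the maximizers `0` and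
`1` have `R ≤ h` and `h ≤ R`. -/
lemma exists_maximizer_of_subgradient {Γ h : ℝ → ℝ} (hΓ : ContinuousOn Γ (Set.Icc 0 1))
    (hh : ContinuousOn h (Set.Icc 0 1)) (hsub : ∀ ρ ∈ Set.Icc (0 : ℝ) 1, ∀ ρ' ∈ Set.Icc (0 : ℝ) 1,
      Γ ρ + (ρ' - ρ) * h ρ ≤ Γ ρ') (R : ℝ) :
    ∃ ρ ∈ Set.Icc (0 : ℝ) 1, (∀ ρ' ∈ Set.Icc (0 : ℝ) 1, ρ' * R - Γ ρ' ≤ ρ * R - Γ ρ) ∧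
      max (R - h ρ) 0 ≤ ρ * (R - h ρ) := by
  obtain ⟨ρ, hρ, hmax⟩ := isCompact_Icc.exists_isMaxOn (Set.nonempty_Icc.2 zero_le_one)
    (((continuousOn_id.mul continuousOn_const).sub hΓ :
      ContinuousOn (fun ρ : ℝ => ρ * R - Γ ρ) (Set.Icc 0 1)))
  have hmax' : ∀ ρ' ∈ Set.Icc (0 : ℝ) 1, ρ' * R - Γ ρ' ≤ ρ * R - Γ ρ := fun ρ' h' => hmax h'
  have key : ∀ ρ' ∈ Set.Icc (0 : ℝ) 1, (ρ' - ρ) * R ≤ (ρ' - ρ) * h ρ' := fun ρ' h' => by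
    linarith [hmax' ρ' h', hsub ρ' h' ρ hρ]
  have hup : ρ < 1 → R ≤ h ρ := fun h1 => by
    have hs : Set.Ioo ρ 1 ⊆ Set.Icc (0 : ℝ) 1 := fun t ht => ⟨hρ.1.trans ht.1.le, ht.2.le⟩
    have : (𝓝[Set.Ioo ρ 1] ρ).NeBot := left_nhdsWithin_Ioo_neBot h1
    refine ge_of_tendsto ((hh ρ hρ).mono hs) ?_
    filter_upwards [self_mem_nhdsWithin] with t ht
    exact le_of_mul_le_mul_left (key t (hs ht)) (sub_pos.2 ht.1)
  have hlow : 0 < ρ → h ρ ≤ R := fun h0 => by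
    have hs : Set.Ioo 0 ρ ⊆ Set.Icc (0 : ℝ) 1 := fun t ht => ⟨ht.1.le, ht.2.le.trans hρ.2⟩
    have : (𝓝[Set.Ioo 0 ρ] ρ).NeBot := right_nhdsWithin_Ioo_neBot h0
    refine le_of_tendsto ((hh ρ hρ).mono hs) ?_
    filter_upwards [self_mem_nhdsWithin] with t ht
    have h1 := key t (hs ht)
    have h2 : (ρ - t) * h t ≤ (ρ - t) * R := by linarith
    exact le_of_mul_le_mul_left h2 (sub_pos.2 ht.2)
  refine ⟨ρ, hρ, hmax', ?_⟩
  rcases hρ.2.lt_or_eq with h1 | h1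
  · have hu := hup h1
    rw [max_eq_right (by linarith)]
    rcases hρ.1.eq_or_lt with h0 | h0
    · rw [← h0, zero_mul]
    · have := hlow h0
      exact mul_nonneg h0.le (by linarith)
  · have := hlow (by linarith)
    rw [max_eq_left (by linarith), h1, one_mul]

section Mixture

variable {Z₁ Z₂ Z₃ B₁ B₂ B₃ : Type*} [Fintype Z₁] [Fintype Z₂] [Fintype Z₃] [Fintype B₁]
  [DecidableEq B₁] [Fintype B₂] [DecidableEq B₂] [Fintype B₃] [DecidableEq B₃]

/-- Gallager's function per letter of a block with head, middle and tail fractions `δ`, `1 - δ`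
and `δ`. -/
def mixGallager (π₁ : Z₁ → B₁) (π₂ : Z₂ → B₂) (π₃ : Z₃ → B₃) (p₁ : Z₁ → ℝ) (p₂ : Z₂ → ℝ)
    (p₃ : Z₃ → ℝ) (δ ρ : ℝ) : ℝ :=
  δ * gallagerFn π₁ p₁ ρ + (1 - δ) * gallagerFn π₂ p₂ ρ + δ * gallagerFn π₃ p₃ ρ

lemma relEnt_nonneg {q p : Z₁ → ℝ} (hq : q ∈ stdSimplex ℝ Z₁) (hp : p ∈ stdSimplex ℝ Z₁)
    (h : ∀ z, 0 < q z → 0 < p z) : 0 ≤ relEnt q p := by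
  have := le_gallagerFn (fun _ => ()) hp le_rfl hq h
  rw [gallagerFn_zero _ hp.2] at this
  linarith

lemma condEnt_tiltLaw_pos_iff (π : Z₁ → B₁) (π' : Z₁ → B₂) {p : Z₁ → ℝ}
    (hp : p ∈ stdSimplex ℝ Z₁) {ρ : ℝ} (hρ : 0 ≤ ρ) :
    0 < condEnt π' (tiltLaw π p ρ) ↔ 0 < condEnt π' p := by
  rw [condEnt_pos_iff π' (tiltLaw_mem π hp hρ).1, condEnt_pos_iff π' hp.1]
  simp only [tiltLaw_pos_iff π hp hρ]

/-- The exponent is attained at some `ρ`, and there the tilted laws make the divergence plus the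
excess of the rate over the entropy at most the exponent. -/
lemma exists_tilt_gallagerExp (π₁ : Z₁ → B₁) (π₂ : Z₂ → B₂) (π₃ : Z₃ → B₃) {p₁ : Z₁ → ℝ}
    {p₂ : Z₂ → ℝ} {p₃ : Z₃ → ℝ} (hp₁ : p₁ ∈ stdSimplex ℝ Z₁) (hp₂ : p₂ ∈ stdSimplex ℝ Z₂)
    (hp₃ : p₃ ∈ stdSimplex ℝ Z₃) {δ : ℝ} (hδ : δ ∈ Set.Icc (0 : ℝ) 1) {G : ℝ → ℝ}
    (hG : ∀ ρ, 0 ≤ ρ → ρ * G (1 / (1 + ρ)) = mixGallager π₁ π₂ π₃ p₁ p₂ p₃ δ ρ) (R : ℝ) :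
    ∃ ρ ∈ Set.Icc (0 : ℝ) 1, IsGreatest (gallagerSet G R) (gallagerExp G R) ∧
      gallagerExp G R = ρ * R - mixGallager π₁ π₂ π₃ p₁ p₂ p₃ δ ρ ∧
      δ * relEnt (tiltLaw π₁ p₁ ρ) p₁ + (1 - δ) * relEnt (tiltLaw π₂ p₂ ρ) p₂ +
          δ * relEnt (tiltLaw π₃ p₃ ρ) p₃ +
        max (R - (δ * condEnt π₁ (tiltLaw π₁ p₁ ρ) + (1 - δ) * condEnt π₂ (tiltLaw π₂ p₂ ρ) +
          δ * condEnt π₃ (tiltLaw π₃ p₃ ρ))) 0 ≤ gallagerExp G R := by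
  have hδ' : 0 ≤ 1 - δ := sub_nonneg.2 hδ.2
  have hI : Set.Icc (0 : ℝ) 1 ⊆ Set.Ici 0 := fun _ h => h.1
  obtain ⟨ρ, hρ, hmax, hle⟩ := exists_maximizer_of_subgradient
    (Γ := mixGallager π₁ π₂ π₃ p₁ p₂ p₃ δ)
    (h := fun ρ => δ * condEnt π₁ (tiltLaw π₁ p₁ ρ) + (1 - δ) * condEnt π₂ (tiltLaw π₂ p₂ ρ) +
      δ * condEnt π₃ (tiltLaw π₃ p₃ ρ))
    (((continuousOn_const.mul ((continuousOn_gallagerFn π₁ hp₁).mono hI)).add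
      (continuousOn_const.mul ((continuousOn_gallagerFn π₂ hp₂).mono hI))).add
      (continuousOn_const.mul ((continuousOn_gallagerFn π₃ hp₃).mono hI)))
    (((continuousOn_const.mul ((continuousOn_condEnt_tiltLaw π₁ hp₁).mono hI)).add
      (continuousOn_const.mul ((continuousOn_condEnt_tiltLaw π₂ hp₂).mono hI))).add
      (continuousOn_const.mul ((continuousOn_condEnt_tiltLaw π₃ hp₃).mono hI)))
    (fun ρ h ρ' h' => by
      have e₁ := mul_le_mul_of_nonneg_left (gallagerFn_subgradient π₁ hp₁ h.1 h'.1) hδ.1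
      have e₂ := mul_le_mul_of_nonneg_left (gallagerFn_subgradient π₂ hp₂ h.1 h'.1) hδ'
      have e₃ := mul_le_mul_of_nonneg_left (gallagerFn_subgradient π₃ hp₃ h.1 h'.1) hδ.1
      unfold mixGallager
      linarith) R
  have hgr : IsGreatest (gallagerSet G R) (ρ * R - mixGallager π₁ π₂ π₃ p₁ p₂ p₃ δ ρ) := by
    constructor
    · exact ⟨ρ, hρ, by rw [← hG ρ hρ.1]; ring⟩
    · rintro _ ⟨ρ', hρ', rfl⟩
      refine le_trans (le_of_eq ?_) (hmax ρ' hρ')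
      rw [← hG ρ' hρ'.1]
      ring
  have hval : gallagerExp G R = ρ * R - mixGallager π₁ π₂ π₃ p₁ p₂ p₃ δ ρ := hgr.csSup_eq
  refine ⟨ρ, hρ, by rw [hval]; exact hgr, hval, ?_⟩
  rw [hval]
  unfold mixGallager
  rw [gallagerFn_eq π₁ hp₁ hρ.1, gallagerFn_eq π₂ hp₂ hρ.1, gallagerFn_eq π₃ hp₃ hρ.1]
  linarith

end Mixture

section Source

variable {X Y : Type*} [Fintype X] [Fintype Y] [DecidableEq X] [DecidableEq Y]

lemma mul_mixX {P : X × Y → ℝ} (hP : P ∈ stdSimplex ℝ (X × Y)) (δ : ℝ) {ρ : ℝ} (hρ : 0 ≤ ρ) :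
    ρ * mixX P δ (1 / (1 + ρ)) =
      mixGallager id Prod.snd (fun _ => ()) (margSnd P) P (margFst P) δ ρ := by
  unfold mixX mixGallager
  rw [gallagerFn_id (margSnd_mem hP) hρ, ← mul_condRenyi hP hρ, ← mul_renyi (margFst_mem hP) hρ]
  ring

lemma mul_mixY {P : X × Y → ℝ} (hP : P ∈ stdSimplex ℝ (X × Y)) (δ : ℝ) {ρ : ℝ} (hρ : 0 ≤ ρ) :
    ρ * mixY P δ (1 / (1 + ρ)) =
      mixGallager (fun _ => ()) Prod.fst id (margSnd P) P (margFst P) δ ρ := by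
  unfold mixY mixGallager
  rw [gallagerFn_id (margFst_mem hP) hρ, ← mul_condRenyi_swapLaw hP hρ,
    ← mul_renyi (margSnd_mem hP) hρ]
  ring

lemma mul_mixXY {P : X × Y → ℝ} (hP : P ∈ stdSimplex ℝ (X × Y)) (δ : ℝ) {ρ : ℝ} (hρ : 0 ≤ ρ) :
    ρ * mixXY P δ (1 / (1 + ρ)) = mixGallager (fun _ => ()) (fun _ => ()) (fun _ => ())
      (margSnd P) P (margFst P) δ ρ := by
  unfold mixXY mixGallager
  rw [← mul_renyi (margFst_mem hP) hρ, ← mul_renyi (margSnd_mem hP) hρ, ← mul_renyi hP hρ]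
  ring

lemma delay_limit_mem {d : ∀ n : ℕ, Fin (n + 1)} {δ : ℝ}
    (hd : Tendsto (fun n : ℕ => ((d n : ℕ) : ℝ) / (n : ℝ)) atTop (𝓝 δ)) : δ ∈ Set.Icc (0 : ℝ) 1 :=
  ⟨ge_of_tendsto' hd fun n => by positivity, le_of_tendsto' hd fun n =>
    div_le_one_of_le₀ (by exact_mod_cast Nat.lt_succ_iff.1 (d n).2) (Nat.cast_nonneg n)⟩

/-! ### The exponent cannot exceed any of the three candidates -/

lemma expLowerBound_fst {p₁ q₁ : Y → ℝ} {p₂ q₂ : X × Y → ℝ} {p₃ q₃ : X → ℝ}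
    (hp₁ : ∀ z, 0 ≤ p₁ z) (hp₂ : ∀ z, 0 ≤ p₂ z) (hp₃ : ∀ z, 0 ≤ p₃ z) (hq₁ : q₁ ∈ stdSimplex ℝ Y)
    (hq₂ : q₂ ∈ stdSimplex ℝ (X × Y)) (hq₃ : q₃ ∈ stdSimplex ℝ X) (h₁ : ∀ z, 0 < q₁ z → 0 < p₁ z)
    (h₂ : ∀ z, 0 < q₂ z → 0 < p₂ z) (h₃ : ∀ z, 0 < q₃ z → 0 < p₃ z)
    {d : ∀ n : ℕ, Fin (n + 1)} {δ : ℝ}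
    (hd : Tendsto (fun n : ℕ => ((d n : ℕ) : ℝ) / (n : ℝ)) atTop (𝓝 δ)) {Rx Ry : ℝ}
    (hRx : 0 ≤ Rx) (hRy : 0 ≤ Ry) (dec : ∀ n, Decoder X Y n (numBins n Rx) (numBins n Ry))
    (hpos : 0 < δ * condEnt id q₁ + (1 - δ) * condEnt Prod.snd q₂ +
      δ * condEnt (fun _ => ()) q₃) :
    ExpLowerBound (fun n => ∑ ω, blockProd p₁ p₂ p₃ (d n) ω * pairErr (dec n) ω)
      (δ * relEnt q₁ p₁ + (1 - δ) * relEnt q₂ p₂ + δ * relEnt q₃ p₃ +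
        max (Rx - (δ * condEnt id q₁ + (1 - δ) * condEnt Prod.snd q₂ +
          δ * condEnt (fun _ => ()) q₃)) 0) :=
  expLowerBound_of_fibers id Prod.snd (fun _ => ()) hp₁ hp₂ hp₃ hq₁ hq₂ hq₃ h₁ h₂ h₃ hd
    (fun _ => Prod.snd) (fun n => sameSide_snd_iff (d n)) (fun n => numBins_pos n hRx)
    (fun n => numBins_le n Rx) (fun n => pairErr (dec n)) (fun n => pairErr_nonneg (dec n))
    (fun n S y hS hN => mul_min_le_sum_pairErr_fst (dec n) (numBins_pos n hRx) (numBins_pos n hRy)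
      S y hS hN) hpos

lemma expLowerBound_snd {p₁ q₁ : Y → ℝ} {p₂ q₂ : X × Y → ℝ} {p₃ q₃ : X → ℝ}
    (hp₁ : ∀ z, 0 ≤ p₁ z) (hp₂ : ∀ z, 0 ≤ p₂ z) (hp₃ : ∀ z, 0 ≤ p₃ z) (hq₁ : q₁ ∈ stdSimplex ℝ Y)
    (hq₂ : q₂ ∈ stdSimplex ℝ (X × Y)) (hq₃ : q₃ ∈ stdSimplex ℝ X) (h₁ : ∀ z, 0 < q₁ z → 0 < p₁ z)
    (h₂ : ∀ z, 0 < q₂ z → 0 < p₂ z) (h₃ : ∀ z, 0 < q₃ z → 0 < p₃ z)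
    {d : ∀ n : ℕ, Fin (n + 1)} {δ : ℝ}
    (hd : Tendsto (fun n : ℕ => ((d n : ℕ) : ℝ) / (n : ℝ)) atTop (𝓝 δ)) {Rx Ry : ℝ}
    (hRx : 0 ≤ Rx) (hRy : 0 ≤ Ry) (dec : ∀ n, Decoder X Y n (numBins n Rx) (numBins n Ry))
    (hpos : 0 < δ * condEnt (fun _ => ()) q₁ + (1 - δ) * condEnt Prod.fst q₂ +
      δ * condEnt id q₃) :
    ExpLowerBound (fun n => ∑ ω, blockProd p₁ p₂ p₃ (d n) ω * pairErr (dec n) ω)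
      (δ * relEnt q₁ p₁ + (1 - δ) * relEnt q₂ p₂ + δ * relEnt q₃ p₃ +
        max (Ry - (δ * condEnt (fun _ => ()) q₁ + (1 - δ) * condEnt Prod.fst q₂ +
          δ * condEnt id q₃)) 0) :=
  expLowerBound_of_fibers (fun _ => ()) Prod.fst id hp₁ hp₂ hp₃ hq₁ hq₂ hq₃ h₁ h₂ h₃ hd
    (fun _ => Prod.fst) (fun n => sameSide_fst_iff (d n)) (fun n => numBins_pos n hRy)
    (fun n => numBins_le n Ry) (fun n => pairErr (dec n)) (fun n => pairErr_nonneg (dec n))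
    (fun n S x hS hN => mul_min_le_sum_pairErr_snd (dec n) (numBins_pos n hRx) (numBins_pos n hRy)
      S x hS hN) hpos

variable {P : X × Y → ℝ} {d : ∀ n : ℕ, Fin (n + 1)} {δ Rx Ry : ℝ}

/-- If the conditional entropy rate vanishes then `δ = 0` and `X` is a function of `Y`; only the
unpaired letters of `X` can then be mistaken, and they cost the full rate. -/
lemma expLowerBound_gallagerExp_mixX (hP : P ∈ stdSimplex ℝ (X × Y))
    (hd : Tendsto (fun n : ℕ => ((d n : ℕ) : ℝ) / (n : ℝ)) atTop (𝓝 δ))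
    (hX : 0 < entropy (margFst P)) (hnd : (∀ᶠ n in atTop, 1 ≤ (d n : ℕ)) ∨ 0 < condEntropy P)
    (hRx : 0 ≤ Rx) (hRy : 0 ≤ Ry) (dec : ∀ n, Decoder X Y n (numBins n Rx) (numBins n Ry)) :
    ExpLowerBound (fun n => errorProb P (d n) (dec n)) (gallagerExp (mixX P δ) Rx) := by
  simp only [errorProb_eq_sum_pairErr]
  have hPX := margFst_mem hP
  have hPY := margSnd_mem hP
  have hδ := delay_limit_mem hd
  obtain ⟨ρ, hρ, -, -, hE⟩ := exists_tilt_gallagerExp id Prod.snd (fun _ => ()) hPY hP hPX hδ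
    (fun ρ hρ => mul_mixX hP δ hρ) Rx
  have hq₁ := tiltLaw_mem id hPY hρ.1
  have hq₂ := tiltLaw_mem Prod.snd hP hρ.1
  have hq₃ := tiltLaw_mem (fun _ => ()) hPX hρ.1
  have h₁ := fun z => (tiltLaw_pos_iff id hPY hρ.1 z).1
  have h₂ := fun z => (tiltLaw_pos_iff Prod.snd hP hρ.1 z).1
  have h₃ := fun z => (tiltLaw_pos_iff (fun _ => ()) hPX hρ.1 z).1
  by_cases hpos : 0 < δ * condEnt id (tiltLaw id (margSnd P) ρ) +
      (1 - δ) * condEnt Prod.snd (tiltLaw Prod.snd P ρ) +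
      δ * condEnt (fun _ => ()) (tiltLaw (fun _ => ()) (margFst P) ρ)
  · exact (expLowerBound_fst hPY.1 hP.1 hPX.1 hq₁ hq₂ hq₃ h₁ h₂ h₃ hd hRx hRy dec hpos).mono hE
  · have n₁ := mul_nonneg hδ.1 (condEnt_nonneg id hq₁.1)
    have n₂ := mul_nonneg (sub_nonneg.2 hδ.2) (condEnt_nonneg Prod.snd hq₂.1)
    have n₃ : 0 < condEnt (fun _ => ()) (tiltLaw (fun _ => ()) (margFst P) ρ) := by
      rw [condEnt_tiltLaw_pos_iff _ _ hPX hρ.1, ← entropy_eq_condEnt hPX.2]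
      exact hX
    have hδ0 : δ = 0 := by
      refine le_antisymm ?_ hδ.1
      by_contra! h
      have := mul_pos h n₃
      exact hpos (by linarith)
    have hcond : ¬ 0 < condEntropy P := by
      rw [condEntropy_eq_condEnt, ← condEnt_tiltLaw_pos_iff Prod.snd Prod.snd hP hρ.1]
      intro h
      refine hpos ?_
      rw [hδ0]
      linarith
    have := expLowerBound_unpaired_fst hPY hP hPX hX (hnd.resolve_right hcond) hRx hRy dec
    refine this.mono (le_trans ?_ hE)
    have r₁ := mul_nonneg hδ.1 (relEnt_nonneg hq₁ hPY h₁)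
    have r₂ := mul_nonneg (sub_nonneg.2 hδ.2) (relEnt_nonneg hq₂ hP h₂)
    have r₃ := mul_nonneg hδ.1 (relEnt_nonneg hq₃ hPX h₃)
    refine le_trans ?_ (add_le_add_right (le_max_left _ _) _)
    linarith

lemma expLowerBound_gallagerExp_mixY (hP : P ∈ stdSimplex ℝ (X × Y))
    (hd : Tendsto (fun n : ℕ => ((d n : ℕ) : ℝ) / (n : ℝ)) atTop (𝓝 δ))
    (hY : 0 < entropy (margSnd P))
    (hnd : (∀ᶠ n in atTop, 1 ≤ (d n : ℕ)) ∨ 0 < condEntropy (swapLaw P))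
    (hRx : 0 ≤ Rx) (hRy : 0 ≤ Ry) (dec : ∀ n, Decoder X Y n (numBins n Rx) (numBins n Ry)) :
    ExpLowerBound (fun n => errorProb P (d n) (dec n)) (gallagerExp (mixY P δ) Ry) := by
  simp only [errorProb_eq_sum_pairErr]
  have hPX := margFst_mem hP
  have hPY := margSnd_mem hP
  have hδ := delay_limit_mem hd
  obtain ⟨ρ, hρ, -, -, hE⟩ := exists_tilt_gallagerExp (fun _ => ()) Prod.fst id hPY hP hPX hδ
    (fun ρ hρ => mul_mixY hP δ hρ) Ry
  have hq₁ := tiltLaw_mem (fun _ => ()) hPY hρ.1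
  have hq₂ := tiltLaw_mem Prod.fst hP hρ.1
  have hq₃ := tiltLaw_mem id hPX hρ.1
  have h₁ := fun z => (tiltLaw_pos_iff (fun _ => ()) hPY hρ.1 z).1
  have h₂ := fun z => (tiltLaw_pos_iff Prod.fst hP hρ.1 z).1
  have h₃ := fun z => (tiltLaw_pos_iff id hPX hρ.1 z).1
  by_cases hpos : 0 < δ * condEnt (fun _ => ()) (tiltLaw (fun _ => ()) (margSnd P) ρ) +
      (1 - δ) * condEnt Prod.fst (tiltLaw Prod.fst P ρ) +
      δ * condEnt id (tiltLaw id (margFst P) ρ)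
  · exact (expLowerBound_snd hPY.1 hP.1 hPX.1 hq₁ hq₂ hq₃ h₁ h₂ h₃ hd hRx hRy dec hpos).mono hE
  · have n₃ := mul_nonneg hδ.1 (condEnt_nonneg id hq₃.1)
    have n₂ := mul_nonneg (sub_nonneg.2 hδ.2) (condEnt_nonneg Prod.fst hq₂.1)
    have n₁ : 0 < condEnt (fun _ => ()) (tiltLaw (fun _ => ()) (margSnd P) ρ) := by
      rw [condEnt_tiltLaw_pos_iff _ _ hPY hρ.1, ← entropy_eq_condEnt hPY.2]
      exact hY
    have hδ0 : δ = 0 := by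
      refine le_antisymm ?_ hδ.1
      by_contra! h
      have := mul_pos h n₁
      exact hpos (by linarith)
    have hcond : ¬ 0 < condEntropy (swapLaw P) := by
      rw [condEntropy_swapLaw_eq_condEnt, ← condEnt_tiltLaw_pos_iff Prod.fst Prod.fst hP hρ.1]
      intro h
      refine hpos ?_
      rw [hδ0]
      linarith
    have := expLowerBound_unpaired_snd hPY hP hPX hY (hnd.resolve_right hcond) hRx hRy dec
    refine this.mono (le_trans ?_ hE)
    have r₁ := mul_nonneg hδ.1 (relEnt_nonneg hq₁ hPY h₁)
    have r₂ := mul_nonneg (sub_nonneg.2 hδ.2) (relEnt_nonneg hq₂ hP h₂)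
    have r₃ := mul_nonneg hδ.1 (relEnt_nonneg hq₃ hPX h₃)
    refine le_trans ?_ (add_le_add_right (le_max_left _ _) _)
    linarith

lemma condEnt_const_pos (hP : P ∈ stdSimplex ℝ (X × Y)) (hX : 0 < entropy (margFst P)) :
    0 < condEnt (fun _ => ()) P := by
  obtain ⟨a, b, hab, ha, hb⟩ := exists_two_letters (margFst_mem hP) hX
  obtain ⟨y, -, hy⟩ := Finset.exists_lt_of_sum_lt (by simpa [margFst] using ha :
    ∑ _y : Y, (0 : ℝ) < ∑ y, P (a, y))
  obtain ⟨y', -, hy'⟩ := Finset.exists_lt_of_sum_lt (by simpa [margFst] using hb :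
    ∑ _y : Y, (0 : ℝ) < ∑ y, P (b, y))
  exact (condEnt_pos_iff _ hP.1).2
    ⟨(a, y), (b, y'), fun h => hab (Prod.ext_iff.1 h).1, rfl, hy, hy'⟩

/-- Under the law that is tilted for errors in both blocks, a rate below the conditional entropy
rate of its block already makes errors in that block alone likely; otherwise pairs that agree in
one block are rare and the competitors differ in both blocks. -/
lemma expLowerBound_gallagerExp_mixXY (hP : P ∈ stdSimplex ℝ (X × Y))
    (hd : Tendsto (fun n : ℕ => ((d n : ℕ) : ℝ) / (n : ℝ)) atTop (𝓝 δ))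
    (hX : 0 < entropy (margFst P)) (hRx : 0 ≤ Rx) (hRy : 0 ≤ Ry)
    (dec : ∀ n, Decoder X Y n (numBins n Rx) (numBins n Ry)) :
    ExpLowerBound (fun n => errorProb P (d n) (dec n)) (gallagerExp (mixXY P δ) (Rx + Ry)) := by
  simp only [errorProb_eq_sum_pairErr]
  have hPX := margFst_mem hP
  have hPY := margSnd_mem hP
  have hδ := delay_limit_mem hd
  have hδ' := sub_nonneg.2 hδ.2
  obtain ⟨ρ, hρ, -, -, hE⟩ := exists_tilt_gallagerExp (fun _ => ()) (fun _ => ()) (fun _ => ())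
    hPY hP hPX hδ (fun ρ hρ => mul_mixXY hP δ hρ) (Rx + Ry)
  have hq₁ := tiltLaw_mem (fun _ => ()) hPY hρ.1
  have hq₂ := tiltLaw_mem (fun _ => ()) hP hρ.1
  have hq₃ := tiltLaw_mem (fun _ => ()) hPX hρ.1
  have h₁ := fun z => (tiltLaw_pos_iff (fun _ => ()) hPY hρ.1 z).1
  have h₂ := fun z => (tiltLaw_pos_iff (fun _ => ()) hP hρ.1 z).1
  have h₃ := fun z => (tiltLaw_pos_iff (fun _ => ()) hPX hρ.1 z).1
  have hP₂ : 0 < condEnt (fun _ => ()) (tiltLaw (fun _ => ()) P ρ) := by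
    rw [condEnt_tiltLaw_pos_iff _ _ hP hρ.1]
    exact condEnt_const_pos hP hX
  have hP₃ : 0 < condEnt (fun _ => ()) (tiltLaw (fun _ => ()) (margFst P) ρ) := by
    rw [condEnt_tiltLaw_pos_iff _ _ hPX hρ.1, ← entropy_eq_condEnt hPX.2]
    exact hX
  have hN₁ := condEnt_nonneg (fun _ => ()) hq₁.1
  revert hE hq₁ hq₂ hq₃ h₁ h₂ h₃ hP₂ hP₃ hN₁
  generalize tiltLaw (fun _ => ()) (margSnd P) ρ = q₁
  generalize tiltLaw (fun _ => ()) P ρ = q₂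
  generalize tiltLaw (fun _ => ()) (margFst P) ρ = q₃
  intro hE hq₁ hq₂ hq₃ h₁ h₂ h₃ hP₂ hP₃ hN₁
  rcases lt_or_ge Rx (δ * condEnt id q₁ + (1 - δ) * condEnt Prod.snd q₂ +
      δ * condEnt (fun _ => ()) q₃) with hx | hx
  · have h := expLowerBound_fst hPY.1 hP.1 hPX.1 hq₁ hq₂ hq₃ h₁ h₂ h₃ hd hRx hRy dec
      (hRx.trans_lt hx)
    rw [max_eq_right (by linarith)] at h
    exact h.mono (le_trans (add_le_add_right (le_max_right _ _) _) hE)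
  rcases lt_or_ge Ry (δ * condEnt (fun _ => ()) q₁ + (1 - δ) * condEnt Prod.fst q₂ +
      δ * condEnt id q₃) with hy | hy
  · have h := expLowerBound_snd hPY.1 hP.1 hPX.1 hq₁ hq₂ hq₃ h₁ h₂ h₃ hd hRx hRy dec
      (hRy.trans_lt hy)
    rw [max_eq_right (by linarith)] at h
    exact h.mono (le_trans (add_le_add_right (le_max_right _ _) _) hE)
  refine (expLowerBound_joint_of_le hPY.1 hP.1 hPX.1 hq₁ hq₂ hq₃ h₁ h₂ h₃ hd hRx hRy dec hx hy
    ?_).mono hE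
  have n₁ := mul_nonneg hδ.1 hN₁
  rcases hδ.1.eq_or_lt with h0 | h0
  · rw [← h0]
    linarith
  · have n₂ := mul_nonneg hδ' hP₂.le
    have n₃ := mul_pos h0 hP₃
    linarith

end Source

/-! ### Matching upper bound and the exponents -/

lemma eventually_mul_pow_le_two_rpow (c : ℝ) (k : ℕ) {ε : ℝ} (hε : 0 < ε) :
    ∀ᶠ n : ℕ in atTop, c * ((n : ℝ) + 1) ^ k ≤ (2 : ℝ) ^ ((n : ℝ) * ε) := by
  have hr1 : (2 : ℝ) ^ (-ε) < 1 := Real.rpow_lt_one_of_one_lt_of_neg one_lt_two (by linarith)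
  have hr0 : 0 < (2 : ℝ) ^ (-ε) := Real.rpow_pos_of_pos two_pos _
  have h := (tendsto_pow_const_mul_const_pow_of_abs_lt_one k
    (by rwa [abs_of_pos hr0] : |(2 : ℝ) ^ (-ε)| < 1)).const_mul (|c| * 2 ^ k)
  rw [mul_zero] at h
  filter_upwards [h.eventually (gt_mem_nhds one_pos), eventually_gt_atTop 0] with n hn hn0
  have hn1 : (1 : ℝ) ≤ n := by exact_mod_cast hn0
  have hpow : ((2 : ℝ) ^ (-ε)) ^ n = ((2 : ℝ) ^ ((n : ℝ) * ε))⁻¹ := by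
    rw [← Real.rpow_natCast, ← Real.rpow_mul two_pos.le, ← Real.rpow_neg two_pos.le]
    congr 1
    ring
  rw [hpow, ← mul_assoc, ← div_eq_mul_inv, div_lt_one (Real.rpow_pos_of_pos two_pos _)] at hn
  refine le_trans ?_ hn.le
  calc c * ((n : ℝ) + 1) ^ k ≤ |c| * (2 * n) ^ k := by
        refine mul_le_mul (le_abs_self c) ?_ (by positivity) (abs_nonneg c)
        exact pow_le_pow_left₀ (by positivity) (by linarith) k
    _ = _ := by rw [mul_pow]; ring

lemma hasErrorExponent_of_bounds {pe : ℕ → ℝ} {E : ℝ} (hlow : ExpLowerBound pe E)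
    (hup : ∀ ε : ℝ, 0 < ε → ∀ᶠ n : ℕ in atTop, pe n ≤ (2 : ℝ) ^ (-((n : ℝ) * (E - ε)))) :
    HasErrorExponent pe E := by
  have hpos : ∀ᶠ n in atTop, 0 < pe n := by
    filter_upwards [hlow 1 one_pos] with n hn
    exact (Real.rpow_pos_of_pos two_pos _).trans_le hn
  refine ⟨hpos, Metric.tendsto_nhds.2 fun ε hε => ?_⟩
  filter_upwards [hpos, hlow (ε / 2) (half_pos hε), hup (ε / 2) (half_pos hε),
    eventually_gt_atTop 0] with n h0 h1 h2 hn
  have hn' : (0 : ℝ) < n := by exact_mod_cast hn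
  rw [← Real.le_logb_iff_rpow_le one_lt_two h0] at h1
  rw [← Real.logb_le_iff_le_rpow one_lt_two h0] at h2
  have h3 : -Real.logb 2 (pe n) / n ≤ E + ε / 2 := by
    rw [div_le_iff₀ hn']
    linarith
  have h4 : E - ε / 2 ≤ -Real.logb 2 (pe n) / n := by
    rw [le_div_iff₀ hn']
    linarith
  rw [Real.dist_eq, abs_lt]
  constructor <;> linarith

section Exponent

variable {X Y : Type*} [Fintype X] [Fintype Y] [DecidableEq X] [DecidableEq Y]

/-- The minimum of the exponents of the three kinds of errors: in the first block only, in the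
second block only, and in both. -/
def minExponent (P : X × Y → ℝ) (δ Rx Ry : ℝ) : ℝ :=
  min (gallagerExp (mixX P δ) Rx)
    (min (gallagerExp (mixY P δ) Ry) (gallagerExp (mixXY P δ) (Rx + Ry)))

variable {P : X × Y → ℝ} {d : ∀ n : ℕ, Fin (n + 1)} {δ Rx Ry : ℝ}

lemma errorProb_universal_le_exponent (hP : P ∈ stdSimplex ℝ (X × Y))
    (hd : Tendsto (fun n : ℕ => ((d n : ℕ) : ℝ) / (n : ℝ)) atTop (𝓝 δ)) (hRx : 0 ≤ Rx)
    (hRy : 0 ≤ Ry) {dec : ∀ n, Decoder X Y n (numBins n Rx) (numBins n Ry)}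
    (hdec : ∀ n, IsMetricDecoder (qMetric Rx Ry) (dec n)) {ε : ℝ} (hε : 0 < ε) :
    ∀ᶠ n : ℕ in atTop, errorProb P (d n) (dec n) ≤
      (2 : ℝ) ^ (-((n : ℝ) * (minExponent P δ Rx Ry - ε))) := by
  have hPX := margFst_mem hP
  have hPY := margSnd_mem hP
  have hδ := delay_limit_mem hd
  obtain ⟨ρ₁, h₁, -, e₁, -⟩ := exists_tilt_gallagerExp id Prod.snd (fun _ => ()) hPY hP hPX hδ
    (fun ρ hρ => mul_mixX hP δ hρ) Rx
  obtain ⟨ρ₂, h₂, -, e₂, -⟩ := exists_tilt_gallagerExp (fun _ => ()) Prod.fst id hPY hP hPX hδ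
    (fun ρ hρ => mul_mixY hP δ hρ) Ry
  obtain ⟨ρ₃, h₃, -, e₃, -⟩ := exists_tilt_gallagerExp (fun _ => ()) (fun _ => ()) (fun _ => ())
    hPY hP hPX hδ (fun ρ hρ => mul_mixXY hP δ hρ) (Rx + Ry)
  have m₁ : minExponent P δ Rx Ry ≤ gallagerExp (mixX P δ) Rx := min_le_left _ _
  have m₂ : minExponent P δ Rx Ry ≤ gallagerExp (mixY P δ) Ry :=
    (min_le_right _ _).trans (min_le_left _ _)
  have m₃ : minExponent P δ Rx Ry ≤ gallagerExp (mixXY P δ) (Rx + Ry) :=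
    (min_le_right _ _).trans (min_le_right _ _)
  unfold mixGallager at e₁ e₂ e₃
  filter_upwards [eventually_blockMean_near hd (gallagerFn id (margSnd P) ρ₁)
      (gallagerFn Prod.snd P ρ₁) (gallagerFn (fun _ => ()) (margFst P) ρ₁) (half_pos hε),
    eventually_blockMean_near hd (gallagerFn (fun _ => ()) (margSnd P) ρ₂)
      (gallagerFn Prod.fst P ρ₂) (gallagerFn id (margFst P) ρ₂) (half_pos hε),
    eventually_blockMean_near hd (gallagerFn (fun _ => ()) (margSnd P) ρ₃)
      (gallagerFn (fun _ => ()) P ρ₃) (gallagerFn (fun _ => ()) (margFst P) ρ₃) (half_pos hε),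
    eventually_mul_pow_le_two_rpow 24 (polyDeg X Y) (half_pos hε)] with n b₁ b₂ b₃ hpoly
  have hn0 : (0 : ℝ) ≤ n := Nat.cast_nonneg n
  have hterm : ∀ {b m ρ R E : ℝ}, b ≤ n * (m + ε / 2) → E = ρ * R - m →
      minExponent P δ Rx Ry ≤ E →
      (2 : ℝ) ^ (b - ρ * (n * R)) ≤ (2 : ℝ) ^ (-((n : ℝ) * (minExponent P δ Rx Ry - ε / 2))) := by
    intro b m ρ R E hb hE hm
    refine Real.rpow_le_rpow_of_exponent_le one_le_two ?_
    have := mul_le_mul_of_nonneg_left hm hn0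
    rw [hE] at this
    linarith
  refine (errorProb_universal_le hP (d n) hRx hRy (hdec n) h₁ h₂ h₃).trans ?_
  calc _ ≤ 8 * ((n : ℝ) + 1) ^ polyDeg X Y *
        ((2 : ℝ) ^ (-((n : ℝ) * (minExponent P δ Rx Ry - ε / 2))) +
          (2 : ℝ) ^ (-((n : ℝ) * (minExponent P δ Rx Ry - ε / 2))) +
          (2 : ℝ) ^ (-((n : ℝ) * (minExponent P δ Rx Ry - ε / 2)))) := by
        refine mul_le_mul_of_nonneg_left ?_ (by positivity)
        exact add_le_add (add_le_add (hterm b₁.2 e₁ m₁) (hterm b₂.2 e₂ m₂)) (hterm b₃.2 e₃ m₃)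
    _ = 24 * ((n : ℝ) + 1) ^ polyDeg X Y *
        (2 : ℝ) ^ (-((n : ℝ) * (minExponent P δ Rx Ry - ε / 2))) := by ring
    _ ≤ (2 : ℝ) ^ ((n : ℝ) * (ε / 2)) *
        (2 : ℝ) ^ (-((n : ℝ) * (minExponent P δ Rx Ry - ε / 2))) :=
        mul_le_mul_of_nonneg_right hpoly (Real.rpow_pos_of_pos two_pos _).le
    _ = _ := by
        rw [← Real.rpow_add two_pos]
        congr 1
        ring

/-- The lower bound holds for every sequence of decoders. -/
lemma expLowerBound_minExponent (hP : P ∈ stdSimplex ℝ (X × Y))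
    (hd : Tendsto (fun n : ℕ => ((d n : ℕ) : ℝ) / (n : ℝ)) atTop (𝓝 δ))
    (hX : 0 < entropy (margFst P)) (hY : 0 < entropy (margSnd P))
    (hnd : (∀ᶠ n in atTop, 1 ≤ (d n : ℕ)) ∨ (0 < condEntropy P ∧ 0 < condEntropy (swapLaw P)))
    (hRx : 0 ≤ Rx) (hRy : 0 ≤ Ry) (dec : ∀ n, Decoder X Y n (numBins n Rx) (numBins n Ry)) :
    ExpLowerBound (fun n => errorProb P (d n) (dec n)) (minExponent P δ Rx Ry) := by
  unfold minExponent
  rcases min_choice (gallagerExp (mixX P δ) Rx)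
    (min (gallagerExp (mixY P δ) Ry) (gallagerExp (mixXY P δ) (Rx + Ry))) with h | h <;> rw [h]
  · exact expLowerBound_gallagerExp_mixX hP hd hX (hnd.imp_right And.left) hRx hRy dec
  rcases min_choice (gallagerExp (mixY P δ) Ry) (gallagerExp (mixXY P δ) (Rx + Ry)) with h | h <;>
    rw [h]
  · exact expLowerBound_gallagerExp_mixY hP hd hY (hnd.imp_right And.right) hRx hRy dec
  · exact expLowerBound_gallagerExp_mixXY hP hd hX hRx hRy dec

lemma errorProb_map_le (hP : P ∈ stdSimplex ℝ (X × Y)) {n Mx My : ℕ} (k : Fin (n + 1))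
    {dec : Decoder X Y n Mx My} (hdec : IsMAPDecoder P k dec) (dec' : Decoder X Y n Mx My) :
    errorProb P k dec ≤ errorProb P k dec' := by
  rw [errorProb_eq_sum_pairErr, errorProb_eq_sum_pairErr]
  exact sum_mul_pairErr_le_of_maximizer dec dec' (P := blockProb P k) (fun x y =>
    blockProd_nonneg (margSnd_mem hP).1 hP.1 (margFst_mem hP).1 k (x, y)) hdec

end Exponent

/-! ### Rates with a prescribed exponent -/

section Threshold

variable {G : ℝ → ℝ} {E : ℝ}

lemma div_one_add_eq {s : ℝ} (hs : 0 < s) : s / (1 + s) = 1 / (1 + 1 / s) := by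
  field_simp
  ring

lemma nonneg_of_mem_threshold (hG : ∀ ρ, 0 ≤ ρ → 0 ≤ ρ * G (1 / (1 + ρ))) (hE : 0 < E) :
    ∀ r ∈ (fun s : ℝ => s * E + G (s / (1 + s))) '' Set.Ici 1, 0 ≤ r := by
  rintro _ ⟨s, hs, rfl⟩
  have hs0 : (0 : ℝ) < s := one_pos.trans_le hs
  have h := hG (1 / s) (by positivity)
  rw [← div_one_add_eq hs0] at h
  have := nonneg_of_mul_nonneg_right h (by positivity : 0 < 1 / s)
  have := mul_pos hs0 hE
  simp only
  linarith

lemma rateThreshold_nonneg (hG : ∀ ρ, 0 ≤ ρ → 0 ≤ ρ * G (1 / (1 + ρ))) (hE : 0 < E) :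
    0 ≤ rateThreshold G E :=
  Real.sInf_nonneg (nonneg_of_mem_threshold hG hE)

/-- The substitution `s = 1 / ρ` turns the condition on the exponent into one on the rate. -/
lemma le_gallagerExp_iff (hG : ∀ ρ, 0 ≤ ρ → 0 ≤ ρ * G (1 / (1 + ρ))) (hE : 0 < E) {R : ℝ}
    (hR : IsGreatest (gallagerSet G R) (gallagerExp G R)) :
    E ≤ gallagerExp G R ↔ rateThreshold G E ≤ R := by
  constructor
  · intro h
    obtain ⟨ρ, hρ, hval⟩ := hR.1
    simp only at hval
    have hρ0 : 0 < ρ := by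
      rcases hρ.1.eq_or_lt with h0 | h0
      · rw [← h0, zero_mul] at hval
        linarith
      · exact h0
    refine (csInf_le ⟨0, nonneg_of_mem_threshold hG hE⟩
      ⟨1 / ρ, (one_le_div hρ0).2 hρ.2, rfl⟩).trans ?_
    simp only
    rw [div_one_add_eq (by positivity), one_div_one_div]
    have : 1 / ρ * E ≤ R - G (1 / (1 + ρ)) := by
      rw [one_div, inv_mul_le_iff₀ hρ0]
      linarith
    linarith
  · intro h
    refine le_of_forall_pos_le_add fun ε hε => ?_
    obtain ⟨_, ⟨s, hs, rfl⟩, hlt⟩ := exists_lt_of_csInf_lt ⟨_, Set.mem_image_of_mem _ Set.self_mem_Ici⟩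
      (lt_of_le_of_lt h (lt_add_of_pos_right R hε))
    have hs1 : (1 : ℝ) ≤ s := hs
    have hs0 : 0 < s := one_pos.trans_le hs1
    have hle := hR.2 ⟨1 / s, ⟨by positivity, (div_le_one hs0).2 hs1⟩, rfl⟩
    simp only at hle hlt
    rw [← div_one_add_eq hs0] at hle
    have h1 : 1 / s * (s * E - ε) ≤ 1 / s * (R - G (s / (1 + s))) :=
      mul_le_mul_of_nonneg_left (by linarith) (by positivity)
    have h2 : 1 / s * (s * E - ε) = E - 1 / s * ε := by field_simp
    have h3 : 1 / s * ε ≤ ε := mul_le_of_le_one_left hε.le ((div_le_one hs0).2 hs1)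
    linarith

end Threshold

section Region

variable {X Y : Type*} [Fintype X] [Fintype Y] [DecidableEq X] [DecidableEq Y]

lemma mixGallager_nonneg {Z₁ Z₂ Z₃ B₁ B₂ B₃ : Type*} [Fintype Z₁] [Fintype Z₂] [Fintype Z₃]
    [Fintype B₁] [DecidableEq B₁] [Fintype B₂] [DecidableEq B₂] [Fintype B₃] [DecidableEq B₃]
    (π₁ : Z₁ → B₁) (π₂ : Z₂ → B₂) (π₃ : Z₃ → B₃) {p₁ : Z₁ → ℝ} {p₂ : Z₂ → ℝ} {p₃ : Z₃ → ℝ}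
    (hp₁ : p₁ ∈ stdSimplex ℝ Z₁) (hp₂ : p₂ ∈ stdSimplex ℝ Z₂) (hp₃ : p₃ ∈ stdSimplex ℝ Z₃) {δ : ℝ}
    (hδ : δ ∈ Set.Icc (0 : ℝ) 1) {ρ : ℝ} (hρ : 0 ≤ ρ) :
    0 ≤ mixGallager π₁ π₂ π₃ p₁ p₂ p₃ δ ρ :=
  add_nonneg (add_nonneg (mul_nonneg hδ.1 (gallagerFn_nonneg π₁ hp₁ hρ))
    (mul_nonneg (sub_nonneg.2 hδ.2) (gallagerFn_nonneg π₂ hp₂ hρ)))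
    (mul_nonneg hδ.1 (gallagerFn_nonneg π₃ hp₃ hρ))

variable {P : X × Y → ℝ} {δ : ℝ}

lemma isGreatest_gallagerExp_mixX (hP : P ∈ stdSimplex ℝ (X × Y)) (hδ : δ ∈ Set.Icc (0 : ℝ) 1)
    (R : ℝ) : IsGreatest (gallagerSet (mixX P δ) R) (gallagerExp (mixX P δ) R) := by
  obtain ⟨_, -, h, -⟩ := exists_tilt_gallagerExp id Prod.snd (fun _ => ()) (margSnd_mem hP) hP
    (margFst_mem hP) hδ (fun ρ hρ => mul_mixX hP δ hρ) R
  exact h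

lemma isGreatest_gallagerExp_mixY (hP : P ∈ stdSimplex ℝ (X × Y)) (hδ : δ ∈ Set.Icc (0 : ℝ) 1)
    (R : ℝ) : IsGreatest (gallagerSet (mixY P δ) R) (gallagerExp (mixY P δ) R) := by
  obtain ⟨_, -, h, -⟩ := exists_tilt_gallagerExp (fun _ => ()) Prod.fst id (margSnd_mem hP) hP
    (margFst_mem hP) hδ (fun ρ hρ => mul_mixY hP δ hρ) R
  exact h

lemma isGreatest_gallagerExp_mixXY (hP : P ∈ stdSimplex ℝ (X × Y)) (hδ : δ ∈ Set.Icc (0 : ℝ) 1)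
    (R : ℝ) : IsGreatest (gallagerSet (mixXY P δ) R) (gallagerExp (mixXY P δ) R) := by
  obtain ⟨_, -, h, -⟩ := exists_tilt_gallagerExp (fun _ => ()) (fun _ => ()) (fun _ => ())
    (margSnd_mem hP) hP (margFst_mem hP) hδ (fun ρ hρ => mul_mixXY hP δ hρ) R
  exact h

/-- The rates with a prescribed exponent. The thresholds are nonnegative, so the constraints
`0 ≤ R_x` and `0 ≤ R_y` are implied. -/
lemma setOf_le_minExponent (hP : P ∈ stdSimplex ℝ (X × Y)) (hδ : δ ∈ Set.Icc (0 : ℝ) 1) {E : ℝ}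
    (hE : 0 < E) :
    {R : ℝ × ℝ | 0 ≤ R.1 ∧ 0 ≤ R.2 ∧ E ≤ minExponent P δ R.1 R.2} =
      {R : ℝ × ℝ | rateThreshold (mixX P δ) E ≤ R.1 ∧ rateThreshold (mixY P δ) E ≤ R.2 ∧
        rateThreshold (mixXY P δ) E ≤ R.1 + R.2} := by
  have hPX := margFst_mem hP
  have hPY := margSnd_mem hP
  have hGx : ∀ ρ, 0 ≤ ρ → 0 ≤ ρ * mixX P δ (1 / (1 + ρ)) := fun ρ hρ => by
    rw [mul_mixX hP δ hρ]
    exact mixGallager_nonneg _ _ _ hPY hP hPX hδ hρ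
  have hGy : ∀ ρ, 0 ≤ ρ → 0 ≤ ρ * mixY P δ (1 / (1 + ρ)) := fun ρ hρ => by
    rw [mul_mixY hP δ hρ]
    exact mixGallager_nonneg _ _ _ hPY hP hPX hδ hρ
  have hGxy : ∀ ρ, 0 ≤ ρ → 0 ≤ ρ * mixXY P δ (1 / (1 + ρ)) := fun ρ hρ => by
    rw [mul_mixXY hP δ hρ]
    exact mixGallager_nonneg _ _ _ hPY hP hPX hδ hρ
  ext R
  simp only [Set.mem_ofPred_eq, minExponent, le_min_iff,
    le_gallagerExp_iff hGx hE (isGreatest_gallagerExp_mixX hP hδ _),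
    le_gallagerExp_iff hGy hE (isGreatest_gallagerExp_mixY hP hδ _),
    le_gallagerExp_iff hGxy hE (isGreatest_gallagerExp_mixXY hP hδ _)]
  exact ⟨fun h => h.2.2, fun h => ⟨(rateThreshold_nonneg hGx hE).trans h.1,
    (rateThreshold_nonneg hGy hE).trans h.2.1, h⟩⟩

end Region

end AsyncSW

end

theorem theorem1 {X Y : Type*} [Fintype X] [Fintype Y] [DecidableEq X] [DecidableEq Y]
    -- universal decoders, for all rates and block lengths, independent of the source and the delay
    (uDec : ∀ (Rx Ry : ℝ) (n : ℕ),
      AsyncSW.Decoder X Y n (AsyncSW.numBins n Rx) (AsyncSW.numBins n Ry))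
    (huDec : ∀ (Rx Ry : ℝ) (n : ℕ),
      AsyncSW.IsMetricDecoder (AsyncSW.qMetric Rx Ry) (uDec Rx Ry n))
    -- the source, the delays and the limiting relative delay
    (P : X × Y → ℝ) (hP : P ∈ stdSimplex ℝ (X × Y))
    (d : ∀ n : ℕ, Fin (n + 1)) (δ : ℝ)
    (hd : Tendsto (fun n : ℕ => ((d n : ℕ) : ℝ) / (n : ℝ)) atTop (𝓝 δ))
    -- non-degeneracy
    (hX : 0 < AsyncSW.entropy (AsyncSW.margFst P))
    (hY : 0 < AsyncSW.entropy (AsyncSW.margSnd P))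
    (hnd : (∀ᶠ n in atTop, 1 ≤ (d n : ℕ)) ∨
      (0 < AsyncSW.condEntropy P ∧ 0 < AsyncSW.condEntropy (AsyncSW.swapLaw P)))
    -- MAP decoders, for all rates and block lengths
    (mapDec : ∀ (Rx Ry : ℝ) (n : ℕ),
      AsyncSW.Decoder X Y n (AsyncSW.numBins n Rx) (AsyncSW.numBins n Ry))
    (hmapDec : ∀ (Rx Ry : ℝ) (n : ℕ), AsyncSW.IsMAPDecoder P (d n) (mapDec Rx Ry n)) :
    ∃ Estar Eq : ℝ → ℝ → ℝ,
      -- existence of both error exponents, their equality and the formula, with attained maxima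
      (∀ Rx Ry : ℝ, 0 ≤ Rx → 0 ≤ Ry →
        AsyncSW.HasErrorExponent (fun n => AsyncSW.errorProb P (d n) (mapDec Rx Ry n))
          (Estar Rx Ry) ∧
        AsyncSW.HasErrorExponent (fun n => AsyncSW.errorProb P (d n) (uDec Rx Ry n))
          (Eq Rx Ry) ∧
        Eq Rx Ry = Estar Rx Ry ∧
        Estar Rx Ry =
          min (AsyncSW.gallagerExp (AsyncSW.mixX P δ) Rx)
            (min (AsyncSW.gallagerExp (AsyncSW.mixY P δ) Ry)
              (AsyncSW.gallagerExp (AsyncSW.mixXY P δ) (Rx + Ry))) ∧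
        IsGreatest (AsyncSW.gallagerSet (AsyncSW.mixX P δ) Rx)
          (AsyncSW.gallagerExp (AsyncSW.mixX P δ) Rx) ∧
        IsGreatest (AsyncSW.gallagerSet (AsyncSW.mixY P δ) Ry)
          (AsyncSW.gallagerExp (AsyncSW.mixY P δ) Ry) ∧
        IsGreatest (AsyncSW.gallagerSet (AsyncSW.mixXY P δ) (Rx + Ry))
          (AsyncSW.gallagerExp (AsyncSW.mixXY P δ) (Rx + Ry))) ∧
      -- the rate region for a prescribed exponent
      (∀ E : ℝ, 0 < E →
        {R : ℝ × ℝ | 0 ≤ R.1 ∧ 0 ≤ R.2 ∧ E ≤ Estar R.1 R.2} =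
          {R : ℝ × ℝ | AsyncSW.rateThreshold (AsyncSW.mixX P δ) E ≤ R.1 ∧
            AsyncSW.rateThreshold (AsyncSW.mixY P δ) E ≤ R.2 ∧
            AsyncSW.rateThreshold (AsyncSW.mixXY P δ) E ≤ R.1 + R.2} ∧
        {R : ℝ × ℝ | 0 ≤ R.1 ∧ 0 ≤ R.2 ∧ E ≤ Eq R.1 R.2} =
          {R : ℝ × ℝ | AsyncSW.rateThreshold (AsyncSW.mixX P δ) E ≤ R.1 ∧
            AsyncSW.rateThreshold (AsyncSW.mixY P δ) E ≤ R.2 ∧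
            AsyncSW.rateThreshold (AsyncSW.mixXY P δ) E ≤ R.1 + R.2}) := by
  have hδ := AsyncSW.delay_limit_mem hd
  refine ⟨AsyncSW.minExponent P δ, AsyncSW.minExponent P δ, fun Rx Ry hRx hRy => ?_, fun E hE =>
    ⟨AsyncSW.setOf_le_minExponent hP hδ hE, AsyncSW.setOf_le_minExponent hP hδ hE⟩⟩
  have hup := fun {ε : ℝ} (hε : 0 < ε) =>
    AsyncSW.errorProb_universal_le_exponent hP hd hRx hRy (huDec Rx Ry) hε
  refine ⟨AsyncSW.hasErrorExponent_of_bounds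
      (AsyncSW.expLowerBound_minExponent hP hd hX hY hnd hRx hRy (mapDec Rx Ry)) fun ε hε => ?_,
    AsyncSW.hasErrorExponent_of_bounds
      (AsyncSW.expLowerBound_minExponent hP hd hX hY hnd hRx hRy (uDec Rx Ry)) fun ε hε => hup hε,
    rfl, rfl, AsyncSW.isGreatest_gallagerExp_mixX hP hδ Rx,
    AsyncSW.isGreatest_gallagerExp_mixY hP hδ Ry,
    AsyncSW.isGreatest_gallagerExp_mixXY hP hδ (Rx + Ry)⟩
  filter_upwards [hup hε] with n hn
  exact (AsyncSW.errorProb_map_le hP (d n) (hmapDec Rx Ry n) (uDec Rx Ry n)).trans hn
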